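/- Let $n\ge 2$ and let $X\subset\mathbb R^n$ be a bounded domain with smooth boundary and outward unit normal $\nu(x)$. Put $\Gamma_\pm=\{(x,\theta)\in\partial X\times S^{n-1}:\pm\,\theta\cdot \nu(x)>0\}$, with the product of the surface measures, and write $\tilde\varphi(x,\theta)=\varphi(x,-\theta)$. Coefficients. For $\sigma\in L^\infty(X)$ and a continuous $k:X\times S^{n-1}\times S^{n-1}\to\mathbb R$ put $\rho=\big\|\int_{S^{n-1}}|k(x,\theta,\theta')|\,d\theta'\big\|_{L^\infty(X\times S^{n-1})}$, and let $\tau$ be the supremum of the lengths of the segments in which lines meet $X$ (each segment being a connected component of the intersection). For $M\in\mathbb R$, $\alpha>0$ call $(\sigma,k)$ *$(M,\alpha)$-admissible* if $0\le\sigma\le M$ a.e., $k(x,\theta,\theta')=k(x,-\theta',-\theta)$, and either $\sigma-\rho\ge\alpha$ a.e. or $\tau\rho\le 1-\alpha$. Put $$Au=-\sigma u+\int_{S^{n-1}}k(x,\theta,\theta')u(x,\theta')\,d\theta',\qquad A^*v=-\sigma v+\int_{S^{n-1}}k(x,\theta',\theta)v(x,\theta')\,d\theta'.$$ Equations. All solutions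 are in $L^\infty(X\times S^{n-1})$, and the equations and boundary values are understood in the integrated sense along almost every line. The albedo operator is $\mathcal A(f)=u|_{\Gamma_+}\in L^\infty(\Gamma_+)$, where $\theta\cdot\nabla u=Au$ and $u|_{\Gamma_-}=f$. For $\varepsilon>0$, $q\in\mathbb R^n$, $\varphi\in\{0,\pi/2\}$ let $\mathcal A_\varepsilon(q,\varphi)$ be the albedo operator of the modulated coefficients $(1+\varepsilon\cos(q\cdot x+\varphi))\sigma$ and $(1+\varepsilon\cos(q\cdot x+\varphi))k$; for fixed $f$, $\mathcal A_\varepsilon(f)$ denotes the map $(q,\varphi)\mapsto\mathcal A_\varepsilon(q,\varphi)(f)$. Let $f,g\in L^\infty(\Gamma_-)$. For admissible $(\sigma,k)$ let $u$ solve $\theta\cdot\nabla u=Au$, $u|_{\Gamma_-}=f$, let $v$ solve the adjoint equation $-\theta\cdot\nabla v=A^*v$, $v|_{\Gamma_+}=\tilde g$, and put $$H(x)=\int_{S^{n-1}}(Au)(x,\theta)\,v(x,\theta)\,d\theta,\qquad \widehat H(q)=\int_X H(x)e^{-iq\cdot x}\,dx .$$ **(1) The data determine $H$ to first order.** The integral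 defining $H(x)$ converges for a.e. $x$, and $H\in L^\infty(X)$. There are maps $R_\varepsilon$, depending only on $X,f,g,\varepsilon$ and not on the coefficients, that take the data $(\mathcal A_\varepsilon(f),\mathcal A(g))$ to functions of $q$, such that for all $M$ and $\alpha>0$ there are $C,\varepsilon_0>0$ with $$\big|\widehat H(q)-R_\varepsilon\big(\mathcal A_\varepsilon(f),\mathcal A(g)\big)(q)\big|\le C\varepsilon\qquad\text{for all }q\in\mathbb R^n,\ 0<\varepsilon<\varepsilon_0,$$ and all $(M,\alpha)$-admissible $(\sigma,k)$. **(2) Stability.** There is a constant $C$ depending only on $X$ such that the following holds for all $f,g\in L^\infty(\Gamma_-)$, all $M$, and all $\alpha>0$. Let $H_1,H_2$ be the functionals obtained from the same $f,g$ and two $(M,\alpha)$-admissible pairs $(\sigma_1,k_1)$, $(\sigma_2,k_2)$, with albedo operators $\mathcal A^j$, $\mathcal A^j_\varepsilon$. (a) There are $C',\varepsilon_0>0$, depending only on $X,f,g,M,\alpha$, such that for all such pairs, all $q\in\mathbb R^n$ and $0<\varepsilon<\varepsilon_0$, $$|\widehat H_1(q)-\widehat H_2(q)|\le\frac C\varepsilon\Big(\|g\|_{L^1(\Gamma_-)}\sum_{\varphi\in\{0,\pi/2\}}\|\mathcal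 A^1_\varepsilon(q,\varphi)(f)-\mathcal A^2_\varepsilon(q,\varphi)(f)\|_{L^\infty(\Gamma_+)}+\|f\|_{L^1(\Gamma_-)}\|\mathcal A^1(g)-\mathcal A^2(g)\|_{L^\infty(\Gamma_+)}\Big)+C'\varepsilon .$$ (b) For each two such pairs, as $\varepsilon\to0$, $$\|H_1-H_2\|_{L^\infty(X)}\le C\Big(\frac1\varepsilon\|g\|_{L^1(\Gamma_-)}\|\mathcal A^1_\varepsilon(f)-\mathcal A^2_\varepsilon(f)\|_{L^1(\mathbb R^n\times\{0,\pi/2\},\,L^\infty(\Gamma_+))}+\|f\|_{L^1(\Gamma_-)}\|\mathcal A^1(g)-\mathcal A^2(g)\|_{L^\infty(\Gamma_+)}\Big)+O(\varepsilon),$$ where the norm of the modulated data may be $+\infty$ (with $0\cdot\infty=0$), and the constant in $O(\varepsilon)$ and the range of $\varepsilon$ may depend on $X,f,g$ and the two pairs of coefficients. -/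

import Mathlib

open MeasureTheory Set Topology

namespace AcoustoOptic

noncomputable section

/-- Euclidean space `ℝⁿ`. -/
abbrev Pos (n : ℕ) : Type := EuclideanSpace ℝ (Fin n)

/-- The unit sphere `S^{n-1}` of directions. -/
abbrev Dir (n : ℕ) : Type := Metric.sphere (0 : Pos n) 1

/-! ### The domain and its boundary -/

/-- `ρ` is a smooth defining function of `X` near the point `p`: it has a nonzero gradient at `p`
and `X = {ρ < 0}` in a neighbourhood of `p`. -/
structure IsDefiningFunctionAt {n : ℕ} (X : Set (Pos n)) (p : Pos n) (ρ : Pos n → ℝ) : Prop where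
  smooth : ContDiff ℝ (⊤ : ℕ∞) ρ
  gradient_ne_zero : gradient ρ p ≠ 0
  mem_iff : ∀ᶠ x in 𝓝 p, x ∈ X ↔ ρ x < 0

/-- The boundary of `X` is a smooth hypersurface, with `X` locally on one side of it. -/
def HasSmoothBoundary {n : ℕ} (X : Set (Pos n)) : Prop :=
  ∀ p ∈ frontier X, ∃ ρ : Pos n → ℝ, IsDefiningFunctionAt X p ρ

/-- A bounded domain (open, connected and non-empty) with smooth boundary. -/
structure IsSmoothBoundedDomain {n : ℕ} (X : Set (Pos n)) : Prop where
  isOpen : IsOpen X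
  isConnected : IsConnected X
  isBounded : Bornology.IsBounded X
  smoothBoundary : HasSmoothBoundary X

/-- `ν` is the outward unit normal vector of `X` at the boundary point `p`. -/
def IsOutwardUnitNormal {n : ℕ} (X : Set (Pos n)) (p ν : Pos n) : Prop :=
  ∃ ρ : Pos n → ℝ, IsDefiningFunctionAt X p ρ ∧ ν = ‖gradient ρ p‖⁻¹ • gradient ρ p

/-- The incoming boundary `Γ₋ = {(x, θ) ∈ ∂X × S^{n-1} : θ · n(x) < 0}`. -/
def inflowSet {n : ℕ} (X : Set (Pos n)) : Set (Pos n × Dir n) :=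
  {z | z.1 ∈ frontier X ∧ ∃ ν, IsOutwardUnitNormal X z.1 ν ∧ inner ℝ (z.2 : Pos n) ν < 0}

/-- The outgoing boundary `Γ₊ = {(x, θ) ∈ ∂X × S^{n-1} : θ · n(x) > 0}`. -/
def outflowSet {n : ℕ} (X : Set (Pos n)) : Set (Pos n × Dir n) :=
  {z | z.1 ∈ frontier X ∧ ∃ ν, IsOutwardUnitNormal X z.1 ν ∧ 0 < inner ℝ (z.2 : Pos n) ν}

/-! ### Measures -/

/-- The surface measure `dθ` on the unit sphere. -/
def sphereMeasure (n : ℕ) : Measure (Dir n) := (volume : Measure (Pos n)).toSphere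

/-- The measure `dx dθ` on `X × S^{n-1}`. -/
def phaseMeasure {n : ℕ} (X : Set (Pos n)) : Measure (Pos n × Dir n) :=
  (volume.restrict X).prod (sphereMeasure n)

/-- Surface measure on `∂X` times `dθ`, on `∂X × S^{n-1}`. The surface measure is the
`(n-1)`-dimensional Hausdorff measure, in the Euclidean normalization. -/
def boundaryMeasure {n : ℕ} (X : Set (Pos n)) : Measure (Pos n × Dir n) :=
  ((Measure.euclideanHausdorffMeasure (n - 1) : Measure (Pos n)).restrict (frontier X)).prod
    (sphereMeasure n)

/-- The measure on `Γ₋`. -/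
def inflowMeasure {n : ℕ} (X : Set (Pos n)) : Measure (Pos n × Dir n) :=
  (boundaryMeasure X).restrict (inflowSet X)

/-- The measure on `Γ₊`. -/
def outflowMeasure {n : ℕ} (X : Set (Pos n)) : Measure (Pos n × Dir n) :=
  (boundaryMeasure X).restrict (outflowSet X)

/-! ### Straight lines through the domain -/

/-- The reflection `φ ↦ φ̃`, `φ̃(x, θ) = φ(x, -θ)`. -/
def reflect {n : ℕ} (φ : Pos n × Dir n → ℝ) : Pos n × Dir n → ℝ := fun z => φ (z.1, -z.2)

/-- `τ₊(x, θ)`: the distance from `x` to the boundary in the direction `θ`. -/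
def tauPlus {n : ℕ} (X : Set (Pos n)) (z : Pos n × Dir n) : ℝ :=
  sInf {t : ℝ | 0 < t ∧ z.1 + t • (z.2 : Pos n) ∉ X}

/-- `τ₋(x, θ)`: the distance from `x` to the boundary in the direction `-θ`. -/
def tauMinus {n : ℕ} (X : Set (Pos n)) (z : Pos n × Dir n) : ℝ :=
  sInf {t : ℝ | 0 < t ∧ z.1 - t • (z.2 : Pos n) ∉ X}

/-- The boundary point `(x + τ₊ θ, θ)`, at which the line through `(x, θ)` leaves `X`. -/
def exitPoint {n : ℕ} (X : Set (Pos n)) (z : Pos n × Dir n) : Pos n × Dir n :=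
  (z.1 + tauPlus X z • (z.2 : Pos n), z.2)

/-- The boundary point `(x - τ₋ θ, θ)`, at which the line through `(x, θ)` enters `X`. -/
def entryPoint {n : ℕ} (X : Set (Pos n)) (z : Pos n × Dir n) : Pos n × Dir n :=
  (z.1 - tauMinus X z • (z.2 : Pos n), z.2)

/-- `θ · ∇u = w` in `X × S^{n-1}` and `u = f` on `Γ₋`: on almost every line, `u` is the primitive
of `w` in the direction `θ` that starts from the value of `f` at the point of entry. -/
def TransportFromInflow {n : ℕ} (X : Set (Pos n)) (u w f : Pos n × Dir n → ℝ) : Prop :=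
  ∀ᵐ z ∂(phaseMeasure X), u z = f (entryPoint X z) +
    ∫ s in (0 : ℝ)..(tauMinus X z), w (z.1 - s • (z.2 : Pos n), z.2)

/-- `θ · ∇u = w` in `X × S^{n-1}` and `u = h` on `Γ₊`: on almost every line, `u` is the primitive
of `w` in the direction `θ` that ends with the value of `h` at the point of exit. -/
def TransportToOutflow {n : ℕ} (X : Set (Pos n)) (u w h : Pos n × Dir n → ℝ) : Prop :=
  ∀ᵐ z ∂(phaseMeasure X), u z = h (exitPoint X z) -
    ∫ s in (0 : ℝ)..(tauPlus X z), w (z.1 + s • (z.2 : Pos n), z.2)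

/-! ### Coefficients and the radiative transport equation -/

/-- `ρ = ‖∫ |k(x, θ, θ')| dθ'‖_{L^∞(X × S^{n-1})}`, an extended nonnegative number. -/
def scatteringBound {n : ℕ} (X : Set (Pos n)) (k : Pos n → Dir n → Dir n → ℝ) : ENNReal :=
  essSup (fun z : Pos n × Dir n => ∫⁻ θ', ‖k z.1 z.2 θ'‖ₑ ∂(sphereMeasure n)) (phaseMeasure X)

/-- `τ`, the supremum of the lengths `τ₋ + τ₊` of the segments cut out of `X` by lines. -/
def maxChordLength {n : ℕ} (X : Set (Pos n)) : ENNReal :=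
  ⨆ z ∈ X ×ˢ (univ : Set (Dir n)), ENNReal.ofReal (tauMinus X z + tauPlus X z)

/-- The standing assumptions on the attenuation `σ` and the scattering kernel `k`, with explicit
constants: `0 ≤ σ ≤ M`; `k` is continuous and obeys the reciprocity relation; and either the
absorption condition `σ - ρ ≥ α` or the smallness condition `τ ρ ≤ 1 - α` holds. The pair `(σ, k)`
satisfies the assumptions with some constants `M` and `α > 0` exactly if `σ ∈ L^∞(X)`, `σ ≥ 0`, and
either `σ - ρ` is bounded below by a positive constant or `τ ρ < 1`. -/
structure IsAdmissible {n : ℕ} (X : Set (Pos n)) (M α : ℝ) (σ : Pos n → ℝ)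
    (k : Pos n → Dir n → Dir n → ℝ) : Prop where
  measurable : AEStronglyMeasurable σ (volume.restrict X)
  nonneg : ∀ᵐ x ∂(volume.restrict X), 0 ≤ σ x
  le_bound : ∀ᵐ x ∂(volume.restrict X), σ x ≤ M
  continuous : ContinuousOn (fun p : Pos n × Dir n × Dir n => k p.1 p.2.1 p.2.2) (X ×ˢ univ)
  reciprocity : ∀ x ∈ X, ∀ θ θ' : Dir n, k x θ θ' = k x (-θ') (-θ)
  solvability :
    (∀ᵐ x ∂(volume.restrict X), scatteringBound X k + ENNReal.ofReal α ≤ ENNReal.ofReal (σ x)) ∨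
      maxChordLength X * scatteringBound X k + ENNReal.ofReal α ≤ 1

/-- `A u = -σ u + ∫ k(x, θ, θ') u(x, θ') dθ'`. -/
def collision {n : ℕ} (σ : Pos n → ℝ) (k : Pos n → Dir n → Dir n → ℝ)
    (u : Pos n × Dir n → ℝ) : Pos n × Dir n → ℝ :=
  fun z => -(σ z.1 * u z) + ∫ θ', k z.1 z.2 θ' * u (z.1, θ') ∂(sphereMeasure n)

/-- The formal adjoint of `A` in `L²(S^{n-1})`:
`A* v = -σ v + ∫ k(x, θ', θ) v(x, θ') dθ'`. -/
def collisionAdjoint {n : ℕ} (σ : Pos n → ℝ) (k : Pos n → Dir n → Dir n → ℝ)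
    (v : Pos n × Dir n → ℝ) : Pos n × Dir n → ℝ :=
  collision σ (fun x θ θ' => k x θ' θ) v

/-- `u ∈ L^∞(X × S^{n-1})` solves `θ · ∇u = A u` with `u = f` on `Γ₋`. -/
def IsRTESolution {n : ℕ} (X : Set (Pos n)) (σ : Pos n → ℝ) (k : Pos n → Dir n → Dir n → ℝ)
    (f u : Pos n × Dir n → ℝ) : Prop :=
  MemLp u ⊤ (phaseMeasure X) ∧ TransportFromInflow X u (collision σ k u) f

/-- `v ∈ L^∞(X × S^{n-1})` solves the adjoint equation `-θ · ∇v = A* v` with `v = b` on `Γ₊`. -/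
def IsAdjointRTESolution {n : ℕ} (X : Set (Pos n)) (σ : Pos n → ℝ)
    (k : Pos n → Dir n → Dir n → ℝ) (b v : Pos n × Dir n → ℝ) : Prop :=
  MemLp v ⊤ (phaseMeasure X) ∧ TransportToOutflow X v (fun z => -collisionAdjoint σ k v z) b

/-- `h = 𝒜(f) ∈ L^∞(Γ₊)` for the albedo operator `𝒜` with coefficients `σ, k`: the function `h` is
the trace on `Γ₊` of the solution of the transport equation that equals `f` on `Γ₋`. -/
def IsAlbedo {n : ℕ} (X : Set (Pos n)) (σ : Pos n → ℝ) (k : Pos n → Dir n → Dir n → ℝ)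
    (f h : Pos n × Dir n → ℝ) : Prop :=
  MemLp h ⊤ (outflowMeasure X) ∧
    ∃ u, IsRTESolution X σ k f u ∧ TransportToOutflow X u (collision σ k u) h

/-! ### Acoustic modulation -/

/-- The modulation factor `1 + ε cos(q · x + φ)`. -/
def modulation {n : ℕ} (ε : ℝ) (q : Pos n) (φ : ℝ) (x : Pos n) : ℝ :=
  1 + ε * Real.cos (inner ℝ q x + φ)

/-- The two phases that are used. -/
def phases : Finset ℝ := {0, Real.pi / 2}

/-- `a q φ = 𝒜_ε(q, φ)(f)` for all wave vectors `q` and for the phases `φ = 0` and `φ = π / 2`. -/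
def IsModulatedAlbedo {n : ℕ} (X : Set (Pos n)) (σ : Pos n → ℝ) (k : Pos n → Dir n → Dir n → ℝ)
    (ε : ℝ) (f : Pos n × Dir n → ℝ) (a : Pos n → ℝ → Pos n × Dir n → ℝ) : Prop :=
  ∀ q : Pos n, ∀ φ ∈ phases,
    IsAlbedo X (fun x => modulation ε q φ x * σ x)
      (fun x θ θ' => modulation ε q φ x * k x θ θ') f (a q φ)

/-- `‖a‖_{L¹(ℝⁿ × {0, π / 2}, L^∞(Γ₊))}`. -/
def modulatedNorm {n : ℕ} (X : Set (Pos n)) (a : Pos n → ℝ → Pos n × Dir n → ℝ) : ENNReal :=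
  ∑ φ ∈ phases, ∫⁻ q : Pos n, eLpNorm (a q φ) ⊤ (outflowMeasure X)

/-! ### The internal functional -/

/-- `H(x) = ∫ (A u)(x, θ) v(x, θ) dθ`. -/
def internalFunctional {n : ℕ} (σ : Pos n → ℝ) (k : Pos n → Dir n → Dir n → ℝ)
    (u v : Pos n × Dir n → ℝ) (x : Pos n) : ℝ :=
  ∫ θ, collision σ k u (x, θ) * v (x, θ) ∂(sphereMeasure n)

/-- The Fourier transform `∫_X H(x) e^{-i q · x} dx` of `H`, extended by zero outside `X`. -/
def fourierOn {n : ℕ} (X : Set (Pos n)) (H : Pos n → ℝ) (q : Pos n) : ℂ :=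
  ∫ x in X, (H x : ℂ) * Complex.exp (-(Complex.I * ((inner ℝ q x : ℝ) : ℂ)))

/-- One experiment with boundary data `f, g` in a medium with admissible coefficients `σ, k`:
`u` solves the transport equation with `u = f` on `Γ₋`, `v` solves the adjoint equation with
`v = g̃` on `Γ₊`, and `b = 𝒜(g)`. -/
structure IsExperiment {n : ℕ} (X : Set (Pos n)) (M α : ℝ) (f g : Pos n × Dir n → ℝ)
    (σ : Pos n → ℝ) (k : Pos n → Dir n → Dir n → ℝ) (u v b : Pos n × Dir n → ℝ) : Prop where
  admissible : IsAdmissible X M α σ k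
  forward : IsRTESolution X σ k f u
  adjoint : IsAdjointRTESolution X σ k (reflect g) v
  albedo : IsAlbedo X σ k g b

end

end AcoustoOptic

open AcoustoOptic

namespace AcoustoOptic

/-! Let `u_ε` solve the modulated equation with inflow data `f`, and let `v` be the adjoint
solution. Both coefficients are multiplied by the same factor `m = 1 + ε cos(q·x + φ)`, so the
modulated collision operator is `m A`. Integrating `θ·∇(u_ε v)` over phase space and using the
duality of `A` and `A*` leaves `∫ (m - 1)(A u_ε) v`. This is `ε ∫ H cos(q·x + φ) + O(ε²)`, because
`u_ε - u = O(ε)`. The boundary side is known from the data: on `Γ₊` it pairs `𝒜_ε(f)` with `g̃`; on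
`Γ₋` it pairs `f` with the trace of `v`, and by reciprocity `ṽ` is a forward solution with data `g`,
so that this trace is the reflection of `𝒜(g)`. Since `e^{-iq·x} = cos(q·x) + i cos(q·x + π/2)`,
dividing by `ε` and combining the two phases gives `R_ε` and the estimate (a). The core is
`boundary_identity` and `exists_first_order`.

Green's formula is obtained line by line: on a chord it is the product rule for absolutely
continuous functions, and `integral_phase_eq` averages it over chords because the motion along lines
preserves measure. Boundary fluxes thus appear as phase-space integrals of the values at exit
points, weighted by the inverse chord length. Only their bound by `L¹(Γ±)` norms is needed
(`lintegral_exitPoint_le`), and it follows from orthogonal projections being 1-Lipschitz.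

The uniform `L^∞` bounds treat both solvability conditions at once, in the form `∫ |k| dθ' ≤ c σ +
d` with `c + T d ≤ κ < 1`, where `T` bounds the chords. Where `|u| > c ‖u‖`, absorption outweighs
the part `c σ` of the scattering, so `|u|` grows at rate at most `d ‖u‖` along the line. Hence `‖u‖
≤ F + κ ‖u‖` for boundary data bounded by `F`.

For (b), an error `O(ε)` at each `q` is not integrable over `ℝⁿ`. But for a fixed pair, `H₁ - H₂` is
bounded by twice the integral of its Fourier transform over some large ball, where the error
integrates to `O(ε)`. The pairing of `f` with the difference of the `𝒜(g)` does not depend on `q`;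
if the modulated term is finite, the Riemann-Lebesgue lemma forces this pairing to be `O(ε²)`. -/

variable {n : ℕ} {X : Set (Pos n)}

/-! ### Motion along lines and reversal of direction. -/

/-- Translation by the length `s` along the line through `z = (x, θ)`. -/
noncomputable def flow (s : ℝ) (z : Pos n × Dir n) : Pos n × Dir n := (z.1 + s • (z.2 : Pos n), z.2)

/-- The reversal of direction. -/
noncomputable def rev (z : Pos n × Dir n) : Pos n × Dir n := (z.1, -z.2)

@[simp] lemma rev_fst (z : Pos n × Dir n) : (rev z).1 = z.1 := rfl
@[simp] lemma rev_snd (z : Pos n × Dir n) : (rev z).2 = -z.2 := rfl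
@[simp] lemma rev_rev (z : Pos n × Dir n) : rev (rev z) = z := by simp [rev]
@[simp] lemma flow_fst (s : ℝ) (z : Pos n × Dir n) : (flow s z).1 = z.1 + s • (z.2 : Pos n) := rfl
@[simp] lemma flow_snd (s : ℝ) (z : Pos n × Dir n) : (flow s z).2 = z.2 := rfl
@[simp] lemma flow_zero (z : Pos n × Dir n) : flow 0 z = z := by simp [flow]

lemma flow_flow (s t : ℝ) (z : Pos n × Dir n) : flow s (flow t z) = flow (t + s) z := by
  simp [flow, add_smul, add_assoc]

lemma norm_dir (θ : Dir n) : ‖(θ : Pos n)‖ = 1 := by simp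

lemma flow_rev (s : ℝ) (z : Pos n × Dir n) : flow s (rev z) = rev (flow (-s) z) := by
  simp [flow, rev]

lemma continuous_flow : Continuous fun p : (Pos n × Dir n) × ℝ => flow p.2 p.1 := by
  unfold flow; fun_prop

lemma continuous_flow_left (z : Pos n × Dir n) : Continuous fun s => flow s z :=
  continuous_flow.comp (by fun_prop : Continuous fun s : ℝ => (z, s))

lemma continuous_rev : Continuous (rev : Pos n × Dir n → _) := by unfold rev; fun_prop

/-- Reversal turns entry into exit, so that only exits have to be studied. -/
lemma tauMinus_eq (z : Pos n × Dir n) : tauMinus X z = tauPlus X (rev z) := by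
  simp [tauMinus, tauPlus, rev, sub_eq_add_neg]

lemma tauPlus_eq (z : Pos n × Dir n) : tauPlus X z = tauMinus X (rev z) := by
  simp [tauMinus_eq]

lemma exitPoint_eq (z : Pos n × Dir n) : exitPoint X z = flow (tauPlus X z) z := rfl

lemma entryPoint_eq (z : Pos n × Dir n) : entryPoint X z = flow (-tauMinus X z) z := by
  simp [entryPoint, flow, sub_eq_add_neg]

lemma entryPoint_eq_rev (z : Pos n × Dir n) : entryPoint X z = rev (exitPoint X (rev z)) := by
  rw [entryPoint_eq, exitPoint_eq, flow_rev, rev_rev, tauMinus_eq]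

/-- The length of the chord through `z`. -/
noncomputable def chord (X : Set (Pos n)) (z : Pos n × Dir n) : ℝ := tauMinus X z + tauPlus X z

lemma chord_rev (z : Pos n × Dir n) : chord X (rev z) = chord X z := by
  rw [chord, chord, tauMinus_eq, rev_rev, tauPlus_eq (rev z), rev_rev, add_comm]

/-! ### Chords of the domain: entry and exit times. -/

section Lines

variable (ho : IsOpen X) (hb : Bornology.IsBounded X)

include hb in
lemma exists_exit (z : Pos n × Dir n) : ({t : ℝ | 0 < t ∧ z.1 + t • (z.2 : Pos n) ∉ X}).Nonempty := by
  obtain ⟨R, hR⟩ := hb.subset_closedBall z.1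
  refine ⟨|R| + 1, by positivity, fun h => ?_⟩
  have := hR h
  simp [norm_smul] at this
  have h2 : |(|R| + 1)| = |R| + 1 := abs_of_pos (by positivity)
  rw [h2] at this
  linarith [le_abs_self R]

lemma bddBelow_exit (z : Pos n × Dir n) : BddBelow {t : ℝ | 0 < t ∧ z.1 + t • (z.2 : Pos n) ∉ X} :=
  ⟨0, fun _ h => h.1.le⟩

lemma tauPlus_nonneg (z : Pos n × Dir n) : 0 ≤ tauPlus X z :=
  Real.sInf_nonneg fun _ h => h.1.le

lemma tauMinus_nonneg (z : Pos n × Dir n) : 0 ≤ tauMinus X z :=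
  Real.sInf_nonneg fun _ h => h.1.le

lemma flow_mem_of_lt_tauPlus {z : Pos n × Dir n} (hz : z.1 ∈ X) {t : ℝ} (h0 : 0 ≤ t)
    (ht : t < tauPlus X z) : (flow t z).1 ∈ X := by
  rcases h0.eq_or_lt with rfl | h0
  · simpa
  · by_contra h
    exact absurd (csInf_le (bddBelow_exit z) ⟨h0, h⟩) (not_le.2 ht)

include ho hb in
lemma tauPlus_mem {z : Pos n × Dir n} (hz : z.1 ∈ X) :
    0 < tauPlus X z ∧ (flow (tauPlus X z) z).1 ∉ X := by
  -- Allowing `t = 0` changes nothing since the line starts in `X`, and it makes the set visibly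
  -- closed; so the infimum is attained.
  have hs : {t : ℝ | 0 < t ∧ z.1 + t • (z.2 : Pos n) ∉ X} =
      {t : ℝ | 0 ≤ t ∧ z.1 + t • (z.2 : Pos n) ∉ X} := by
    ext t
    refine ⟨fun h => ⟨h.1.le, h.2⟩, fun h => ⟨lt_of_le_of_ne h.1 ?_, h.2⟩⟩
    rintro rfl
    simp [hz] at h
  have hc : IsClosed {t : ℝ | 0 < t ∧ z.1 + t • (z.2 : Pos n) ∉ X} := by
    rw [hs]
    exact isClosed_Ici.inter (ho.isClosed_compl.preimage (by fun_prop :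
      Continuous fun t : ℝ => z.1 + t • (z.2 : Pos n)))
  exact hc.csInf_mem (exists_exit hb z) (bddBelow_exit z)

include ho hb in
lemma tauPlus_pos {z : Pos n × Dir n} (hz : z.1 ∈ X) : 0 < tauPlus X z := (tauPlus_mem ho hb hz).1

include ho hb in
lemma tauMinus_pos {z : Pos n × Dir n} (hz : z.1 ∈ X) : 0 < tauMinus X z := by
  rw [tauMinus_eq]; exact tauPlus_pos ho hb hz

include ho hb in
lemma chord_pos {z : Pos n × Dir n} (hz : z.1 ∈ X) : 0 < chord X z :=
  add_pos (tauMinus_pos ho hb hz) (tauPlus_pos ho hb hz)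

include ho hb in
lemma exitPoint_notMem {z : Pos n × Dir n} (hz : z.1 ∈ X) : (exitPoint X z).1 ∉ X :=
  (tauPlus_mem ho hb hz).2

lemma flow_mem {z : Pos n × Dir n} (hz : z.1 ∈ X) {t : ℝ} (h0 : -tauMinus X z < t)
    (ht : t < tauPlus X z) : (flow t z).1 ∈ X := by
  rcases le_total 0 t with h | h
  · exact flow_mem_of_lt_tauPlus hz h ht
  · rw [tauMinus_eq] at h0
    have := flow_mem_of_lt_tauPlus (X := X) (z := rev z) hz (t := -t) (by linarith) (by linarith)
    simpa [flow, rev] using this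

include ho hb in
lemma tauPlus_unique {z : Pos n × Dir n} (hz : z.1 ∈ X) {T : ℝ} (hT : 0 ≤ T)
    (h1 : ∀ t, 0 ≤ t → t < T → (flow t z).1 ∈ X) (h2 : (flow T z).1 ∉ X) : tauPlus X z = T := by
  refine le_antisymm (not_lt.1 fun h => h2 (flow_mem_of_lt_tauPlus hz hT h)) (not_lt.1 fun h => ?_)
  exact (tauPlus_mem ho hb hz).2 (h1 _ (tauPlus_nonneg z) h)

include ho hb in
lemma tauPlus_flow {z : Pos n × Dir n} (hz : z.1 ∈ X) {s : ℝ} (h0 : -tauMinus X z < s)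
    (hs : s < tauPlus X z) : tauPlus X (flow s z) = tauPlus X z - s := by
  refine tauPlus_unique ho hb (flow_mem hz h0 hs) (by linarith) (fun t ht ht' => ?_) ?_
  · rw [flow_flow]; exact flow_mem hz (by linarith) (by linarith)
  · rw [flow_flow, add_sub_cancel]; exact (tauPlus_mem ho hb hz).2

include ho hb in
lemma tauMinus_flow {z : Pos n × Dir n} (hz : z.1 ∈ X) {s : ℝ} (h0 : -tauMinus X z < s)
    (hs : s < tauPlus X z) : tauMinus X (flow s z) = tauMinus X z + s := by
  have : rev (flow s z) = flow (-s) (rev z) := by rw [flow_rev, neg_neg]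
  rw [tauMinus_eq, tauMinus_eq, this, tauPlus_flow ho hb (z := rev z) hz] <;>
    simp [tauMinus_eq] at * <;> linarith

include ho hb in
lemma chord_flow {z : Pos n × Dir n} (hz : z.1 ∈ X) {s : ℝ} (h0 : -tauMinus X z < s)
    (hs : s < tauPlus X z) : chord X (flow s z) = chord X z := by
  rw [chord, chord, tauMinus_flow ho hb hz h0 hs, tauPlus_flow ho hb hz h0 hs]; ring

include ho hb in
lemma entryPoint_flow {z : Pos n × Dir n} (hz : z.1 ∈ X) {s : ℝ} (h0 : -tauMinus X z < s)
    (hs : s < tauPlus X z) : entryPoint X (flow s z) = entryPoint X z := by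
  rw [entryPoint_eq, entryPoint_eq, tauMinus_flow ho hb hz h0 hs, flow_flow]; congr 1; ring

include ho hb in
lemma exitPoint_mem_frontier {z : Pos n × Dir n} (hz : z.1 ∈ X) :
    (exitPoint X z).1 ∈ frontier X := by
  rw [frontier, ho.interior_eq]
  refine ⟨?_, exitPoint_notMem ho hb hz⟩
  have hc : Continuous fun t : ℝ => (flow t z).1 := (continuous_flow_left z).fst
  have h1 : tauPlus X z ∈ closure (Ico 0 (tauPlus X z)) := by
    rw [closure_Ico (tauPlus_pos ho hb hz).ne]; exact ⟨tauPlus_nonneg z, le_rfl⟩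
  exact map_mem_closure (f := fun t => (flow t z).1) hc h1
    fun t ht => flow_mem_of_lt_tauPlus hz ht.1 ht.2

lemma tauPlus_le {D : ℝ} (hD : ∀ x ∈ X, ∀ y ∈ X, dist x y ≤ D) {z : Pos n × Dir n} (hz : z.1 ∈ X) :
    tauPlus X z ≤ D := by
  refine le_of_forall_lt fun c hc => ?_
  rcases lt_or_ge c 0 with h | h
  · exact h.trans_le (by simpa using hD _ hz _ hz)
  · obtain ⟨c', h1, h2⟩ := exists_between hc
    have := hD _ hz _ (flow_mem_of_lt_tauPlus hz (h.trans h1.le) h2)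
    simp [norm_smul, abs_of_pos (h.trans_lt h1)] at this
    linarith

lemma chord_le {D : ℝ} (hD : ∀ x ∈ X, ∀ y ∈ X, dist x y ≤ D) {z : Pos n × Dir n} (hz : z.1 ∈ X) :
    chord X z ≤ D + D := by
  refine add_le_add ?_ (tauPlus_le hD hz)
  rw [tauMinus_eq]; exact tauPlus_le hD hz

-- A line that stays in the open set `X` during the compact time interval `[0, c]` still does so
-- after a small perturbation. So the exit time is lower semicontinuous on `X`, which gives its
-- measurability.
include ho hb in
lemma isOpen_lt_tauPlus {c : ℝ} (hc : 0 ≤ c) :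
    IsOpen {z : Pos n × Dir n | z.1 ∈ X ∧ c < tauPlus X z} := by
  have h1 : {z : Pos n × Dir n | z.1 ∈ X ∧ c < tauPlus X z} =
      {z | ∀ t ∈ Icc 0 c, (flow t z).1 ∈ X} := by
    ext z
    constructor
    · rintro ⟨hz, h⟩ t ht
      exact flow_mem_of_lt_tauPlus hz ht.1 (ht.2.trans_lt h)
    · intro h
      have hz : z.1 ∈ X := by simpa using h 0 ⟨le_rfl, hc⟩
      refine ⟨hz, not_le.1 fun h2 => ?_⟩
      exact (tauPlus_mem ho hb hz).2 (h _ ⟨tauPlus_nonneg z, h2⟩)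
  rw [h1, isOpen_iff_mem_nhds]
  intro z hz
  have := isCompact_Icc.eventually_forall_of_forall_eventually (x₀ := z) (K := Icc 0 c)
    (P := fun z t => (flow t z).1 ∈ X) (fun t ht =>
      (continuous_flow.fst.tendsto (z, t)).eventually (ho.mem_nhds (hz t ht)))
  exact this

include ho hb in
lemma measurable_indicator_tauPlus :
    Measurable ((X ×ˢ (univ : Set (Dir n))).indicator (tauPlus X)) := by
  refine measurable_of_Ioi fun c => ?_
  rcases le_or_gt 0 c with hc | hc
  · convert (isOpen_lt_tauPlus ho hb hc).measurableSet using 1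
    ext z
    by_cases hz : z.1 ∈ X <;> simp [indicator, hz, hc]
  · convert MeasurableSet.univ using 1
    ext z
    by_cases hz : z.1 ∈ X <;> simp [indicator, hz, hc]
    exact hc.trans_le (tauPlus_nonneg z)

include ho hb in
lemma measurable_indicator_tauMinus :
    Measurable ((X ×ˢ (univ : Set (Dir n))).indicator (tauMinus X)) := by
  convert (measurable_indicator_tauPlus ho hb).comp continuous_rev.measurable using 1
  ext z
  by_cases hz : z.1 ∈ X <;> simp [indicator, hz, tauMinus_eq]

include ho in
lemma measurableSet_phase : MeasurableSet (X ×ˢ (univ : Set (Dir n))) :=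
  ho.measurableSet.prod MeasurableSet.univ

end Lines

/-! ### Invariance of the phase-space measure under motion along lines. -/

section Flow

/-- The measure `dx dθ` on the whole phase space. -/
noncomputable def fullMeasure (n : ℕ) : Measure (Pos n × Dir n) :=
  (volume : Measure (Pos n)).prod (sphereMeasure n)

instance : IsFiniteMeasure (sphereMeasure n) := by unfold sphereMeasure; infer_instance

instance : SFinite (fullMeasure n) := by unfold fullMeasure; infer_instance

lemma phaseMeasure_eq (X : Set (Pos n)) :
    phaseMeasure X = (fullMeasure n).restrict (X ×ˢ univ) := by
  rw [phaseMeasure, fullMeasure, ← Measure.prod_restrict, Measure.restrict_univ]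

/-- The motion along lines, with reversal of time. -/
noncomputable def flowInv (p : (Pos n × Dir n) × ℝ) : (Pos n × Dir n) × ℝ := (flow p.2 p.1, -p.2)

lemma flowInv_flowInv (p : (Pos n × Dir n) × ℝ) : flowInv (flowInv p) = p := by
  simp [flowInv, flow_flow]

/-- With the variables ordered as direction and time, then position, this is a skew product: time is
negated, and position is translated by a vector depending only on direction and time. -/
lemma measurePreserving_flowInv :
    MeasurePreserving (flowInv (n := n)) ((fullMeasure n).prod volume)
      ((fullMeasure n).prod volume) := by
  have e1 : MeasurePreserving (fun p : (Pos n × Dir n) × ℝ => ((p.1.2, p.2), p.1.1))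
      ((fullMeasure n).prod volume) (((sphereMeasure n).prod volume).prod volume) :=
    Measure.measurePreserving_swap.comp (measurePreserving_prodAssoc _ _ _)
  have e2 : MeasurePreserving (fun p : (Dir n × ℝ) × Pos n => ((p.2, p.1.1), p.1.2))
      (((sphereMeasure n).prod volume).prod volume) ((fullMeasure n).prod volume) :=
    ((measurePreserving_prodAssoc _ _ _).symm MeasurableEquiv.prodAssoc).comp
      Measure.measurePreserving_swap
  have e3 : MeasurePreserving (fun p : (Dir n × ℝ) × Pos n =>
        (((p.1.1, -p.1.2) : Dir n × ℝ), p.2 + p.1.2 • (p.1.1 : Pos n)))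
      (((sphereMeasure n).prod volume).prod volume)
      (((sphereMeasure n).prod volume).prod volume) := by
    refine MeasurePreserving.skew_product (f := fun q : Dir n × ℝ => (q.1, -q.2))
      (g := fun q x => x + q.2 • (q.1 : Pos n)) ?_ ?_ ?_
    · exact (MeasurePreserving.id _).prod (Measure.measurePreserving_neg volume)
    · exact Continuous.measurable (by fun_prop)
    · exact Filter.Eventually.of_forall fun q => (measurePreserving_add_right volume _).map_eq
  exact e2.comp (e3.comp e1)

variable (ho : IsOpen X) (hb : Bornology.IsBounded X)

include ho in
lemma ae_phase_iff {P : Pos n × Dir n → Prop} :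
    (∀ᵐ z ∂(phaseMeasure X), P z) ↔ ∀ᵐ z ∂(fullMeasure n), z.1 ∈ X → P z := by
  rw [phaseMeasure_eq, ae_restrict_iff' (measurableSet_phase ho)]
  simp

include ho in
lemma ae_phase_mem : ∀ᵐ z ∂(phaseMeasure X), z.1 ∈ X :=
  (ae_phase_iff ho).2 (Filter.Eventually.of_forall fun _ => id)

include ho in
/-- What holds at almost every point holds almost everywhere on almost every line. -/
lemma ae_segment {P : Pos n × Dir n → Prop} (h : ∀ᵐ z ∂(phaseMeasure X), P z) :
    ∀ᵐ z ∂(phaseMeasure X), ∀ᵐ s : ℝ, s ∈ Ioo (-tauMinus X z) (tauPlus X z) → P (flow s z) := by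
  rw [ae_phase_iff ho] at h
  -- The exceptional null set is extended to all times, pulled back by `flowInv` and sliced by
  -- Fubini.
  have h1 : ∀ᵐ p ∂((fullMeasure n).prod (volume : Measure ℝ)), p.1.1 ∈ X → P p.1 :=
    Measure.quasiMeasurePreserving_fst.ae h
  have h2 := measurePreserving_flowInv.quasiMeasurePreserving.ae h1
  have h3 := Measure.ae_ae_of_ae_prod h2
  rw [ae_phase_iff ho]
  filter_upwards [h3] with z hz hzX
  filter_upwards [hz] with s hs hs'
  exact hs (flow_mem hzX hs'.1 hs'.2)

/-- The pairs of a point `z` and a time for which the line through `z` stays in `X`. -/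
def segments (X : Set (Pos n)) : Set ((Pos n × Dir n) × ℝ) :=
  {p | p.1.1 ∈ X ∧ -tauMinus X p.1 < p.2 ∧ p.2 < tauPlus X p.1}

include ho hb in
lemma measurableSet_segments : MeasurableSet (segments X) := by
  have h1 := measurable_indicator_tauPlus ho hb
  have h2 := measurable_indicator_tauMinus ho hb
  have : segments X = (Prod.fst ⁻¹' (X ×ˢ (univ : Set (Dir n)))) ∩
      ({p | -(X ×ˢ (univ : Set (Dir n))).indicator (tauMinus X) p.1 < p.2} ∩
      {p | p.2 < (X ×ˢ (univ : Set (Dir n))).indicator (tauPlus X) p.1}) := by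
    ext p
    by_cases hp : p.1.1 ∈ X <;> simp [segments, hp, indicator]
  rw [this]
  exact (measurable_fst (measurableSet_phase ho)).inter
    ((measurableSet_lt (h2.comp measurable_fst).neg measurable_snd).inter
      (measurableSet_lt measurable_snd (h1.comp measurable_fst)))

include ho hb in
lemma flowInv_mem_segments {p : (Pos n × Dir n) × ℝ} (hp : p ∈ segments X) :
    flowInv p ∈ segments X := by
  obtain ⟨h1, h2, h3⟩ := hp
  refine ⟨flow_mem h1 h2 h3, ?_, ?_⟩
  · simp only [flowInv]; rw [tauMinus_flow ho hb h1 h2 h3]; linarith [tauMinus_pos ho hb h1]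
  · simp only [flowInv]; rw [tauPlus_flow ho hb h1 h2 h3]; linarith [tauPlus_pos ho hb h1]

include ho hb in
lemma flowInv_mem_segments_iff {p : (Pos n × Dir n) × ℝ} :
    flowInv p ∈ segments X ↔ p ∈ segments X :=
  ⟨fun h => by simpa [flowInv_flowInv] using flowInv_mem_segments ho hb h,
    flowInv_mem_segments ho hb⟩

include ho hb in
lemma measurable_indicator_chord :
    Measurable ((X ×ˢ (univ : Set (Dir n))).indicator (chord X)) := by
  convert (measurable_indicator_tauMinus ho hb).add (measurable_indicator_tauPlus ho hb) using 1
  exact indicator_add _ _ _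

end Flow

/-! ### Integration over phase space through chords. -/

section Integration

variable (ho : IsOpen X) (hb : Bornology.IsBounded X)

include ho hb in
lemma aemeasurable_tauPlus : AEMeasurable (tauPlus X) (phaseMeasure X) :=
  ⟨_, measurable_indicator_tauPlus ho hb, by
    filter_upwards [ae_phase_mem ho] with z hz; simp [indicator, hz]⟩

include ho hb in
lemma aemeasurable_tauMinus : AEMeasurable (tauMinus X) (phaseMeasure X) :=
  ⟨_, measurable_indicator_tauMinus ho hb, by
    filter_upwards [ae_phase_mem ho] with z hz; simp [indicator, hz]⟩

include ho hb in
lemma aemeasurable_chord : AEMeasurable (chord X) (phaseMeasure X) :=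
  (aemeasurable_tauMinus ho hb).add (aemeasurable_tauPlus ho hb)

include ho in
lemma ae_intervalIntegrable_segment {w : Pos n × Dir n → ℝ} {C : ℝ}
    (hw : AEStronglyMeasurable w (phaseMeasure X)) (hC : ∀ᵐ z ∂(phaseMeasure X), |w z| ≤ C) :
    ∀ᵐ z ∂(phaseMeasure X), IntegrableOn (fun s => w (flow s z))
      (Ioo (-tauMinus X z) (tauPlus X z)) := by
  filter_upwards [ae_segment ho (hw.ae_eq_mk.and hC)] with z hz
  rw [← ae_restrict_iff' measurableSet_Ioo] at hz
  have h1 : AEStronglyMeasurable (fun s => w (flow s z))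
      (volume.restrict (Ioo (-tauMinus X z) (tauPlus X z))) := by
    refine ⟨fun s => hw.mk w (flow s z), ?_, hz.mono fun s hs => hs.1⟩
    exact hw.stronglyMeasurable_mk.comp_measurable (continuous_flow_left z).measurable
  have : IsFiniteMeasure (volume.restrict (Ioo (-tauMinus X z) (tauPlus X z))) := ⟨by simp⟩
  exact Integrable.of_bound h1 C (hz.mono fun s hs => hs.2)

include ho hb in
/-- Integration over the phase space by averages over chords. -/
lemma integral_phase_eq {F : Pos n × Dir n → ℝ} (hF : Integrable F (phaseMeasure X)) :
    ∫ z, F z ∂(phaseMeasure X) = ∫ z, (chord X z)⁻¹ *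
      (∫ s in (-tauMinus X z)..(tauPlus X z), F (flow s z)) ∂(phaseMeasure X) := by
  classical
  set Q := X ×ˢ (univ : Set (Dir n)) with hQ
  have hQm : MeasurableSet Q := measurableSet_phase ho
  have hF0 : Integrable (Q.indicator F) (fullMeasure n) := by
    rw [integrable_indicator_iff hQm, IntegrableOn, ← phaseMeasure_eq]; exact hF
  -- The weight has mass one on each segment, so integrating `G` in time first gives back `F`.
  -- Composition with `flowInv` keeps `segments X` and the chord length and replaces `F z` by `F
  -- (flow s z)`, which yields the average along the chord.
  set G : (Pos n × Dir n) × ℝ → ℝ := (segments X).indicator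
    fun p => (Q.indicator (chord X) p.1)⁻¹ * Q.indicator F p.1 with hG
  have hGz : ∀ z : Pos n × Dir n, z.1 ∈ X → ∀ s, G (z, s) =
      (Ioo (-tauMinus X z) (tauPlus X z)).indicator (fun _ => (chord X z)⁻¹ * F z) s := by
    intro z hz s
    simp [hG, indicator, segments, hz, hQ]
  have hGz' : ∀ z : Pos n × Dir n, z.1 ∉ X → ∀ s, G (z, s) = 0 := by
    intro z hz s
    simp [hG, indicator, segments, hz]
  have hlen : ∀ z : Pos n × Dir n, z.1 ∈ X →
      volume.real (Ioo (-tauMinus X z) (tauPlus X z)) = chord X z := by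
    intro z hz
    rw [Real.volume_real_Ioo_of_le]
    · rw [chord]; ring
    · linarith [tauPlus_nonneg (X := X) z, tauMinus_nonneg (X := X) z]
  have hGm : AEStronglyMeasurable G ((fullMeasure n).prod volume) := by
    refine AEStronglyMeasurable.indicator ?_ (measurableSet_segments ho hb)
    refine AEStronglyMeasurable.mul ?_ hF0.aestronglyMeasurable.comp_fst
    exact (((measurable_indicator_chord ho hb).comp measurable_fst).inv).aestronglyMeasurable
  have hint : ∀ z, ∫ s, G (z, s) = Q.indicator F z := by
    intro z
    by_cases hz : z.1 ∈ X
    · simp_rw [hGz z hz]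
      rw [integral_indicator measurableSet_Ioo, setIntegral_const, hlen z hz]
      have := (chord_pos ho hb hz).ne'
      simp [indicator, hz, hQ]
      field_simp
    · simp_rw [hGz' z hz]; simp [indicator, hz, hQ]
  have hGi : Integrable G ((fullMeasure n).prod volume) := by
    rw [integrable_prod_iff hGm]
    constructor
    · refine Filter.Eventually.of_forall fun z => ?_
      by_cases hz : z.1 ∈ X
      · simp_rw [hGz z hz]
        rw [integrable_indicator_iff measurableSet_Ioo]
        exact integrableOn_const (by simp)
      · simp_rw [hGz' z hz]; simp
    · refine hF0.norm.congr (Filter.Eventually.of_forall fun z => ?_)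
      by_cases hz : z.1 ∈ X
      · simp_rw [hGz z hz, norm_indicator_eq_indicator_norm]
        rw [integral_indicator measurableSet_Ioo, setIntegral_const, hlen z hz]
        have := chord_pos ho hb hz
        simp [indicator, hz, hQ, abs_of_pos this]
        field_simp
      · simp_rw [hGz' z hz]; simp [indicator, hz, hQ]
  have hmp := measurePreserving_flowInv (n := n)
  have h1 : ∫ p, G p ∂((fullMeasure n).prod volume) = ∫ z, F z ∂(phaseMeasure X) := by
    rw [integral_prod _ hGi]
    simp_rw [hint]
    rw [integral_indicator hQm, phaseMeasure_eq]
  have h2 : ∫ p, G (flowInv p) ∂((fullMeasure n).prod volume) =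
      ∫ p, G p ∂((fullMeasure n).prod volume) := by
    conv_rhs => rw [← hmp.map_eq]
    rw [integral_map hmp.measurable.aemeasurable]
    rw [hmp.map_eq]; exact hGm
  have h3 : Integrable (fun p => G (flowInv p)) ((fullMeasure n).prod volume) :=
    hmp.integrable_comp_of_integrable hGi
  rw [← h1, ← h2, integral_prod _ h3, phaseMeasure_eq, ← integral_indicator hQm]
  congr 1
  ext z
  have hseg : ∀ s, flowInv (z, s) ∈ segments X ↔ (z, s) ∈ segments X := fun s =>
    flowInv_mem_segments_iff ho hb
  by_cases hz : z.1 ∈ X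
  · have e : ∀ s, G (flowInv (z, s)) = (Ioo (-tauMinus X z) (tauPlus X z)).indicator
        (fun s => (chord X z)⁻¹ * F (flow s z)) s := by
      intro s
      rw [hG]
      by_cases hs : s ∈ Ioo (-tauMinus X z) (tauPlus X z)
      · have hs' : flowInv (z, s) ∈ segments X := (hseg s).2 ⟨hz, hs.1, hs.2⟩
        have hm := flow_mem hz hs.1 hs.2
        rw [indicator_of_mem hs', indicator_of_mem hs]
        simp only [flowInv]
        rw [indicator_of_mem, indicator_of_mem, chord_flow ho hb hz hs.1 hs.2]
        · exact ⟨hm, trivial⟩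
        · exact ⟨hm, trivial⟩
      · rw [indicator_of_notMem hs, indicator_of_notMem]
        exact fun h => hs ((hseg s).1 h).2
    simp_rw [e]
    have hzQ : z ∈ Q := ⟨hz, trivial⟩
    rw [integral_indicator measurableSet_Ioo, integral_const_mul, indicator_of_mem hzQ,
      intervalIntegral.integral_of_le, integral_Ioc_eq_integral_Ioo]
    linarith [tauPlus_nonneg (X := X) z, tauMinus_nonneg (X := X) z]
  · have e : ∀ s, G (flowInv (z, s)) = 0 := by
      intro s
      rw [hG, indicator_of_notMem]
      exact fun h => hz ((hseg s).1 h).1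
    simp_rw [e]
    rw [indicator_of_notMem (fun h => hz h.1)]; simp

end Integration

/-! ### Orthogonal projections and surface measure. -/

section HausdorffMeasure

open Module

lemma euclideanHausdorffMeasure_image_le {E F : Type*} [EMetricSpace E] [MeasurableSpace E]
    [BorelSpace E] [EMetricSpace F] [MeasurableSpace F] [BorelSpace F] {K : NNReal} {f : E → F}
    {s : Set E} (hf : LipschitzOnWith K f s) (d : ℕ) :
    Measure.euclideanHausdorffMeasure d (f '' s) ≤
      (K : ENNReal) ^ (d : ℝ) * Measure.euclideanHausdorffMeasure d s := by
  simp only [Measure.euclideanHausdorffMeasure_def, Measure.smul_apply, ENNReal.smul_def,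
    smul_eq_mul]
  rw [mul_left_comm]
  gcongr
  exact hf.hausdorffMeasure_image_le (Nat.cast_nonneg d)

lemma finrank_orthogonal_span {v : Pos n} (hv : v ≠ 0) :
    finrank ℝ (Submodule.span ℝ {v})ᗮ = n - 1 := by
  have := Submodule.finrank_add_finrank_orthogonal (Submodule.span ℝ {v})
  rw [finrank_span_singleton hv, finrank_euclideanSpace_fin] at this
  omega

lemma volume_orthogonal_span {v : Pos n} (hv : v ≠ 0) :
    (volume : Measure (Submodule.span ℝ {v})ᗮ) = Measure.euclideanHausdorffMeasure (n - 1) := by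
  rw [← InnerProductSpace.euclideanHausdorffMeasure_eq_volume, finrank_orthogonal_span hv]

/-- Projections are 1-Lipschitz. This inequality plays the part of `|θ · ν| ≤ 1` and makes a
Jacobian formula on the boundary unnecessary. -/
lemma volume_projection_le {v : Pos n} (hv : v ≠ 0) (A : Set (Pos n)) :
    volume ((Submodule.span ℝ {v})ᗮ.orthogonalProjectionOnto '' A) ≤
      Measure.euclideanHausdorffMeasure (n - 1) A := by
  rw [volume_orthogonal_span hv]
  simpa using euclideanHausdorffMeasure_image_le
    ((Submodule.span ℝ {v})ᗮ.lipschitzWith_orthogonalProjectionOnto.lipschitzOnWith (s := A)) (n - 1)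

lemma dir_ne_zero (θ : Dir n) : (θ : Pos n) ≠ 0 := by
  intro h; simpa [h] using norm_dir θ

/-- Fubini for the splitting into the line of `θ` and its orthogonal complement; `t ↦ t θ` preserves
length because `θ` is a unit vector. -/
lemma lintegral_lines (θ : Dir n) {f : Pos n → ENNReal} (hf : Measurable f) :
    ∫⁻ x, f x = ∫⁻ p : (Submodule.span ℝ {(θ : Pos n)})ᗮ, ∫⁻ t : ℝ, f (p + t • (θ : Pos n)) := by
  set s := Submodule.span ℝ {(θ : Pos n)}
  have h1 := (s.measurePreserving_measurableEquivProd (0 : Pos n)).symm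
  rw [InnerProductSpace.euclideanHausdorffMeasure_eq_volume] at h1
  have hθ : (θ : Pos n) ≠ 0 := by
    intro h; simpa [h] using norm_dir θ
  rw [← h1.lintegral_comp hf, Measure.volume_eq_prod, lintegral_prod_symm]
  swap
  · exact (hf.comp h1.measurable).aemeasurable
  have h2 : (volume : Measure s) = (volume : Measure ℝ).map
      (· • (⟨θ, Submodule.mem_span_singleton_self _⟩ : s)) := by
    rw [volume_eq_of_finrank_eq_one (finrank_span_singleton hθ)
      (v := ⟨θ, Submodule.mem_span_singleton_self _⟩)]
    · have : ‖(⟨θ, Submodule.mem_span_singleton_self _⟩ : s)‖ₑ = 1 := by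
        rw [← ofReal_norm, Submodule.coe_norm, norm_dir]; simp
      rw [this, one_smul]
    · simpa using hθ
  congr 1
  ext p
  rw [h2, lintegral_map]
  · simp [add_comm]
  · exact hf.comp (h1.measurable.comp (by fun_prop))
  · fun_prop

end HausdorffMeasure

/-! ### Finite area of the boundary. -/

section Boundary

lemma IsDefiningFunctionAt.eventually {p : Pos n} {ρ : Pos n → ℝ}
    (h : IsDefiningFunctionAt X p ρ) : ∀ᶠ y in 𝓝 p, IsDefiningFunctionAt X y ρ := by
  have hg : Continuous (gradient ρ) :=
    (InnerProductSpace.toDual ℝ (Pos n)).symm.continuous.comp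
      (h.smooth.continuous_fderiv (by simp))
  filter_upwards [hg.continuousAt.eventually_ne h.gradient_ne_zero, h.mem_iff.eventually_nhds]
    with y h1 h2
  exact ⟨h.smooth, h1, h2⟩

lemma IsDefiningFunctionAt.eq_zero (ho : IsOpen X) {p : Pos n} {ρ : Pos n → ℝ}
    (h : IsDefiningFunctionAt X p ρ) (hp : p ∈ frontier X) : ρ p = 0 := by
  rw [frontier, ho.interior_eq] at hp
  refine le_antisymm (not_lt.1 fun hpos => ?_) (not_lt.1 fun hneg => hp.2 ?_)
  · have h1 := (h.smooth.continuous.continuousAt.eventually (lt_mem_nhds hpos)).and h.mem_iff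
    obtain ⟨y, hy, hyX⟩ := mem_closure_iff_nhds.1 hp.1 _ h1
    exact absurd (hy.2.1 hyX) (not_lt.2 hy.1.le)
  · exact h.mem_iff.self_of_nhds.2 hneg

lemma IsDefiningFunctionAt.hasStrictFDerivAt {p : Pos n} {ρ : Pos n → ℝ}
    (h : IsDefiningFunctionAt X p ρ) (y : Pos n) :
    HasStrictFDerivAt ρ (innerSL ℝ (gradient ρ y)) y := by
  have h1 : HasStrictFDerivAt ρ (fderiv ℝ ρ y) y :=
    h.smooth.contDiffAt.hasStrictFDerivAt (by simp)
  have h2 : innerSL ℝ (gradient ρ y) = fderiv ℝ ρ y := by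
    ext w; simp [gradient]
  rwa [h2]

/-- The surface measure of the boundary is locally finite: near a boundary point the projection
along the normal has a Lipschitz inverse on the boundary. -/
lemma finiteAtFilter_frontier (ho : IsOpen X) {p : Pos n} {ρ : Pos n → ℝ}
    (h : IsDefiningFunctionAt X p ρ) :
    (Measure.euclideanHausdorffMeasure (n - 1) : Measure (Pos n)).FiniteAtFilter
      (𝓝[frontier X] p) := by
  set v := gradient ρ p with hv
  have hv0 : v ≠ 0 := h.gradient_ne_zero
  have hvn : 0 < ‖v‖ := norm_pos_iff.2 hv0
  -- Since `ρ` vanishes on the boundary, approximating it with error `‖v‖ / 2` bounds the component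
  -- of `x - y` along `v` by half of `‖x - y‖`. The tangential component carries the other half,
  -- whence the Lipschitz constant 2 of the inverse.
  obtain ⟨U, hU, hUa⟩ := (h.hasStrictFDerivAt p).approximates_deriv_on_nhds
    (c := ‖v‖₊ / 2) (Or.inr (by simpa using hv0))
  set A := frontier X ∩ (U ∩ ({y | IsDefiningFunctionAt X y ρ} ∩ Metric.ball p 1)) with hA
  refine ⟨A, ?_, ?_⟩
  · exact Filter.inter_mem self_mem_nhdsWithin (mem_nhdsWithin_of_mem_nhds
      (Filter.inter_mem hU (Filter.inter_mem h.eventually (Metric.ball_mem_nhds p one_pos))))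
  set P := (Submodule.span ℝ {v})ᗮ.orthogonalProjectionOnto with hP
  have hanti : ∀ x ∈ A, ∀ y ∈ A, dist x y ≤ 2 * dist (P x) (P y) := by
    intro x hx y hy
    have h1 := hUa x hx.2.1 y hy.2.1
    rw [hx.2.2.1.eq_zero ho hx.1, hy.2.2.1.eq_zero ho hy.1] at h1
    simp only [sub_self, zero_sub, norm_neg, innerSL_apply_apply] at h1
    change ‖inner ℝ v (x - y)‖ ≤ ‖v‖ / 2 * ‖x - y‖ at h1
    have h2 : x - y = (inner ℝ v (x - y) / ‖v‖ ^ 2) • v + (P (x - y) : Pos n) := by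
      have := Submodule.starProjection_add_starProjection_orthogonal
        (K := Submodule.span ℝ {v}) (x - y)
      rw [Submodule.starProjection_singleton] at this
      exact this.symm
    have h3 : ‖x - y‖ ≤ ‖x - y‖ / 2 + ‖P (x - y)‖ := by
      calc ‖x - y‖ = ‖(inner ℝ v (x - y) / ‖v‖ ^ 2) • v + (P (x - y) : Pos n)‖ := by rw [← h2]
        _ ≤ ‖(inner ℝ v (x - y) / ‖v‖ ^ 2) • v‖ + ‖(P (x - y) : Pos n)‖ := norm_add_le _ _
        _ ≤ ‖x - y‖ / 2 + ‖P (x - y)‖ := by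
          gcongr
          · rw [norm_smul, norm_div, norm_pow, norm_norm]
            calc ‖inner ℝ v (x - y)‖ / ‖v‖ ^ 2 * ‖v‖
                ≤ (‖v‖ / 2 * ‖x - y‖) / ‖v‖ ^ 2 * ‖v‖ := by gcongr
              _ = ‖x - y‖ / 2 := by field_simp
          · exact le_of_eq rfl
    rw [dist_eq_norm, dist_eq_norm, ← map_sub]
    linarith
  have hinj : InjOn P A := by
    intro x hx y hy hxy
    have := hanti x hx y hy
    rw [hxy, dist_self, mul_zero] at this
    exact dist_le_zero.1 this
  have hlip : LipschitzOnWith 2 (Function.invFunOn P A) (P '' A) := by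
    rw [lipschitzOnWith_iff_dist_le_mul]
    rintro _ ⟨x, hx, rfl⟩ _ ⟨y, hy, rfl⟩
    rw [hinj.leftInvOn_invFunOn hx, hinj.leftInvOn_invFunOn hy]
    exact hanti x hx y hy
  have himg : Function.invFunOn P A '' (P '' A) = A := hinj.invFunOn_image (Subset.refl A)
  have h4 := euclideanHausdorffMeasure_image_le hlip (n - 1)
  rw [himg] at h4
  refine h4.trans_lt (ENNReal.mul_lt_top (by simp) ?_)
  rw [← volume_orthogonal_span hv0]
  refine Bornology.IsBounded.measure_lt_top ?_
  refine LipschitzWith.isBounded_image (f := P)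
    (Submodule.lipschitzWith_orthogonalProjectionOnto _)
    (Metric.isBounded_ball.subset (fun x hx => hx.2.2.2 : A ⊆ Metric.ball p 1))

lemma frontier_measure_lt_top (hX : IsSmoothBoundedDomain X) :
    (Measure.euclideanHausdorffMeasure (n - 1) : Measure (Pos n)) (frontier X) < ⊤ := by
  have hc : IsCompact (frontier X) :=
    Metric.isCompact_of_isClosed_isBounded isClosed_frontier
      (hX.isBounded.closure.subset frontier_subset_closure)
  refine hc.measure_lt_top_of_nhdsWithin fun p hp => ?_
  obtain ⟨ρ, hρ⟩ := hX.smoothBoundary p hp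
  exact finiteAtFilter_frontier hX.isOpen hρ

end Boundary

/-! ### Flux through the boundary in a fixed direction. -/

section Slices

variable (ho : IsOpen X) (hb : Bornology.IsBounded X)

/-- The measure of density one over the length of the chord, with chords in direction `θ`. -/
noncomputable def chordMeasure (X : Set (Pos n)) (θ : Dir n) : Measure (Pos n) :=
  volume.withDensity fun x => (ENNReal.ofReal ((X ×ˢ univ).indicator (chord X) (x, θ)))⁻¹

/-- The points of `X` from which the line in direction `θ` leaves `X` through `E`. -/
def exitSet (X : Set (Pos n)) (θ : Dir n) (E : Set (Pos n)) : Set (Pos n) :=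
  {x | x ∈ X ∧ (exitPoint X (x, θ)).1 ∈ E}

include ho hb in
lemma measurable_chord_inv : Measurable fun z : Pos n × Dir n =>
    (ENNReal.ofReal ((X ×ˢ univ).indicator (chord X) z))⁻¹ :=
  (measurable_indicator_chord ho hb).ennreal_ofReal.inv

include ho hb in
lemma measurable_indicator_exit : Measurable fun z : Pos n × Dir n =>
    (flow ((X ×ˢ univ).indicator (tauPlus X) z) z) :=
  continuous_flow.measurable.comp (measurable_id.prodMk (measurable_indicator_tauPlus ho hb))

include ho hb in
lemma measurableSet_exitSet (θ : Dir n) {E : Set (Pos n)} (hE : MeasurableSet E) :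
    MeasurableSet (exitSet X θ E) := by
  have h1 : Measurable fun x : Pos n =>
      (flow ((X ×ˢ univ).indicator (tauPlus X) (x, θ)) (x, θ)).1 :=
    ((measurable_indicator_exit ho hb).comp (measurable_id.prodMk measurable_const)).fst
  convert ho.measurableSet.inter (h1 hE) using 1
  ext x
  by_cases hx : x ∈ X <;> simp [exitSet, hx, indicator, exitPoint, flow]

include ho hb in
/-- Two chords of length at least `δ` in one line that end at a distance less than `δ` coincide. -/
lemma exitPoint_eq_of_dist_lt {θ : Dir n} {x y : Pos n} (hx : x ∈ X) (hy : y ∈ X) {r δ : ℝ}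
    (hr : 0 ≤ r) (hδ : r < δ) (hxδ : δ ≤ chord X (x, θ))
    (h : (exitPoint X (x, θ)).1 = (exitPoint X (y, θ)).1 + r • (θ : Pos n)) : r = 0 := by
  by_contra hr0
  have hr' : 0 < r := lt_of_le_of_ne hr (Ne.symm hr0)
  have h1 : (exitPoint X (y, θ)).1 = (flow (tauPlus X (x, θ) - r) (x, θ)).1 := by
    have : (exitPoint X (y, θ)).1 = (exitPoint X (x, θ)).1 - r • (θ : Pos n) := by
      rw [h, add_sub_cancel_right]
    rw [this, exitPoint_eq]
    simp [flow, sub_smul, add_sub_assoc]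
  refine exitPoint_notMem ho hb (z := (y, θ)) hy ?_
  rw [h1]
  refine flow_mem (z := (x, θ)) hx ?_ ?_
  · rw [chord] at hxδ; linarith
  · linarith

-- In each line of direction `θ`, at most one chord of length at least `δ` ends in `E`. The inverse
-- length integrates to at most one over it, so the left side is at most the area of the projection
-- of `E ∩ frontier X` along `θ`.
include ho hb in
lemma chordMeasure_exitSet_le_of_dist_lt (θ : Dir n) {E : Set (Pos n)} (hE : MeasurableSet E)
    {δ : ℝ} (hδ : ∀ x ∈ E, ∀ y ∈ E, dist x y < δ) :
    chordMeasure X θ (exitSet X θ E ∩ {x | δ ≤ (X ×ˢ univ).indicator (chord X) (x, θ)}) ≤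
      Measure.euclideanHausdorffMeasure (n - 1) (E ∩ frontier X) := by
  have hchm : Measurable fun x : Pos n => (X ×ˢ univ).indicator (chord X) (x, θ) :=
    (measurable_indicator_chord ho hb).comp (measurable_id.prodMk measurable_const)
  set A := exitSet X θ E ∩ {x | δ ≤ (X ×ˢ univ).indicator (chord X) (x, θ)} with hA
  have hAm : MeasurableSet A :=
    (measurableSet_exitSet ho hb θ hE).inter (measurableSet_le measurable_const hchm)
  have hch : ∀ x ∈ X, (X ×ˢ univ).indicator (chord X) (x, θ) = chord X (x, θ) := fun x hx => by
    simp [indicator, hx]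
  set P := (Submodule.span ℝ {(θ : Pos n)})ᗮ.orthogonalProjectionOnto with hP
  have hθ0 : P (θ : Pos n) = 0 := by
    rw [hP, Submodule.orthogonalProjectionOnto_eq_zero_iff]
    simp [Submodule.mem_span_singleton_self]
  have hdm : Measurable fun x : Pos n =>
      (ENNReal.ofReal ((X ×ˢ univ).indicator (chord X) (x, θ)))⁻¹ := hchm.ennreal_ofReal.inv
  rw [chordMeasure, withDensity_apply _ hAm, ← lintegral_indicator hAm,
    lintegral_lines θ (hdm.indicator hAm)]
  refine le_trans ?_ (volume_projection_le (dir_ne_zero θ) _)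
  rw [← one_mul (volume _)]
  refine le_trans (lintegral_mono fun p => ?_) (lintegral_indicator_const_le _ 1)
  by_cases hp : ∃ t : ℝ, (p : Pos n) + t • (θ : Pos n) ∈ A
  · obtain ⟨t₀, ht₀⟩ := hp
    set x₀ := (p : Pos n) + t₀ • (θ : Pos n) with hx₀
    have hx₀X : x₀ ∈ X := ht₀.1.1
    have hmem : p ∈ P '' (E ∩ frontier X) := by
      refine ⟨_, ⟨ht₀.1.2, exitPoint_mem_frontier ho hb (z := (x₀, θ)) hx₀X⟩, ?_⟩
      rw [exitPoint_eq, flow_fst, map_add, map_smul, hθ0, smul_zero, add_zero, hx₀, map_add,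
        map_smul, hθ0, smul_zero, add_zero]
      exact Submodule.orthogonalProjectionOnto_mem_subspace_eq_self p
    rw [indicator_of_mem hmem]
    have hle : ∀ t : ℝ, A.indicator (fun x => (ENNReal.ofReal
        ((X ×ˢ univ).indicator (chord X) (x, θ)))⁻¹) ((p : Pos n) + t • (θ : Pos n)) ≤
        (Icc (t₀ - tauMinus X (x₀, θ)) (t₀ + tauPlus X (x₀, θ))).indicator
          (fun _ => (ENNReal.ofReal (chord X (x₀, θ)))⁻¹) t := by
      intro t
      by_cases ht : (p : Pos n) + t • (θ : Pos n) ∈ A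
      swap
      · rw [indicator_of_notMem ht]; exact zero_le
      rw [indicator_of_mem ht]
      set x := (p : Pos n) + t • (θ : Pos n) with hx
      have hxX : x ∈ X := ht.1.1
      have hxx : x = x₀ + (t - t₀) • (θ : Pos n) := by rw [hx, hx₀, sub_smul]; abel
      set r := t + tauPlus X (x, θ) - (t₀ + tauPlus X (x₀, θ)) with hr
      have e1 : (exitPoint X (x, θ)).1 = (exitPoint X (x₀, θ)).1 + r • (θ : Pos n) := by
        rw [exitPoint_eq, exitPoint_eq, flow_fst, flow_fst, hr]
        simp only [hx, hx₀, sub_smul, add_smul]; abel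
      have e2 : (exitPoint X (x₀, θ)).1 = (exitPoint X (x, θ)).1 + (-r) • (θ : Pos n) := by
        rw [e1, neg_smul, add_neg_cancel_right]
      have e3 : |r| < δ := by
        have := hδ _ ht.1.2 _ ht₀.1.2
        rw [e1, dist_eq_norm, add_sub_cancel_left, norm_smul, norm_dir, mul_one] at this
        exact this
      have hc1 : δ ≤ chord X (x, θ) := by rw [← hch x hxX]; exact ht.2
      have hc2 : δ ≤ chord X (x₀, θ) := by rw [← hch x₀ hx₀X]; exact ht₀.2
      -- Otherwise one of the two exit points would lie in the interior of the other long chord.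
      have hr0 : r = 0 := by
        rcases le_total 0 r with h | h
        · exact exitPoint_eq_of_dist_lt ho hb hxX hx₀X h ((le_abs_self r).trans_lt e3) hc1 e1
        · have := exitPoint_eq_of_dist_lt ho hb hx₀X hxX (neg_nonneg.2 h)
            ((neg_le_abs r).trans_lt e3) hc2 e2
          linarith
      have hpos := tauPlus_pos ho hb (z := (x, θ)) hxX
      have hts : t - t₀ < tauPlus X (x₀, θ) := by linarith
      -- If `x` lay before the entry point of the chord of `x₀`, that entry point would lie between
      -- `x` and the common exit point, hence in `X`.
      have htm : -tauMinus X (x₀, θ) ≤ t - t₀ := by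
        by_contra hlt
        rw [not_le] at hlt
        have hy : (flow (-tauMinus X (x₀, θ)) (x₀, θ)).1 ∈ X := by
          have : flow (-tauMinus X (x₀, θ)) (x₀, θ) =
              flow (-tauMinus X (x₀, θ) - (t - t₀)) (x, θ) := by
            have : (x, θ) = flow (t - t₀) (x₀, θ) := by rw [hxx]; rfl
            rw [this, flow_flow]; congr 1; ring
          rw [this]
          refine flow_mem_of_lt_tauPlus (z := (x, θ)) hxX (by linarith) ?_
          have := tauPlus_pos ho hb (z := (x₀, θ)) hx₀X
          have := tauMinus_pos ho hb (z := (x₀, θ)) hx₀X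
          linarith
        have := exitPoint_notMem ho hb (z := rev (x₀, θ)) hx₀X
        rw [exitPoint_eq, ← tauMinus_eq, flow_rev] at this
        exact this hy
      have htI : t ∈ Icc (t₀ - tauMinus X (x₀, θ)) (t₀ + tauPlus X (x₀, θ)) := by
        constructor <;> linarith
      rw [indicator_of_mem htI]
      rcases htm.eq_or_lt with heq | hlt
      · exfalso
        have := exitPoint_notMem ho hb (z := rev (x₀, θ)) hx₀X
        rw [exitPoint_eq, ← tauMinus_eq, flow_rev, heq] at this
        apply this
        change x₀ + (t - t₀) • (θ : Pos n) ∈ X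
        rwa [← hxx]
      · have : (x, θ) = flow (t - t₀) (x₀, θ) := by rw [hxx]; rfl
        rw [hch x hxX, this, chord_flow ho hb (z := (x₀, θ)) hx₀X hlt hts]
    refine (lintegral_mono hle).trans ?_
    rw [lintegral_indicator measurableSet_Icc, setLIntegral_const, Real.volume_Icc]
    have : t₀ + tauPlus X (x₀, θ) - (t₀ - tauMinus X (x₀, θ)) = chord X (x₀, θ) := by
      rw [chord]; ring
    rw [this]
    exact ENNReal.inv_mul_le_one _
  · push Not at hp
    have : ∀ t : ℝ, A.indicator (fun x => (ENNReal.ofReal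
        ((X ×ˢ univ).indicator (chord X) (x, θ)))⁻¹) ((p : Pos n) + t • (θ : Pos n)) = 0 :=
      fun t => indicator_of_notMem (hp t) _
    have h0 : ∫⁻ t : ℝ, A.indicator (fun x => (ENNReal.ofReal
        ((X ×ˢ univ).indicator (chord X) (x, θ)))⁻¹) ((p : Pos n) + t • (θ : Pos n)) = 0 := by
      simp_rw [this]; simp
    exact h0.le.trans zero_le

/-- A partition of space into countably many small pieces. -/
lemma exists_small_partition {δ : ℝ} (hδ : 0 < δ) : ∃ B : ℕ → Set (Pos n),
    (∀ i, MeasurableSet (B i)) ∧ Pairwise (Function.onFun Disjoint B) ∧ ⋃ i, B i = univ ∧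
      ∀ i, ∀ x ∈ B i, ∀ y ∈ B i, dist x y < δ := by
  set b : ℕ → Set (Pos n) := fun i =>
    Metric.ball (TopologicalSpace.denseSeq (Pos n) i) (δ / 2) with hbdef
  refine ⟨disjointed b, fun i => ?_, disjoint_disjointed b, ?_, fun i x hx y hy => ?_⟩
  · exact MeasurableSet.disjointed (fun i => Metric.isOpen_ball.measurableSet) i
  · rw [iUnion_disjointed, eq_univ_iff_forall]
    intro x
    obtain ⟨i, hi⟩ := (TopologicalSpace.denseRange_denseSeq (Pos n)).exists_dist_lt x
      (half_pos hδ)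
    exact mem_iUnion.2 ⟨i, hi⟩
  · have h1 : dist x _ < δ / 2 := disjointed_subset b i hx
    have h2 : dist y _ < δ / 2 := disjointed_subset b i hy
    linarith [dist_triangle_right x y (TopologicalSpace.denseSeq (Pos n) i)]

include ho hb in
/-- The flux through `E` in a fixed direction is at most the area of `E`. -/
lemma chordMeasure_exitSet_le (θ : Dir n) {E : Set (Pos n)} (hE : MeasurableSet E) :
    chordMeasure X θ (exitSet X θ E) ≤
      Measure.euclideanHausdorffMeasure (n - 1) (E ∩ frontier X) := by
  have hstep : ∀ m : ℕ, chordMeasure X θ (exitSet X θ E ∩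
      {x | 1 / ((m : ℝ) + 1) ≤ (X ×ˢ univ).indicator (chord X) (x, θ)}) ≤
      Measure.euclideanHausdorffMeasure (n - 1) (E ∩ frontier X) := by
    intro m
    -- The pieces are smaller than the cutoff for the chord length. As they are disjoint, their
    -- areas add up, and a line that leaves `X` several times is counted once per piece that it
    -- leaves through.
    obtain ⟨B, hBm, hBd, hBu, hBδ⟩ := exists_small_partition (n := n)
      (δ := 1 / ((m : ℝ) + 1)) (by positivity)
    have h1 : exitSet X θ E = ⋃ i, exitSet X θ (E ∩ B i) := by
      ext x
      simp only [exitSet, mem_iUnion, mem_ofPred_eq, mem_inter_iff]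
      have : (exitPoint X (x, θ)).1 ∈ ⋃ i, B i := by rw [hBu]; trivial
      rw [mem_iUnion] at this
      constructor
      · rintro ⟨h, h'⟩; obtain ⟨i, hi⟩ := this; exact ⟨i, h, h', hi⟩
      · rintro ⟨i, h, h', _⟩; exact ⟨h, h'⟩
    have h2 : E ∩ frontier X = ⋃ i, (E ∩ B i) ∩ frontier X := by
      rw [← iUnion_inter, ← inter_iUnion, hBu, inter_univ]
    rw [h1, iUnion_inter, h2, measure_iUnion (μ := Measure.euclideanHausdorffMeasure (n - 1))]
    · exact (measure_iUnion_le _).trans (ENNReal.tsum_le_tsum fun i =>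
        chordMeasure_exitSet_le_of_dist_lt ho hb θ (hE.inter (hBm i))
          fun x hx y hy => hBδ i x hx.2 y hy.2)
    · exact fun i j hij => ((hBd hij).mono inter_subset_right inter_subset_right).mono
        inter_subset_left inter_subset_left
    · exact fun i => (hE.inter (hBm i)).inter isClosed_frontier.measurableSet
  have hU : exitSet X θ E = ⋃ m : ℕ, (exitSet X θ E ∩
      {x | 1 / ((m : ℝ) + 1) ≤ (X ×ˢ univ).indicator (chord X) (x, θ)}) := by
    rw [← inter_iUnion, eq_comm, inter_eq_left]
    intro x hx
    have := chord_pos ho hb (z := (x, θ)) hx.1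
    obtain ⟨m, hm⟩ := exists_nat_one_div_lt this
    refine mem_iUnion.2 ⟨m, ?_⟩
    have hx' : x ∈ X := hx.1
    simp [indicator, hx']
    simpa using hm.le
  rw [hU, Monotone.measure_iUnion]
  · exact iSup_le hstep
  · intro a b hab
    refine inter_subset_inter_right _ fun x hx => ?_
    have hab' : (a : ℝ) + 1 ≤ (b : ℝ) + 1 := by simpa using hab
    exact le_trans (one_div_le_one_div_of_le (by positivity) hab') hx

end Slices

/-! ### Surface measure of the sphere. -/

section Sphere

open scoped Pointwise

/-- The measure of a set of directions is a multiple of the volume of the cone over it, and this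
cone lies in a hyperplane. -/
lemma sphereMeasure_orthogonal {v : Pos n} (hv : v ≠ 0) :
    sphereMeasure n {θ : Dir n | inner ℝ (θ : Pos n) v = 0} = 0 := by
  have hm : MeasurableSet {θ : Dir n | inner ℝ (θ : Pos n) v = 0} :=
    (isClosed_eq (by fun_prop) continuous_const).measurableSet
  rw [sphereMeasure, Measure.toSphere_apply' _ hm]
  have hsub : Ioo (0 : ℝ) 1 • (Subtype.val '' {θ : Dir n | inner ℝ (θ : Pos n) v = 0}) ⊆
      ((Submodule.span ℝ {v})ᗮ : Set (Pos n)) := by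
    rintro _ ⟨t, _, _, ⟨θ, hθ, rfl⟩, rfl⟩
    rw [SetLike.mem_coe, Submodule.mem_orthogonal_singleton_iff_inner_left]
    change inner ℝ (t • (θ : Pos n)) v = 0
    rw [inner_smul_left]
    have : inner ℝ (θ : Pos n) v = 0 := hθ
    simp [this]
  have hne : (Submodule.span ℝ {v})ᗮ ≠ ⊤ := by
    rw [Ne, Submodule.orthogonal_eq_top_iff, Submodule.span_singleton_eq_bot]
    exact hv
  rw [measure_mono_null hsub (Measure.addHaar_submodule _ _ hne), mul_zero]

lemma measurePreserving_neg_dir :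
    MeasurePreserving (fun θ : Dir n => -θ) (sphereMeasure n) (sphereMeasure n) := by
  have hc : Continuous (fun θ : Dir n => -θ) := by fun_prop
  refine ⟨hc.measurable, ?_⟩
  ext s hs
  rw [Measure.map_apply hc.measurable hs, sphereMeasure, Measure.toSphere_apply' _ hs,
    Measure.toSphere_apply' _ (hc.measurable hs)]
  congr 1
  have : Ioo (0 : ℝ) 1 • (Subtype.val '' ((fun θ : Dir n => -θ) ⁻¹' s)) =
      (fun x : Pos n => -x) ⁻¹' (Ioo (0 : ℝ) 1 • (Subtype.val '' s)) := by
    ext x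
    constructor
    · rintro ⟨t, ht, _, ⟨θ, hθ, rfl⟩, rfl⟩
      exact ⟨t, ht, _, ⟨-θ, hθ, rfl⟩, by simp⟩
    · rintro ⟨t, ht, _, ⟨θ, hθ, rfl⟩, h⟩
      refine ⟨t, ht, _, ⟨-θ, by simpa using hθ, rfl⟩, ?_⟩
      simp only at h ⊢
      change t • (-(θ : Pos n)) = x
      have h' : t • (θ : Pos n) = -x := h
      rw [smul_neg, h', neg_neg]
  rw [this, Measure.measure_preimage_neg]

lemma measurePreserving_rev_prod {μ : Measure (Pos n)} [SFinite μ] :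
    MeasurePreserving (rev (n := n)) (μ.prod (sphereMeasure n)) (μ.prod (sphereMeasure n)) :=
  (MeasurePreserving.id μ).prod measurePreserving_neg_dir

lemma measurePreserving_rev_phase :
    MeasurePreserving (rev (n := n)) (phaseMeasure X) (phaseMeasure X) :=
  measurePreserving_rev_prod

end Sphere

/-! ### Traces of boundary data along lines. -/

section Traces

lemma mem_outflowSet_iff {z : Pos n × Dir n} : z ∈ outflowSet X ↔ z.1 ∈ frontier X ∧
    ∃ ρ, IsDefiningFunctionAt X z.1 ρ ∧ 0 < inner ℝ (z.2 : Pos n) (gradient ρ z.1) := by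
  refine and_congr_right fun _ => ⟨?_, ?_⟩
  · rintro ⟨_, ⟨ρ, hρ, rfl⟩, h⟩
    refine ⟨ρ, hρ, ?_⟩
    rw [inner_smul_right] at h
    exact pos_of_mul_pos_right h (by positivity)
  · rintro ⟨ρ, hρ, h⟩
    refine ⟨_, ⟨ρ, hρ, rfl⟩, ?_⟩
    rw [inner_smul_right]
    exact mul_pos (inv_pos.2 (norm_pos_iff.2 hρ.gradient_ne_zero)) h

lemma rev_mem_outflowSet_iff {z : Pos n × Dir n} : rev z ∈ outflowSet X ↔ z ∈ inflowSet X := by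
  simp [outflowSet, inflowSet]

lemma rev_mem_inflowSet_iff {z : Pos n × Dir n} : rev z ∈ inflowSet X ↔ z ∈ outflowSet X := by
  rw [← rev_mem_outflowSet_iff, rev_rev]

/-- Relatively open subsets of a measurable set are measurable. Membership in `outflowSet X` asks
for the existence of some defining function, but it is an open condition within the boundary. -/
lemma measurableSet_of_mem_nhdsWithin {α : Type*} [TopologicalSpace α] [MeasurableSpace α]
    [BorelSpace α] {A C : Set α} (hC : MeasurableSet C) (hA : A ⊆ C)
    (h : ∀ z ∈ A, A ∈ 𝓝[C] z) : MeasurableSet A := by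
  have : A = C ∩ interior (A ∪ Cᶜ) := by
    refine Subset.antisymm (fun z hz => ⟨hA hz, ?_⟩) fun z hz => ?_
    · rw [mem_interior_iff_mem_nhds]
      have := mem_nhdsWithin_iff_eventually.1 (h z hz)
      filter_upwards [this] with y hy
      by_cases hyC : y ∈ C
      · exact Or.inl (hy hyC)
      · exact Or.inr hyC
    · exact (interior_subset hz.2).resolve_right fun h => h hz.1
  rw [this]
  exact hC.inter isOpen_interior.measurableSet

lemma measurableSet_frontier_prod :
    MeasurableSet (frontier X ×ˢ (univ : Set (Dir n))) :=
  isClosed_frontier.measurableSet.prod MeasurableSet.univ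

lemma measurableSet_outflowSet : MeasurableSet (outflowSet X) := by
  refine measurableSet_of_mem_nhdsWithin (measurableSet_frontier_prod (X := X))
    (fun z hz => ⟨hz.1, trivial⟩) fun z hz => ?_
  obtain ⟨hzf, ρ, hρ, h⟩ := mem_outflowSet_iff.1 hz
  have hg : Continuous (gradient ρ) :=
    (InnerProductSpace.toDual ℝ (Pos n)).symm.continuous.comp
      (hρ.smooth.continuous_fderiv (by simp))
  have hc : Continuous fun z : Pos n × Dir n => inner ℝ (z.2 : Pos n) (gradient ρ z.1) := by
    fun_prop
  have h1 := hc.continuousAt.eventually (lt_mem_nhds h)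
  have h2 := (continuous_fst.continuousAt (x := z)).eventually hρ.eventually
  rw [mem_nhdsWithin_iff_eventually]
  filter_upwards [h1, h2] with y hy1 hy2 hy3
  exact mem_outflowSet_iff.2 ⟨hy3.1, ρ, hy2, hy1⟩

lemma measurableSet_inflowSet : MeasurableSet (inflowSet X) := by
  convert continuous_rev.measurable (measurableSet_outflowSet (X := X)) using 1
  ext z
  exact rev_mem_outflowSet_iff.symm

variable (hX : IsSmoothBoundedDomain X)

include hX in
lemma isFiniteMeasure_frontier : IsFiniteMeasure
    ((Measure.euclideanHausdorffMeasure (n - 1) : Measure (Pos n)).restrict (frontier X)) :=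
  ⟨by rw [Measure.restrict_apply_univ]; exact frontier_measure_lt_top hX⟩

include hX in
lemma isFiniteMeasure_boundary : IsFiniteMeasure (boundaryMeasure X) := by
  have := isFiniteMeasure_frontier hX
  unfold boundaryMeasure
  infer_instance

include hX in
lemma measurePreserving_rev_boundary :
    MeasurePreserving (rev (n := n)) (boundaryMeasure X) (boundaryMeasure X) := by
  have := isFiniteMeasure_frontier hX
  exact measurePreserving_rev_prod

include hX in
lemma measurePreserving_rev_inflow :
    MeasurePreserving (rev (n := n)) (inflowMeasure X) (outflowMeasure X) := by
  have h := (measurePreserving_rev_boundary hX).restrict_preimage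
    (measurableSet_outflowSet (X := X))
  have h2 : rev ⁻¹' outflowSet X = inflowSet X := by ext z; exact rev_mem_outflowSet_iff
  rwa [h2] at h

include hX in
lemma measurePreserving_rev_outflow :
    MeasurePreserving (rev (n := n)) (outflowMeasure X) (inflowMeasure X) := by
  have h := (measurePreserving_rev_boundary hX).restrict_preimage
    (measurableSet_inflowSet (X := X))
  have h2 : rev ⁻¹' inflowSet X = outflowSet X := by ext z; exact rev_mem_inflowSet_iff
  rwa [h2] at h

include hX in
/-- Almost every direction is transversal to the boundary at almost every point. -/
lemma boundaryMeasure_tangential :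
    boundaryMeasure X ((frontier X ×ˢ univ) \ (outflowSet X ∪ inflowSet X)) = 0 := by
  have := isFiniteMeasure_frontier hX
  have hm : MeasurableSet ((frontier X ×ˢ (univ : Set (Dir n))) \ (outflowSet X ∪ inflowSet X)) :=
    measurableSet_frontier_prod.diff (measurableSet_outflowSet.union measurableSet_inflowSet)
  rw [boundaryMeasure, Measure.measure_prod_null hm]
  refine (ae_restrict_mem isClosed_frontier.measurableSet).mono fun y hy => ?_
  obtain ⟨ρ, hρ⟩ := hX.smoothBoundary y hy
  refine measure_mono_null (fun θ hθ => ?_) (sphereMeasure_orthogonal hρ.gradient_ne_zero)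
  have h1 : ¬ 0 < inner ℝ (θ : Pos n) (gradient ρ y) := fun h =>
    hθ.2 (Or.inl (mem_outflowSet_iff.2 ⟨hy, ρ, hρ, h⟩))
  have h2 : ¬ 0 < inner ℝ (-(θ : Pos n)) (gradient ρ y) := fun h =>
    hθ.2 (Or.inr (rev_mem_outflowSet_iff.1 (mem_outflowSet_iff.2 ⟨hy, ρ, hρ, h⟩)))
  rw [inner_neg_left] at h2
  exact le_antisymm (not_lt.1 h1) (by linarith)

/-- Moving back from the exit point one is in `X`, where a defining function is negative. Its
derivative in the direction `-θ` is therefore at most zero, whereas at an inflow point it is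
positive. -/
lemma exitPoint_notMem_inflowSet (ho : IsOpen X) (hb : Bornology.IsBounded X)
    {z : Pos n × Dir n} (hz : z.1 ∈ X) : exitPoint X z ∉ inflowSet X := by
  intro h
  obtain ⟨hf, ρ, hρ, hin⟩ := mem_outflowSet_iff.1 (rev_mem_outflowSet_iff.2 h)
  set y := (exitPoint X z).1 with hy
  change 0 < inner ℝ (-(z.2 : Pos n)) (gradient ρ y) at hin
  have h0 : ρ y = 0 := hρ.eq_zero ho hf
  have hl : HasDerivAt (fun t : ℝ => y + t • (-(z.2 : Pos n))) (-(z.2 : Pos n)) 0 := by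
    simpa using ((hasDerivAt_id (0 : ℝ)).smul_const (-(z.2 : Pos n))).const_add y
  have hd : HasDerivAt (fun t : ℝ => ρ (y + t • (-(z.2 : Pos n))))
      (inner ℝ (gradient ρ y) (-(z.2 : Pos n))) 0 := by
    have h1 := (hρ.hasStrictFDerivAt y).hasFDerivAt
    have h2 : y = y + (0 : ℝ) • (-(z.2 : Pos n)) := by simp
    have h3 : HasFDerivAt ρ (innerSL ℝ (gradient ρ y)) (y + (0 : ℝ) • (-(z.2 : Pos n))) := by
      rwa [← h2]
    exact h3.comp_hasDerivAt (0 : ℝ) hl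
  have ht := hd.tendsto_slope_zero_right
  simp only [zero_add, zero_smul, add_zero, h0, sub_zero, smul_eq_mul] at ht
  have hcont : Filter.Tendsto (fun t : ℝ => y + t • (-(z.2 : Pos n))) (𝓝[>] 0) (𝓝 y) := by
    have : Continuous fun t : ℝ => y + t • (-(z.2 : Pos n)) := by fun_prop
    have h2 := this.tendsto 0
    simp only [zero_smul, add_zero] at h2
    exact h2.mono_left nhdsWithin_le_nhds
  have hle : inner ℝ (gradient ρ y) (-(z.2 : Pos n)) ≤ 0 := by
    refine le_of_tendsto ht ?_
    filter_upwards [hcont.eventually hρ.mem_iff, Ioo_mem_nhdsGT (tauPlus_pos ho hb hz)]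
      with t h1 h2
    have hmem : y + t • (-(z.2 : Pos n)) ∈ X := by
      have := flow_mem_of_lt_tauPlus hz (t := tauPlus X z - t) (by linarith [h2.2])
        (by linarith [h2.1])
      rw [flow_fst, sub_smul] at this
      rw [hy, exitPoint_eq, flow_fst, smul_neg]
      convert this using 1; abel
    have := h1.1 hmem
    exact mul_nonpos_of_nonneg_of_nonpos (inv_nonneg.2 h2.1.le) this.le
  rw [real_inner_comm] at hle
  exact absurd hin (not_lt.2 hle)

/-- The measure on phase space that gives mass one to every chord. -/
noncomputable def traceMeasure (X : Set (Pos n)) : Measure (Pos n × Dir n) :=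
  (phaseMeasure X).withDensity fun z => (ENNReal.ofReal ((X ×ˢ univ).indicator (chord X) z))⁻¹

/-- The point of exit, extended by the identity outside of `X`. -/
noncomputable def exitMap (X : Set (Pos n)) (z : Pos n × Dir n) : Pos n × Dir n :=
  flow ((X ×ˢ univ).indicator (tauPlus X) z) z

lemma exitMap_eq {z : Pos n × Dir n} (hz : z.1 ∈ X) : exitMap X z = exitPoint X z := by
  simp [exitMap, indicator, hz, exitPoint_eq]

include hX in
lemma measurable_exitMap : Measurable (exitMap X) :=
  measurable_indicator_exit hX.isOpen hX.isBounded

-- Fubini in the direction `θ` reduces this to the bound for a single direction.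
include hX in
lemma traceMeasure_exit_le_boundary {E : Set (Pos n × Dir n)} (hE : MeasurableSet E) :
    traceMeasure X (exitMap X ⁻¹' E) ≤ boundaryMeasure X E := by
  have := isFiniteMeasure_frontier hX
  have ho := hX.isOpen
  have hb := hX.isBounded
  have hQ := measurableSet_phase (X := X) ho
  have hpre : MeasurableSet (exitMap X ⁻¹' E) := measurable_exitMap hX hE
  have hd := measurable_chord_inv ho hb
  rw [traceMeasure, withDensity_apply _ hpre, phaseMeasure_eq, Measure.restrict_restrict hpre,
    ← lintegral_indicator (hpre.inter hQ), fullMeasure, lintegral_prod_symm,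
    boundaryMeasure, Measure.prod_apply_symm hE]
  swap
  · exact (hd.indicator (hpre.inter hQ)).aemeasurable
  refine lintegral_mono fun θ => ?_
  have hEθ : MeasurableSet ((fun x => (x, θ)) ⁻¹' E) := measurable_prodMk_right hE
  rw [Measure.restrict_apply hEθ]
  refine le_trans (le_of_eq ?_) (chordMeasure_exitSet_le ho hb θ hEθ)
  rw [chordMeasure, withDensity_apply _ (measurableSet_exitSet ho hb θ hEθ),
    ← lintegral_indicator (measurableSet_exitSet ho hb θ hEθ)]
  congr 1
  ext x
  have hiff : (x, θ) ∈ exitMap X ⁻¹' E ∩ X ×ˢ univ ↔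
      x ∈ exitSet X θ ((fun x => (x, θ)) ⁻¹' E) := by
    by_cases hx : x ∈ X
    · simp only [mem_inter_iff, mem_preimage, mem_prod, hx, mem_univ, and_true, exitSet, true_and,
        mem_ofPred_eq]
      rw [exitMap_eq (z := (x, θ)) hx]
      rfl
    · simp [hx, exitSet]
  by_cases h : x ∈ exitSet X θ ((fun x => (x, θ)) ⁻¹' E)
  · rw [indicator_of_mem h, indicator_of_mem (hiff.2 h)]
  · rw [indicator_of_notMem h, indicator_of_notMem (fun h' => h (hiff.1 h'))]

-- The density is the inverse of a finite number, hence nowhere zero.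
include hX in
lemma ae_phase_of_ae_traceMeasure {P : Pos n × Dir n → Prop}
    (h : ∀ᵐ z ∂(traceMeasure X), P z) : ∀ᵐ z ∂(phaseMeasure X), P z := by
  rw [traceMeasure, ae_withDensity_iff (measurable_chord_inv hX.isOpen hX.isBounded)] at h
  filter_upwards [h] with z hz
  exact hz (by simp)

lemma traceMeasure_absolutelyContinuous : traceMeasure X ≪ phaseMeasure X :=
  withDensity_absolutelyContinuous _ _

-- Tangential boundary pairs form a null set, so almost no line exits there, and no line exits
-- through `Γ₋`.
include hX in
lemma ae_exitPoint_mem : ∀ᵐ z ∂(phaseMeasure X), exitPoint X z ∈ outflowSet X := by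
  have hm : MeasurableSet ((frontier X ×ˢ (univ : Set (Dir n))) \ (outflowSet X ∪ inflowSet X)) :=
    measurableSet_frontier_prod.diff (measurableSet_outflowSet.union measurableSet_inflowSet)
  have h1 : traceMeasure X (exitMap X ⁻¹'
      ((frontier X ×ˢ univ) \ (outflowSet X ∪ inflowSet X))) = 0 :=
    le_antisymm ((traceMeasure_exit_le_boundary hX hm).trans_eq
      (boundaryMeasure_tangential hX)) zero_le
  have h2 := ae_phase_of_ae_traceMeasure hX (measure_eq_zero_iff_ae_notMem.1 h1)
  filter_upwards [h2, ae_phase_mem hX.isOpen] with z hz hzX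
  rw [mem_preimage, exitMap_eq hzX] at hz
  by_contra hno
  refine hz ⟨⟨exitPoint_mem_frontier hX.isOpen hX.isBounded hzX, trivial⟩, ?_⟩
  rintro (h | h)
  · exact hno h
  · exact exitPoint_notMem_inflowSet hX.isOpen hX.isBounded hzX h

include hX in
lemma map_exitMap_le : (traceMeasure X).map (exitMap X) ≤ outflowMeasure X := by
  refine Measure.le_iff.2 fun E hE => ?_
  rw [Measure.map_apply (measurable_exitMap hX) hE, outflowMeasure, Measure.restrict_apply hE]
  refine le_trans (measure_mono_ae ?_)
    (traceMeasure_exit_le_boundary hX (hE.inter measurableSet_outflowSet))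
  refine traceMeasure_absolutelyContinuous.ae_le ?_
  filter_upwards [ae_exitPoint_mem hX, ae_phase_mem hX.isOpen] with z hz hzX h
  have h' : exitMap X z ∈ E := h
  refine ⟨h', ?_⟩
  rw [exitMap_eq hzX]
  exact hz

-- This gives a meaning to exit values of functions that are only determined up to null sets of
-- `Γ₊`.
include hX in
lemma quasiMeasurePreserving_exitMap :
    Measure.QuasiMeasurePreserving (exitMap X) (phaseMeasure X) (outflowMeasure X) := by
  refine ⟨measurable_exitMap hX, Measure.AbsolutelyContinuous.mk fun E hE h0 => ?_⟩
  rw [Measure.map_apply (measurable_exitMap hX) hE]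
  have h1 : traceMeasure X (exitMap X ⁻¹' E) = 0 := by
    rw [← Measure.map_apply (measurable_exitMap hX) hE]
    exact le_antisymm ((map_exitMap_le hX E).trans_eq h0) zero_le
  exact measure_eq_zero_iff_ae_notMem.2
    (ae_phase_of_ae_traceMeasure hX (measure_eq_zero_iff_ae_notMem.1 h1))

include hX in
lemma ae_exitPoint {P : Pos n × Dir n → Prop} (h : ∀ᵐ z ∂(outflowMeasure X), P z) :
    ∀ᵐ z ∂(phaseMeasure X), P (exitPoint X z) := by
  filter_upwards [(quasiMeasurePreserving_exitMap hX).ae h, ae_phase_mem hX.isOpen] with z hz hzX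
  rwa [exitMap_eq hzX] at hz

include hX in
lemma ae_entryPoint {P : Pos n × Dir n → Prop} (h : ∀ᵐ z ∂(inflowMeasure X), P z) :
    ∀ᵐ z ∂(phaseMeasure X), P (entryPoint X z) := by
  have h1 := ae_exitPoint hX ((measurePreserving_rev_outflow hX).quasiMeasurePreserving.ae h)
  have h2 := measurePreserving_rev_phase.quasiMeasurePreserving.ae h1
  filter_upwards [h2] with z hz
  rwa [entryPoint_eq_rev]

include hX in
lemma aestronglyMeasurable_exitPoint {φ : Pos n × Dir n → ℝ}
    (h : AEStronglyMeasurable φ (outflowMeasure X)) :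
    AEStronglyMeasurable (fun z => φ (exitPoint X z)) (phaseMeasure X) :=
  (h.comp_quasiMeasurePreserving (quasiMeasurePreserving_exitMap hX)).congr (by
    filter_upwards [ae_phase_mem hX.isOpen] with z hz
    simp [exitMap_eq hz])

include hX in
/-- Averages over the chords are bounded by integrals over the outgoing boundary. -/
lemma lintegral_exitPoint_le {φ : Pos n × Dir n → ℝ}
    (h : AEStronglyMeasurable φ (outflowMeasure X)) :
    ∫⁻ z, ‖(chord X z)⁻¹ * φ (exitPoint X z)‖ₑ ∂(phaseMeasure X) ≤
      eLpNorm φ 1 (outflowMeasure X) := by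
  have hd := measurable_chord_inv (X := X) hX.isOpen hX.isBounded
  have h1 : ∫⁻ z, ‖φ (exitMap X z)‖ₑ ∂(traceMeasure X) ≤ eLpNorm φ 1 (outflowMeasure X) := by
    rw [eLpNorm_one_eq_lintegral_enorm]
    rw [← lintegral_map' (f := fun z => ‖φ z‖ₑ)
      (h.mono_ac (map_exitMap_le hX).absolutelyContinuous).enorm
      (measurable_exitMap hX).aemeasurable]
    exact lintegral_mono' (map_exitMap_le hX) le_rfl
  refine le_trans (le_of_eq ?_) h1
  have hq : AEMeasurable (fun z => ‖φ (exitMap X z)‖ₑ) (phaseMeasure X) :=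
    (h.comp_quasiMeasurePreserving (quasiMeasurePreserving_exitMap hX)).enorm
  rw [traceMeasure, lintegral_withDensity_eq_lintegral_mul₀ hd.aemeasurable hq]
  refine lintegral_congr_ae ?_
  filter_upwards [ae_phase_mem hX.isOpen] with z hz
  have hp := chord_pos hX.isOpen hX.isBounded hz
  simp only [Pi.mul_apply]
  rw [enorm_mul, exitMap_eq hz]
  congr 1
  rw [← ofReal_norm, Real.norm_of_nonneg (inv_nonneg.2 hp.le), ENNReal.ofReal_inv_of_pos hp]
  simp [indicator, hz]

include hX in
lemma lintegral_entryPoint_le {φ : Pos n × Dir n → ℝ}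
    (h : AEStronglyMeasurable φ (inflowMeasure X)) :
    ∫⁻ z, ‖(chord X z)⁻¹ * φ (entryPoint X z)‖ₑ ∂(phaseMeasure X) ≤
      eLpNorm φ 1 (inflowMeasure X) := by
  have hr := measurePreserving_rev_outflow hX
  have h1 := lintegral_exitPoint_le hX (φ := fun z => φ (rev z))
    (h.comp_measurePreserving hr)
  have h2 : eLpNorm (fun z => φ (rev z)) 1 (outflowMeasure X) = eLpNorm φ 1 (inflowMeasure X) :=
    eLpNorm_comp_measurePreserving h hr
  rw [h2] at h1
  refine le_trans (le_of_eq ?_) h1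
  have hp := measurePreserving_rev_phase (X := X)
  let e : (Pos n × Dir n) ≃ᵐ (Pos n × Dir n) :=
    ⟨⟨rev, rev, rev_rev, rev_rev⟩, continuous_rev.measurable, continuous_rev.measurable⟩
  have h3 := hp.lintegral_comp_emb e.measurableEmbedding
    (fun z => ‖(chord X z)⁻¹ * φ (rev (exitPoint X z))‖ₑ)
  rw [← h3]
  simp only [chord_rev, ← entryPoint_eq_rev]

include hX in
lemma integrable_exitPoint {φ : Pos n × Dir n → ℝ} (h : Integrable φ (outflowMeasure X)) :
    Integrable (fun z => (chord X z)⁻¹ * φ (exitPoint X z)) (phaseMeasure X) :=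
  ⟨(aemeasurable_chord hX.isOpen hX.isBounded).inv.aestronglyMeasurable.mul
    (aestronglyMeasurable_exitPoint hX h.aestronglyMeasurable),
    (lintegral_exitPoint_le hX h.aestronglyMeasurable).trans_lt
      (memLp_one_iff_integrable.2 h).2⟩

include hX in
lemma integrable_entryPoint {φ : Pos n × Dir n → ℝ} (h : Integrable φ (inflowMeasure X)) :
    Integrable (fun z => (chord X z)⁻¹ * φ (entryPoint X z)) (phaseMeasure X) := by
  have h1 := integrable_exitPoint hX
    ((measurePreserving_rev_outflow hX).integrable_comp_of_integrable h)
  have h2 := measurePreserving_rev_phase.integrable_comp_of_integrable h1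
  refine h2.congr (Filter.Eventually.of_forall fun z => ?_)
  simp [chord_rev, entryPoint_eq_rev]

end Traces

/-! ### The transport equation along lines and a maximum principle. -/

section Transport

/-- A comparison principle for primitives. -/
lemma le_of_barrier {a b L S W₀ : ℝ} {y : ℝ → ℝ} (hab : a ≤ b)
    (hy : IntervalIntegrable y volume a b) (hW₀ : W₀ ≤ L) (hS : 0 ≤ S)
    (h : ∀ᵐ t, t ∈ Ioo a b → L < W₀ + ∫ r in a..t, y r → y t ≤ S) :
    W₀ + ∫ r in a..b, y r ≤ L + (b - a) * S := by
  by_contra hcon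
  rw [not_le] at hcon
  set W : ℝ → ℝ := fun t => W₀ + ∫ r in a..t, y r with hW
  have hWc : ContinuousOn W (Icc a b) := by
    rw [← uIcc_of_le hab]
    refine continuousOn_const.add (intervalIntegral.continuousOn_primitive_interval ?_)
    rw [uIcc_of_le hab, integrableOn_Icc_iff_integrableOn_Ioc]
    exact (intervalIntegrable_iff_integrableOn_Ioc_of_le hab).1 hy
  set Z := {t | t ∈ Icc a b ∧ W t ≤ L + (t - a) * S} with hZ
  have hZc : IsClosed Z :=
    isClosed_Icc.isClosed_le hWc (by fun_prop)
  have hZn : Z.Nonempty := ⟨a, ⟨le_rfl, hab⟩, by simpa [hW] using hW₀⟩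
  have hZb : BddAbove Z := ⟨b, fun t ht => ht.1.2⟩
  -- This is the last time at which `W` is below the line of slope `S`. Later `W` exceeds `L`, so it
  -- grows at rate at most `S` and cannot end above that line.
  set t₁ := sSup Z with ht₁
  have hm : t₁ ∈ Z := hZc.csSup_mem hZn hZb
  have hlt : t₁ < b := by
    rcases hm.1.2.eq_or_lt with h' | h'
    · have := hm.2
      rw [h'] at this
      exact absurd hcon (not_lt.2 this)
    · exact h'
  have hy1 : IntervalIntegrable y volume a t₁ :=
    hy.mono_set (by rw [uIcc_of_le hab, uIcc_of_le hm.1.1]; exact Icc_subset_Icc_right hm.1.2)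
  have hy2 : IntervalIntegrable y volume t₁ b :=
    hy.mono_set (by rw [uIcc_of_le hab, uIcc_of_le hm.1.2]; exact Icc_subset_Icc_left hm.1.1)
  have h1 : ∫ r in t₁..b, y r ≤ ∫ r in t₁..b, S := by
    rw [intervalIntegral.integral_of_le hlt.le, intervalIntegral.integral_of_le hlt.le,
      integral_Ioc_eq_integral_Ioo, integral_Ioc_eq_integral_Ioo]
    refine setIntegral_mono_on_ae ((intervalIntegrable_iff_integrableOn_Ioo_of_le hlt.le).1 hy2)
      (integrableOn_const (by simp)) measurableSet_Ioo ?_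
    filter_upwards [h] with t ht htm
    refine ht ⟨hm.1.1.trans_lt htm.1, htm.2⟩ ?_
    have hnot : t ∉ Z := notMem_of_csSup_lt htm.1 hZb
    have htI : t ∈ Icc a b := ⟨hm.1.1.trans htm.1.le, htm.2.le⟩
    have h3 : L + (t - a) * S < W t := by
      by_contra h4
      exact hnot ⟨htI, not_lt.1 h4⟩
    have : 0 ≤ (t - a) * S := mul_nonneg (by linarith [htI.1]) hS
    change L < W t
    linarith
  rw [intervalIntegral.integral_const, smul_eq_mul] at h1
  have h2 := intervalIntegral.integral_add_adjacent_intervals hy1 hy2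
  have h3 : W₀ + ∫ r in a..t₁, y r ≤ L + (t₁ - a) * S := hm.2
  rw [← h2] at hcon
  nlinarith

variable (ho : IsOpen X) (hb : Bornology.IsBounded X)
variable {u w f h : Pos n × Dir n → ℝ}

lemma TransportFromInflow.ae_eq (hu : TransportFromInflow X u w f) :
    ∀ᵐ z ∂(phaseMeasure X), u z = f (entryPoint X z) +
      ∫ r in (-tauMinus X z)..0, w (flow r z) := by
  filter_upwards [hu] with z hz
  rw [hz]
  congr 1
  have := intervalIntegral.integral_comp_neg (a := 0) (b := tauMinus X z)
    (fun s => w (flow s z))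
  rw [neg_zero] at this
  rw [← this]
  simp [flow, sub_eq_add_neg]

include ho hb in
lemma TransportFromInflow.ae_line (hu : TransportFromInflow X u w f) :
    ∀ᵐ z ∂(phaseMeasure X), ∀ᵐ s : ℝ, s ∈ Ioo (-tauMinus X z) (tauPlus X z) →
      u (flow s z) = f (entryPoint X z) + ∫ r in (-tauMinus X z)..s, w (flow r z) := by
  filter_upwards [ae_segment ho hu.ae_eq, ae_phase_mem ho] with z hz hzX
  filter_upwards [hz] with s hs hsm
  rw [hs hsm, entryPoint_flow ho hb hzX hsm.1 hsm.2, tauMinus_flow ho hb hzX hsm.1 hsm.2]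
  congr 1
  simp_rw [flow_flow]
  rw [intervalIntegral.integral_comp_add_left (fun r => w (flow r z))]
  congr 1 <;> ring

lemma TransportToOutflow.ae_eq (hu : TransportToOutflow X u w h) :
    ∀ᵐ z ∂(phaseMeasure X), h (exitPoint X z) = u z +
      ∫ r in (0 : ℝ)..(tauPlus X z), w (flow r z) := by
  filter_upwards [hu] with z hz
  rw [hz]
  simp [flow]

lemma ae_phase_rev {P : Pos n × Dir n → Prop} (hP : ∀ᵐ z ∂(phaseMeasure X), P z) :
    ∀ᵐ z ∂(phaseMeasure X), P (rev z) :=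
  measurePreserving_rev_phase.quasiMeasurePreserving.ae hP

lemma transportFromInflow_reflect (hu : TransportToOutflow X u w h) :
    TransportFromInflow X (reflect u) (fun z => -w (rev z)) (reflect h) := by
  filter_upwards [ae_phase_rev hu] with z hz
  have h1 : reflect u z = u (rev z) := rfl
  have h2 : reflect h (entryPoint X z) = h (exitPoint X (rev z)) := by
    rw [entryPoint_eq_rev]; change h (rev (rev _)) = _; rw [rev_rev]
  rw [h1, h2, hz, ← tauMinus_eq, intervalIntegral.integral_neg]
  simp [rev, sub_eq_add_neg]

/-- In the transport equation, the functions matter only up to null sets. -/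
lemma TransportFromInflow.congr {u' w' : Pos n × Dir n → ℝ} (ho : IsOpen X)
    (hu : TransportFromInflow X u w f) (h1 : u' =ᵐ[phaseMeasure X] u)
    (h2 : w' =ᵐ[phaseMeasure X] w) : TransportFromInflow X u' w' f := by
  filter_upwards [hu, h1, ae_segment ho h2, ae_phase_mem ho] with z hz hz1 hz2 hzX
  rw [hz1, hz]
  congr 1
  have hp := tauMinus_nonneg (X := X) z
  have hp' := tauPlus_nonneg (X := X) z
  have hz2' : ∀ᵐ s : ℝ, -s ∈ Ioo (-tauMinus X z) (tauPlus X z) →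
      w' (flow (-s) z) = w (flow (-s) z) :=
    (Measure.measurePreserving_neg (volume : Measure ℝ)).quasiMeasurePreserving.ae hz2
  rw [intervalIntegral.integral_of_le hp, intervalIntegral.integral_of_le hp,
    integral_Ioc_eq_integral_Ioo, integral_Ioc_eq_integral_Ioo]
  refine setIntegral_congr_ae measurableSet_Ioo ?_
  filter_upwards [hz2'] with s hs hsm
  have := hs ⟨by linarith [hsm.2], by linarith [hsm.1]⟩
  simp only [flow, neg_smul, ← sub_eq_add_neg] at this
  exact this.symm

include ho hb in
/-- The fundamental estimate for the transport equation with absorption `σ`. -/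
lemma ae_abs_le_of_transport {σ : Pos n → ℝ} {c d B F s T C : ℝ} (hc : 0 ≤ c) (hd : 0 ≤ d)
    (hB : 0 ≤ B) (hs : 0 ≤ s) (hF : 0 ≤ F) (hT : ∀ z : Pos n × Dir n, z.1 ∈ X → chord X z ≤ T)
    (hw : AEStronglyMeasurable w (phaseMeasure X)) (hC : ∀ᵐ z ∂(phaseMeasure X), |w z| ≤ C)
    (hu : TransportFromInflow X u w f)
    (hf : ∀ᵐ z ∂(phaseMeasure X), |f (entryPoint X z)| ≤ F)
    (hσ : ∀ᵐ z ∂(phaseMeasure X), 0 ≤ σ z.1)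
    (hwu : ∀ᵐ z ∂(phaseMeasure X), |w z + σ z.1 * u z| ≤ (c * σ z.1 + d) * B + s) :
    ∀ᵐ z ∂(phaseMeasure X), |u z| ≤ F + (c + T * d) * B + T * s := by
  filter_upwards [hu.ae_eq, hu.ae_line ho hb, ae_segment ho (hσ.and hwu), hf,
    ae_intervalIntegrable_segment ho hw hC, ae_phase_mem ho] with z h1 h2 h3 h4 h5 hz
  have hm := tauMinus_pos ho hb hz
  have hp := tauPlus_pos ho hb hz
  have hτ : tauMinus X z ≤ T := by
    have := hT z hz
    rw [chord] at this
    linarith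
  have hint : IntervalIntegrable (fun r => w (flow r z)) volume (-tauMinus X z) 0 := by
    rw [intervalIntegrable_iff_integrableOn_Ioo_of_le (by linarith)]
    exact h5.mono_set (Ioo_subset_Ioo_right hp.le)
  have hdB : 0 ≤ d * B + s := add_nonneg (mul_nonneg hd hB) hs
  have hcB : 0 ≤ c * B := mul_nonneg hc hB
  have hend : max F (c * B) + (0 - -tauMinus X z) * (d * B + s) ≤
      F + (c + T * d) * B + T * s := by
    have e1 : max F (c * B) ≤ F + c * B := max_le (by linarith) (by linarith)
    have e2 : tauMinus X z * (d * B + s) ≤ T * (d * B + s) :=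
      mul_le_mul_of_nonneg_right hτ hdB
    nlinarith
  rw [h1, abs_le]
  constructor
  -- The comparison is made for `-u` here and for `u` below. Above the level `c * B`, the absorption
  -- `σ |u|` outweighs the term `c σ B`, and the growth rate is at most `d * B + s`.
  · have := le_of_barrier (L := max F (c * B)) (S := d * B + s) (W₀ := -f (entryPoint X z))
      (by linarith) hint.neg (((neg_le_abs _).trans h4).trans (le_max_left _ _)) hdB ?_
    · simp only [Pi.neg_apply] at this
      rw [intervalIntegral.integral_neg] at this
      linarith
    · filter_upwards [h2, h3] with t ht2 ht3 htm hL
      have htm' : t ∈ Ioo (-tauMinus X z) (tauPlus X z) := ⟨htm.1, htm.2.trans hp⟩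
      simp only [Pi.neg_apply] at hL ⊢
      rw [intervalIntegral.integral_neg, ← neg_add, ← ht2 htm'] at hL
      obtain ⟨e1, e2⟩ := ht3 htm'
      rw [abs_le] at e2
      have e3 : c * B < -u (flow t z) := (le_max_right _ _).trans_lt hL
      have e4 : σ (flow t z).1 * (c * B) ≤ σ (flow t z).1 * -u (flow t z) :=
        mul_le_mul_of_nonneg_left e3.le e1
      nlinarith [e2.1]
  · have := le_of_barrier (L := max F (c * B)) (S := d * B + s) (W₀ := f (entryPoint X z))
      (by linarith) hint (((le_abs_self _).trans h4).trans (le_max_left _ _)) hdB ?_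
    · linarith
    · filter_upwards [h2, h3] with t ht2 ht3 htm hL
      have htm' : t ∈ Ioo (-tauMinus X z) (tauPlus X z) := ⟨htm.1, htm.2.trans hp⟩
      rw [← ht2 htm'] at hL
      obtain ⟨e1, e2⟩ := ht3 htm'
      rw [abs_le] at e2
      have e3 : c * B < u (flow t z) := (le_max_right _ _).trans_lt hL
      have e4 : σ (flow t z).1 * (c * B) ≤ σ (flow t z).1 * u (flow t z) :=
        mul_le_mul_of_nonneg_left e3.le e1
      nlinarith [e2.2]

end Transport

/-! ### Bounds for the collision operator. -/

section Collision

/-- Quantitative bounds for the coefficients of the transport equation. -/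
structure CoefficientBound (X : Set (Pos n)) (L c d : ℝ) (σ : Pos n → ℝ)
    (k : Pos n → Dir n → Dir n → ℝ) : Prop where
  measurable : AEStronglyMeasurable σ (volume.restrict X)
  nonneg : ∀ᵐ x ∂(volume.restrict X), 0 ≤ σ x
  le_bound : ∀ᵐ x ∂(volume.restrict X), σ x ≤ L
  continuous : ContinuousOn (fun p : Pos n × Dir n × Dir n => k p.1 p.2.1 p.2.2) (X ×ˢ univ)
  scattering : ∀ᵐ z ∂(phaseMeasure X),
    ∫⁻ θ', ‖k z.1 z.2 θ'‖ₑ ∂(sphereMeasure n) ≤ ENNReal.ofReal (c * σ z.1 + d)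
  c_nonneg : 0 ≤ c
  d_nonneg : 0 ≤ d

lemma ae_phase_fst {P : Pos n → Prop} (h : ∀ᵐ x ∂(volume.restrict X), P x) :
    ∀ᵐ z ∂(phaseMeasure X), P z.1 :=
  Measure.quasiMeasurePreserving_fst.ae h

lemma quasiMeasurePreserving_fst_snd : Measure.QuasiMeasurePreserving
    (fun p : (Pos n × Dir n) × Dir n => (p.1.1, p.2)) ((phaseMeasure X).prod (sphereMeasure n))
    (phaseMeasure X) := by
  have h1 := (measurePreserving_prodAssoc (volume.restrict X) (sphereMeasure n)
    (sphereMeasure n)).quasiMeasurePreserving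
  have h2 : Measure.QuasiMeasurePreserving (Prod.map id Prod.snd : Pos n × Dir n × Dir n → _)
      ((volume.restrict X).prod ((sphereMeasure n).prod (sphereMeasure n))) (phaseMeasure X) :=
    QuasiMeasurePreserving.prodMap (Measure.QuasiMeasurePreserving.id _)
      Measure.quasiMeasurePreserving_snd
  exact h2.comp h1

variable {L c d B : ℝ} {σ : Pos n → ℝ} {k : Pos n → Dir n → Dir n → ℝ}
  {u v : Pos n × Dir n → ℝ}

lemma continuous_kernel
    (hk : ContinuousOn (fun p : Pos n × Dir n × Dir n => k p.1 p.2.1 p.2.2) (X ×ˢ univ))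
    {x : Pos n} (hx : x ∈ X) : Continuous fun p : Dir n × Dir n => k x p.1 p.2 := by
  rw [← continuousOn_univ]
  exact hk.comp (f := fun p : Dir n × Dir n => (x, p.1, p.2)) (by fun_prop)
    fun p _ => ⟨hx, trivial⟩

lemma ae_abs_slice_le (hu : ∀ᵐ z ∂(phaseMeasure X), |u z| ≤ B) :
    ∀ᵐ x ∂(volume.restrict X), ∀ᵐ θ ∂(sphereMeasure n), |u (x, θ)| ≤ B :=
  Measure.ae_ae_of_ae_prod hu

lemma ae_measurable_slice (hu : AEStronglyMeasurable u (phaseMeasure X)) :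
    ∀ᵐ x ∂(volume.restrict X), AEStronglyMeasurable (fun θ => u (x, θ)) (sphereMeasure n) :=
  hu.prodMk_left

lemma CoefficientBound.kernel (h : CoefficientBound X L c d σ k) (ho : IsOpen X)
    (hu : AEStronglyMeasurable u (phaseMeasure X)) (hB : ∀ᵐ z ∂(phaseMeasure X), |u z| ≤ B) :
    ∀ᵐ z ∂(phaseMeasure X), Integrable (fun θ' => k z.1 z.2 θ' * u (z.1, θ')) (sphereMeasure n) ∧
      |∫ θ', k z.1 z.2 θ' * u (z.1, θ') ∂(sphereMeasure n)| ≤ (c * σ z.1 + d) * B := by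
  filter_upwards [h.scattering, ae_phase_fst (ae_abs_slice_le hB),
    ae_phase_fst (ae_measurable_slice hu), ae_phase_mem ho, ae_phase_fst h.nonneg, hB]
    with z h1 h2 h3 hz h5 h6
  have hk : Continuous fun θ' => k z.1 z.2 θ' :=
    (continuous_kernel h.continuous hz).comp (by fun_prop : Continuous fun θ' => (z.2, θ'))
  have hki : Integrable (fun θ' => k z.1 z.2 θ') (sphereMeasure n) :=
    ⟨hk.aestronglyMeasurable, h1.trans_lt ENNReal.ofReal_lt_top⟩
  have hpos : 0 ≤ c * σ z.1 + d := add_nonneg (mul_nonneg h.c_nonneg h5) h.d_nonneg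
  refine ⟨hki.mul_bdd (c := B) h3 h2, ?_⟩
  have h4 : ∫ θ', ‖k z.1 z.2 θ'‖ ∂(sphereMeasure n) ≤ c * σ z.1 + d := by
    rw [integral_norm_eq_lintegral_enorm hki.aestronglyMeasurable]
    exact ENNReal.toReal_le_of_le_ofReal hpos h1
  have hB0 : 0 ≤ B := (abs_nonneg _).trans h6
  calc |∫ θ', k z.1 z.2 θ' * u (z.1, θ') ∂(sphereMeasure n)|
      ≤ ∫ θ', ‖k z.1 z.2 θ' * u (z.1, θ')‖ ∂(sphereMeasure n) :=
        by
          rw [← Real.norm_eq_abs]; exact norm_integral_le_integral_norm _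
    _ ≤ ∫ θ', ‖k z.1 z.2 θ'‖ * B ∂(sphereMeasure n) := by
        refine integral_mono_ae (hki.mul_bdd (c := B) h3 h2).norm (hki.norm.mul_const B) ?_
        filter_upwards [h2] with θ hθ
        rw [norm_mul]
        exact mul_le_mul_of_nonneg_left hθ (norm_nonneg _)
    _ ≤ (c * σ z.1 + d) * B := by
        rw [integral_mul_const]
        exact mul_le_mul_of_nonneg_right h4 hB0

lemma CoefficientBound.aestronglyMeasurable_kernel (h : CoefficientBound X L c d σ k)
    (ho : IsOpen X) (hu : AEStronglyMeasurable u (phaseMeasure X)) :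
    AEStronglyMeasurable (fun p : (Pos n × Dir n) × Dir n => k p.1.1 p.1.2 p.2 * u (p.1.1, p.2))
      ((phaseMeasure X).prod (sphereMeasure n)) := by
  refine AEStronglyMeasurable.mul ?_ (hu.comp_quasiMeasurePreserving quasiMeasurePreserving_fst_snd)
  have h1 : (phaseMeasure X).prod (sphereMeasure n) = ((fullMeasure n).prod
      (sphereMeasure n)).restrict ((X ×ˢ (univ : Set (Dir n))) ×ˢ (univ : Set (Dir n))) := by
    rw [← Measure.prod_restrict, Measure.restrict_univ, phaseMeasure_eq]
  rw [h1]
  refine ContinuousOn.aestronglyMeasurable ?_ ((measurableSet_phase ho).prod MeasurableSet.univ)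
  exact h.continuous.comp (f := fun p : (Pos n × Dir n) × Dir n => (p.1.1, p.1.2, p.2))
    (by fun_prop) fun p hp => ⟨hp.1.1, trivial⟩

lemma CoefficientBound.aestronglyMeasurable_collision (h : CoefficientBound X L c d σ k)
    (ho : IsOpen X) (hu : AEStronglyMeasurable u (phaseMeasure X)) :
    AEStronglyMeasurable (collision σ k u) (phaseMeasure X) := by
  refine AEStronglyMeasurable.add ?_ ?_
  · exact ((h.measurable.comp_quasiMeasurePreserving Measure.quasiMeasurePreserving_fst).mul
      hu).neg
  · exact (h.aestronglyMeasurable_kernel ho hu).integral_prod_right'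

/-- Adding `σ u` leaves the scattering integral alone. Absorption has to stay separate, since the
transport estimate uses its sign. -/
lemma CoefficientBound.collision_add_le (h : CoefficientBound X L c d σ k) (ho : IsOpen X)
    (hu : AEStronglyMeasurable u (phaseMeasure X)) (hB : ∀ᵐ z ∂(phaseMeasure X), |u z| ≤ B) :
    ∀ᵐ z ∂(phaseMeasure X), |collision σ k u z + σ z.1 * u z| ≤ (c * σ z.1 + d) * B := by
  filter_upwards [h.kernel ho hu hB] with z hz
  rw [collision, neg_add_cancel_comm]
  exact hz.2

lemma CoefficientBound.collision_le (h : CoefficientBound X L c d σ k) (ho : IsOpen X)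
    (hu : AEStronglyMeasurable u (phaseMeasure X)) (hB : ∀ᵐ z ∂(phaseMeasure X), |u z| ≤ B) :
    ∀ᵐ z ∂(phaseMeasure X), |collision σ k u z| ≤ (L + (c * L + d)) * B := by
  filter_upwards [h.collision_add_le ho hu hB, ae_phase_fst h.nonneg, ae_phase_fst h.le_bound, hB]
    with z h1 h2 h3 h4
  have hB0 : 0 ≤ B := (abs_nonneg _).trans h4
  have e1 : |σ z.1 * u z| ≤ L * B := by
    rw [abs_mul, abs_of_nonneg h2]
    exact mul_le_mul h3 h4 (abs_nonneg _) (h2.trans h3)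
  have e2 : (c * σ z.1 + d) * B ≤ (c * L + d) * B := by
    have := mul_le_mul_of_nonneg_left h3 h.c_nonneg
    exact mul_le_mul_of_nonneg_right (by linarith) hB0
  have e3 := abs_sub (collision σ k u z + σ z.1 * u z) (σ z.1 * u z)
  rw [add_sub_cancel_right] at e3
  linarith

lemma CoefficientBound.collision_sub (h : CoefficientBound X L c d σ k) (ho : IsOpen X)
    {B' : ℝ}
    (hu : AEStronglyMeasurable u (phaseMeasure X)) (hB : ∀ᵐ z ∂(phaseMeasure X), |u z| ≤ B)
    (hv : AEStronglyMeasurable v (phaseMeasure X)) (hB' : ∀ᵐ z ∂(phaseMeasure X), |v z| ≤ B') :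
    ∀ᵐ z ∂(phaseMeasure X),
      collision σ k (u - v) z = collision σ k u z - collision σ k v z := by
  filter_upwards [h.kernel ho hu hB, h.kernel ho hv hB'] with z h1 h2
  simp only [collision, Pi.sub_apply, mul_sub]
  rw [integral_sub h1.1 h2.1]
  ring

lemma collision_congr (σ : Pos n → ℝ) (k : Pos n → Dir n → Dir n → ℝ)
    (huv : u =ᵐ[phaseMeasure X] v) : collision σ k u =ᵐ[phaseMeasure X] collision σ k v := by
  have h1 : ∀ᵐ x ∂(volume.restrict X), ∀ᵐ θ ∂(sphereMeasure n), u (x, θ) = v (x, θ) :=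
    Measure.ae_ae_of_ae_prod huv
  filter_upwards [huv, ae_phase_fst h1] with z hz h2
  simp only [collision, hz]
  congr 1
  refine integral_congr_ae ?_
  filter_upwards [h2] with θ hθ
  rw [hθ]

/-- Absorption and scattering carry the same factor. This is why the first-order effect of the
modulation is `(m - 1) A u`. -/
lemma collision_smul (m : Pos n → ℝ) (σ : Pos n → ℝ) (k : Pos n → Dir n → Dir n → ℝ)
    (u : Pos n × Dir n → ℝ) (z : Pos n × Dir n) :
    collision (fun x => m x * σ x) (fun x θ θ' => m x * k x θ θ') u z =
      m z.1 * collision σ k u z := by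
  simp only [collision, mul_assoc]
  rw [integral_const_mul]
  ring

/-- The effect of a modulation on the bounds for the coefficients. -/
lemma CoefficientBound.modulate (h : CoefficientBound X L c d σ k) {m : Pos n → ℝ} {η : ℝ}
    (hη : η ≤ 1) (hm : Continuous m) (hm' : ∀ x, |m x - 1| ≤ η) :
    CoefficientBound X (2 * L) c ((1 + η) * d) (fun x => m x * σ x)
      (fun x θ θ' => m x * k x θ θ') := by
  have h0 : ∀ x, 0 ≤ m x := fun x => by linarith [(abs_le.1 (hm' x)).1]
  have h1 : ∀ x, m x ≤ 1 + η := fun x => by linarith [(abs_le.1 (hm' x)).2]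
  have hη0 : 0 ≤ η := (abs_nonneg _).trans (hm' 0)
  refine ⟨hm.aestronglyMeasurable.mul h.measurable, ?_, ?_, ?_, ?_, h.c_nonneg,
    mul_nonneg (by linarith) h.d_nonneg⟩
  · filter_upwards [h.nonneg] with x hx
    exact mul_nonneg (h0 x) hx
  · filter_upwards [h.nonneg, h.le_bound] with x hx hx'
    exact mul_le_mul (by linarith [h1 x]) hx' hx (by norm_num)
  · exact (hm.comp continuous_fst).continuousOn.mul h.continuous
  · filter_upwards [h.scattering] with z hz
    simp only [enorm_mul]
    rw [lintegral_const_mul' _ _ (by simp), Real.enorm_of_nonneg (h0 _)]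
    refine (mul_le_mul_right hz _).trans ?_
    rw [← ENNReal.ofReal_mul (h0 _)]
    refine ENNReal.ofReal_le_ofReal ?_
    -- In `m (c σ + d) = c (m σ) + m d` the first term belongs to the modulated absorption, so `c`
    -- is kept and only `d` grows.
    have := mul_le_mul_of_nonneg_right (h1 z.1) h.d_nonneg
    linarith

end Collision

/-! ### A priori bounds, uniqueness and dependence on the modulation. -/

section Estimates

lemma ae_abs_le_of_memLp {α : Type*} [MeasurableSpace α] {μ : Measure α} {u : α → ℝ}
    (hu : MemLp u ⊤ μ) : ∀ᵐ z ∂μ, |u z| ≤ (eLpNorm u ⊤ μ).toReal := by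
  filter_upwards [ae_le_eLpNormEssSup (f := u) (μ := μ)] with z hz
  rw [← eLpNorm_exponent_top] at hz
  have := ENNReal.toReal_mono hu.2.ne hz
  rwa [toReal_enorm, Real.norm_eq_abs] at this

variable {L c d T κ : ℝ} {σ : Pos n → ℝ} {k : Pos n → Dir n → Dir n → ℝ}
  {u v w y f g h S : Pos n × Dir n → ℝ}

/-- The a priori estimate for the transport equation. -/
lemma CoefficientBound.ae_abs_le (hk : CoefficientBound X L c d σ k) (ho : IsOpen X)
    (hb : Bornology.IsBounded X) (hT0 : 0 ≤ T)
    (hT : ∀ z : Pos n × Dir n, z.1 ∈ X → chord X z ≤ T) (hκ : c + T * d ≤ κ) (hκ1 : κ < 1)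
    {s F : ℝ} (hs0 : 0 ≤ s) (hF0 : 0 ≤ F) (hum : MemLp u ⊤ (phaseMeasure X))
    (hSm : AEStronglyMeasurable S (phaseMeasure X)) (hS : ∀ᵐ z ∂(phaseMeasure X), |S z| ≤ s)
    (hf : ∀ᵐ z ∂(phaseMeasure X), |f (entryPoint X z)| ≤ F)
    (hu : TransportFromInflow X u (fun z => collision σ k u z + S z) f) :
    ∀ᵐ z ∂(phaseMeasure X), |u z| ≤ (F + T * s) / (1 - κ) := by
  set B := (eLpNorm u ⊤ (phaseMeasure X)).toReal with hBdef
  have hB0 : 0 ≤ B := ENNReal.toReal_nonneg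
  have hB := ae_abs_le_of_memLp hum
  have hR : 0 ≤ F + (c + T * d) * B + T * s := by
    have := hk.c_nonneg
    have := hk.d_nonneg
    positivity
  have h1 : ∀ᵐ z ∂(phaseMeasure X), |u z| ≤ F + (c + T * d) * B + T * s := by
    refine ae_abs_le_of_transport ho hb (σ := σ) (C := (L + (c * L + d)) * B + s) hk.c_nonneg
      hk.d_nonneg hB0 hs0 hF0 hT ((hk.aestronglyMeasurable_collision ho hum.1).add hSm) ?_ hu hf
      (ae_phase_fst hk.nonneg) ?_
    · filter_upwards [hk.collision_le ho hum.1 hB, hS] with z h1 h2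
      exact (abs_add_le _ _).trans (add_le_add h1 h2)
    · filter_upwards [hk.collision_add_le ho hum.1 hB, hS] with z h1 h2
      have : (collision σ k u + S) z + σ z.1 * u z =
        (collision σ k u z + σ z.1 * u z) + S z := by rw [Pi.add_apply]; ring
      rw [this]
      exact (abs_add_le _ _).trans (add_le_add h1 h2)
  -- `B` is the norm of `u` itself, so the bound closes: `B ≤ F + κ B + T s` with `κ < 1`.
  have h2 : B ≤ F + (c + T * d) * B + T * s := by
    refine ENNReal.toReal_le_of_le_ofReal hR ?_
    rw [eLpNorm_exponent_top]
    exact eLpNormEssSup_le_of_ae_bound h1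
  have h3 : (c + T * d) * B ≤ κ * B := mul_le_mul_of_nonneg_right hκ hB0
  have h4 : B ≤ (F + T * s) / (1 - κ) := by
    rw [le_div_iff₀ (by linarith)]
    linarith
  exact hB.mono fun z hz => hz.trans h4

lemma TransportFromInflow.sub {u' w' f' : Pos n × Dir n → ℝ} {C C' : ℝ} (ho : IsOpen X)
    (hu : TransportFromInflow X u w f) (hu' : TransportFromInflow X u' w' f')
    (hw : AEStronglyMeasurable w (phaseMeasure X)) (hC : ∀ᵐ z ∂(phaseMeasure X), |w z| ≤ C)
    (hw' : AEStronglyMeasurable w' (phaseMeasure X)) (hC' : ∀ᵐ z ∂(phaseMeasure X), |w' z| ≤ C') :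
    TransportFromInflow X (u - u') (w - w') (f - f') := by
  have key : ∀ {w : Pos n × Dir n → ℝ} {z : Pos n × Dir n},
      IntegrableOn (fun s => w (flow s z)) (Ioo (-tauMinus X z) (tauPlus X z)) →
      IntervalIntegrable (fun s => w (z.1 - s • (z.2 : Pos n), z.2)) volume 0 (tauMinus X z) := by
    intro w z hi
    have h1 : IntervalIntegrable (fun s => w (flow s z)) volume (-tauMinus X z) 0 := by
      rw [intervalIntegrable_iff_integrableOn_Ioo_of_le
        (by linarith [tauMinus_nonneg (X := X) z])]
      exact hi.mono_set (Ioo_subset_Ioo_right (tauPlus_nonneg z))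
    have h2 := (IntervalIntegrable.iff_comp_neg).1 h1
    rw [neg_neg, neg_zero] at h2
    simpa [flow, sub_eq_add_neg] using h2.symm
  filter_upwards [hu, hu', ae_intervalIntegrable_segment ho hw hC,
    ae_intervalIntegrable_segment ho hw' hC'] with z h1 h2 h3 h4
  simp only [Pi.sub_apply]
  rw [h1, h2, intervalIntegral.integral_sub (key h3) (key h4)]
  ring

lemma CoefficientBound.unique (hk : CoefficientBound X L c d σ k) (ho : IsOpen X)
    (hb : Bornology.IsBounded X) (hT0 : 0 ≤ T)
    (hT : ∀ z : Pos n × Dir n, z.1 ∈ X → chord X z ≤ T) (hκ : c + T * d ≤ κ) (hκ1 : κ < 1)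
    (hu : IsRTESolution X σ k f u) (hv : IsRTESolution X σ k f v) :
    u =ᵐ[phaseMeasure X] v := by
  have hB := ae_abs_le_of_memLp hu.1
  have hB' := ae_abs_le_of_memLp hv.1
  have h1 := hu.2.sub ho hv.2 (hk.aestronglyMeasurable_collision ho hu.1.1)
    (hk.collision_le ho hu.1.1 hB) (hk.aestronglyMeasurable_collision ho hv.1.1)
    (hk.collision_le ho hv.1.1 hB')
  have h2 : TransportFromInflow X (u - v) (fun z => collision σ k (u - v) z + 0) (f - f) := by
    refine h1.congr ho (Filter.EventuallyEq.refl _ _) ?_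
    filter_upwards [hk.collision_sub ho hu.1.1 hB hv.1.1 hB'] with z hz
    simp [hz]
  have h3 := hk.ae_abs_le (S := fun _ => 0) (F := 0) (s := 0) ho hb hT0 hT hκ hκ1 le_rfl le_rfl
    (hu.1.sub hv.1) aestronglyMeasurable_const (by simp) (by simp) h2
  filter_upwards [h3] with z hz
  have : |u z - v z| ≤ 0 := by simpa using hz
  exact sub_eq_zero.1 (abs_eq_zero.1 (le_antisymm this (abs_nonneg _)))

/-- Under a modulation of size `η` of the coefficients, the solution changes by `O(η)`. -/
lemma CoefficientBound.ae_abs_sub_le (hk : CoefficientBound X L c d σ k) (ho : IsOpen X)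
    (hb : Bornology.IsBounded X) (hT0 : 0 ≤ T)
    (hT : ∀ z : Pos n × Dir n, z.1 ∈ X → chord X z ≤ T) {m : Pos n → ℝ} {η B : ℝ}
    (hη : η ≤ 1) (hm : Continuous m) (hm' : ∀ x, |m x - 1| ≤ η)
    (hκ : c + T * ((1 + η) * d) ≤ κ) (hκ1 : κ < 1) (hL : 0 ≤ L) (hB0 : 0 ≤ B)
    (hB : ∀ᵐ z ∂(phaseMeasure X), |u z| ≤ B) (hu : IsRTESolution X σ k f u)
    (hv : IsRTESolution X (fun x => m x * σ x) (fun x θ θ' => m x * k x θ θ') f v) :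
    ∀ᵐ z ∂(phaseMeasure X), |v z - u z| ≤ T * (η * ((L + (c * L + d)) * B)) / (1 - κ) := by
  have hη0 : 0 ≤ η := (abs_nonneg _).trans (hm' 0)
  have hkm := hk.modulate hη hm hm'
  have hBv := ae_abs_le_of_memLp hv.1
  have hc := hk.aestronglyMeasurable_collision ho hu.1.1
  have hcb := hk.collision_le ho hu.1.1 hB
  have h1 := hv.2.sub ho hu.2 (hkm.aestronglyMeasurable_collision ho hv.1.1)
    (hkm.collision_le ho hv.1.1 hBv) hc hcb
  -- The difference solves the modulated equation with zero data and the source `(m - 1) A u` of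
  -- size `η`.
  have h2 : TransportFromInflow X (v - u) (fun z => collision (fun x => m x * σ x)
      (fun x θ θ' => m x * k x θ θ') (v - u) z + (m z.1 - 1) * collision σ k u z) (f - f) := by
    refine h1.congr ho (Filter.EventuallyEq.refl _ _) ?_
    filter_upwards [hkm.collision_sub ho hv.1.1 hBv hu.1.1 hB] with z hz
    rw [hz, Pi.sub_apply, collision_smul m σ k u]
    ring
  have hN : 0 ≤ L + (c * L + d) := by
    have := hk.c_nonneg
    have := hk.d_nonneg
    positivity
  have h3 := hkm.ae_abs_le (F := 0) (s := η * ((L + (c * L + d)) * B)) ho hb hT0 hT hκ hκ1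
    (by positivity) le_rfl (hv.1.sub hu.1)
    (((hm.comp continuous_fst).sub continuous_const).aestronglyMeasurable.mul hc) ?_ (by simp) h2
  · simpa using h3
  · filter_upwards [hcb] with z hz
    simp only [Pi.mul_apply, abs_mul]
    exact mul_le_mul (hm' _) hz (abs_nonneg _) hη0

end Estimates

/-! ### Constants that are uniform over admissible coefficients. -/

section Admissible

variable {M α : ℝ} {σ : Pos n → ℝ} {k : Pos n → Dir n → Dir n → ℝ}

lemma exists_chord_le (hX : IsSmoothBoundedDomain X) (hn : 0 < n) : ∃ T : ℝ, 0 < T ∧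
    maxChordLength X = ENNReal.ofReal T ∧ ∀ z : Pos n × Dir n, z.1 ∈ X → chord X z ≤ T := by
  obtain ⟨D, hD⟩ := Metric.isBounded_iff.1 hX.isBounded
  have hle : maxChordLength X ≤ ENNReal.ofReal (D + D) :=
    iSup₂_le fun z hz => ENNReal.ofReal_le_ofReal (chord_le (fun x hx y hy => hD hx hy) hz.1)
  have htop : maxChordLength X ≠ ⊤ := (hle.trans_lt ENNReal.ofReal_lt_top).ne
  have hz : ∀ z : Pos n × Dir n, z.1 ∈ X → chord X z ≤ (maxChordLength X).toReal := by
    intro z hz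
    refine (ENNReal.ofReal_le_iff_le_toReal htop).1 ?_
    exact le_iSup₂ (f := fun (z : Pos n × Dir n) (_ : z ∈ X ×ˢ (univ : Set (Dir n))) =>
      ENNReal.ofReal (tauMinus X z + tauPlus X z)) z ⟨hz, trivial⟩
  -- A direction exists since `n > 0`; with a point of `X` it gives a chord of positive length,
  -- hence `0 < T`.
  have hθ : Nonempty (Dir n) := by
    have : Nontrivial (Pos n) := by
      have : Nonempty (Fin n) := ⟨⟨0, hn⟩⟩
      infer_instance
    exact (NormedSpace.sphere_nonempty.2 zero_le_one).to_subtype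
  obtain ⟨x, hx⟩ := hX.isConnected.nonempty
  obtain ⟨θ⟩ := hθ
  exact ⟨_, (chord_pos hX.isOpen hX.isBounded (z := (x, θ)) hx).trans_le (hz _ hx),
    (ENNReal.ofReal_toReal htop).symm, hz⟩

/-- Admissible coefficients obey bounds that are uniform in the coefficients. -/
lemma exists_coefficientBound (hX : IsSmoothBoundedDomain X) (hn : 0 < n) (M : ℝ) (hα : 0 < α) :
    ∃ T L κ : ℝ, 0 < T ∧ (∀ z : Pos n × Dir n, z.1 ∈ X → chord X z ≤ T) ∧ 0 ≤ L ∧ 0 ≤ κ ∧ κ < 1 ∧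
      ∀ σ k, IsAdmissible X M α σ k → ∃ c d, CoefficientBound X L c d σ k ∧ c + T * d ≤ κ ∧
        c ≤ 1 ∧ d ≤ L := by
  obtain ⟨T, hT0, hTeq, hT⟩ := exists_chord_le hX hn
  set M' := max M 0 with hM'
  have hM0 : 0 ≤ M' := le_max_right _ _
  have hM1 : M ≤ M' := le_max_left _ _
  have hc0 : 0 ≤ M' / (M' + α) := by positivity
  have hc1 : M' / (M' + α) < 1 := by rw [div_lt_one (by positivity)]; linarith
  -- The two entries of the maximum come from absorption (`d = 0`) and from smallness (`c = 0`). In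
  -- the latter case `d` is the scattering bound, which is at most `1 / T`; this explains the
  -- summand in `L`.
  refine ⟨T, M' + 1 / T, max (M' / (M' + α)) (1 - α), hT0, hT, by positivity,
    hc0.trans (le_max_left _ _), max_lt hc1 (by linarith), fun σ k h => ?_⟩
  have hsc : ∀ᵐ z ∂(phaseMeasure X),
      ∫⁻ θ', ‖k z.1 z.2 θ'‖ₑ ∂(sphereMeasure n) ≤ scatteringBound X k := ENNReal.ae_le_essSup _
  set r := (scatteringBound X k).toReal with hr
  have hr0 : 0 ≤ r := ENNReal.toReal_nonneg
  have hL : ∀ᵐ x ∂(volume.restrict X), σ x ≤ M' + 1 / T :=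
    h.le_bound.mono fun x hx => (hx.trans hM1).trans (by linarith [one_div_pos.2 hT0])
  rcases h.solvability with hs | hs
  -- The absorption condition has to hold at some point in order to show that the scattering bound
  -- is finite.
  · have hne : (ae (volume.restrict X)).NeBot := by
      rw [ae_neBot, Ne, Measure.restrict_eq_zero]
      exact (hX.isOpen.measure_pos _ hX.isConnected.nonempty).ne'
    obtain ⟨x₀, hx₀⟩ := hs.exists
    have htop : scatteringBound X k ≠ ⊤ :=
      ((le_self_add.trans hx₀).trans_lt ENNReal.ofReal_lt_top).ne
    -- From `r ≤ σ - α` and `σ ≤ M'` one gets `r (M' + α) ≤ (σ - α)(M' + α) ≤ M' σ`.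
    have hcσ : ∀ᵐ x ∂(volume.restrict X), r ≤ M' / (M' + α) * σ x := by
      filter_upwards [hs, h.le_bound, h.nonneg] with x h1 h2 h3
      rw [← ENNReal.ofReal_toReal htop, ← ENNReal.ofReal_add hr0 hα.le,
        ENNReal.ofReal_le_ofReal_iff h3] at h1
      rw [div_mul_eq_mul_div, le_div_iff₀ (by positivity)]
      nlinarith
    refine ⟨M' / (M' + α), 0, ⟨h.measurable, h.nonneg, hL, h.continuous, ?_, hc0, le_rfl⟩, ?_,
      hc1.le, by positivity⟩
    · filter_upwards [hsc, ae_phase_fst hcσ] with z h1 h2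
      refine h1.trans ?_
      rw [← ENNReal.ofReal_toReal htop, add_zero]
      exact ENNReal.ofReal_le_ofReal h2
    · rw [mul_zero, add_zero]; exact le_max_left _ _
  · have htop : scatteringBound X k ≠ ⊤ := by
      intro h0
      rw [hTeq, h0, ENNReal.mul_top (by simpa using hT0)] at hs
      simp at hs
    rw [hTeq, ← ENNReal.ofReal_toReal htop, ← ENNReal.ofReal_mul hT0.le,
      ← ENNReal.ofReal_add (by positivity) hα.le, ENNReal.ofReal_le_one] at hs
    refine ⟨0, r, ⟨h.measurable, h.nonneg, hL, h.continuous, ?_, le_rfl, hr0⟩, ?_, zero_le_one,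
      ?_⟩
    · filter_upwards [hsc] with z h1
      refine h1.trans ?_
      rw [zero_mul, zero_add, hr, ENNReal.ofReal_toReal htop]
    · rw [zero_add]
      exact le_trans (by linarith) (le_max_right _ _)
    · have : r ≤ 1 / T := by rw [le_div_iff₀ hT0]; linarith
      linarith

end Admissible

/-! ### Reciprocity: the adjoint equation as a reversed forward equation. -/

section Reciprocity

variable {L c d T κ : ℝ} {σ : Pos n → ℝ} {k : Pos n → Dir n → Dir n → ℝ}
  {u v f g h : Pos n × Dir n → ℝ}

lemma reflect_reflect (φ : Pos n × Dir n → ℝ) : reflect (reflect φ) = φ := by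
  ext z; simp [reflect]

lemma integral_neg_dir (F : Dir n → ℝ) :
    ∫ θ, F (-θ) ∂(sphereMeasure n) = ∫ θ, F θ ∂(sphereMeasure n) :=
  measurePreserving_neg_dir.integral_comp (Homeomorph.neg (Dir n)).measurableEmbedding F

/-- Substituting `-θ'` for `θ'` in the integral turns reciprocity into conjugation of `A*` to `A` by
reversal. -/
lemma collisionAdjoint_rev (hk : ∀ x ∈ X, ∀ θ θ' : Dir n, k x θ θ' = k x (-θ') (-θ))
    {z : Pos n × Dir n} (hz : z.1 ∈ X) :
    collisionAdjoint σ k v (rev z) = collision σ k (reflect v) z := by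
  simp only [collisionAdjoint, collision, rev_fst, rev_snd]
  rw [← integral_neg_dir (fun θ' => k z.1 θ' (-z.2) * v (z.1, θ'))]
  congr 1
  refine integral_congr_ae (Filter.Eventually.of_forall fun θ' => ?_)
  simp only [reflect]
  rw [hk z.1 hz z.2 θ']

/-- This makes the inflow trace of `v` accessible to measurement: `reflect v` is the solution whose
outgoing trace is `𝒜(g)`. -/
lemma IsAdjointRTESolution.reflect (ho : IsOpen X)
    (hk : ∀ x ∈ X, ∀ θ θ' : Dir n, k x θ θ' = k x (-θ') (-θ))
    (hv : IsAdjointRTESolution X σ k (reflect g) v) : IsRTESolution X σ k g (reflect v) := by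
  refine ⟨hv.1.comp_measurePreserving measurePreserving_rev_phase, ?_⟩
  have h1 := transportFromInflow_reflect hv.2
  rw [reflect_reflect] at h1
  refine h1.congr ho (Filter.EventuallyEq.refl _ _) ?_
  filter_upwards [ae_phase_mem ho] with z hz
  rw [neg_neg, collisionAdjoint_rev hk hz]

/-- The adjoint solution on the incoming boundary is given by the albedo operator. -/
lemma transportFromInflow_adjoint (ho : IsOpen X)
    (hk : ∀ x ∈ X, ∀ θ θ' : Dir n, k x θ θ' = k x (-θ') (-θ))
    (hu : TransportToOutflow X u (collision σ k u) h)
    (huv : u =ᵐ[phaseMeasure X] reflect v) :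
    TransportFromInflow X v (fun z => -collisionAdjoint σ k v z) (reflect h) := by
  have h1 := transportFromInflow_reflect hu
  refine h1.congr ho ?_ ?_
  · filter_upwards [ae_phase_rev huv] with z hz
    change v z = u (rev z)
    rw [hz]
    simp [AcoustoOptic.reflect, rev]
  · filter_upwards [ae_phase_rev (collision_congr σ k huv), ae_phase_mem ho] with z hz hzX
    rw [hz, ← collisionAdjoint_rev hk (z := rev z) hzX, rev_rev]

end Reciprocity

/-! ### Green's formula. -/

section Identity

/-- Integration by parts for primitives of integrable functions. -/
lemma integral_primitive_mul {a b U₀ V₀ : ℝ} {w y : ℝ → ℝ}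
    (hw : IntervalIntegrable w volume a b) (hy : IntervalIntegrable y volume a b) :
    ∫ t in a..b, (w t * (V₀ + ∫ r in a..t, y r) + (U₀ + ∫ r in a..t, w r) * y t) =
      (U₀ + ∫ r in a..b, w r) * (V₀ + ∫ r in a..b, y r) - U₀ * V₀ := by
  have hconst : ∀ c : ℝ, AbsolutelyContinuousOnInterval (fun _ : ℝ => c) a b := fun c =>
    (LipschitzWith.const c).lipschitzOnWith.absolutelyContinuousOnInterval
  have hU := (hconst U₀).fun_add
    (hw.absolutelyContinuousOnInterval_intervalIntegral left_mem_uIcc)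
  have hV := (hconst V₀).fun_add
    (hy.absolutelyContinuousOnInterval_intervalIntegral left_mem_uIcc)
  have h := AbsolutelyContinuousOnInterval.integral_deriv_mul_eq_sub hU hV
  simp only [intervalIntegral.integral_same, add_zero] at h
  rw [← h]
  refine intervalIntegral.integral_congr_ae ?_
  filter_upwards [hw.ae_hasDerivAt_integral, hy.ae_hasDerivAt_integral] with t h1 h2 ht
  have ht' := uIoc_subset_uIcc ht
  rw [((h1 ht' a left_mem_uIcc).const_add U₀).deriv, ((h2 ht' a left_mem_uIcc).const_add V₀).deriv]

/-- The flux out of `X` of a function on the outgoing boundary. -/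
noncomputable def exitPairing (X : Set (Pos n)) (φ : Pos n × Dir n → ℝ) : ℝ :=
  ∫ z, (chord X z)⁻¹ * φ (exitPoint X z) ∂(phaseMeasure X)

/-- The flux into `X` of a function on the incoming boundary. -/
noncomputable def entryPairing (X : Set (Pos n)) (φ : Pos n × Dir n → ℝ) : ℝ :=
  ∫ z, (chord X z)⁻¹ * φ (entryPoint X z) ∂(phaseMeasure X)

lemma exitPairing_le (hX : IsSmoothBoundedDomain X) {φ : Pos n × Dir n → ℝ}
    (hφ : AEStronglyMeasurable φ (outflowMeasure X)) :
    ‖exitPairing X φ‖ₑ ≤ eLpNorm φ 1 (outflowMeasure X) :=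
  (enorm_integral_le_lintegral_enorm _).trans (lintegral_exitPoint_le hX hφ)

lemma entryPairing_le (hX : IsSmoothBoundedDomain X) {φ : Pos n × Dir n → ℝ}
    (hφ : AEStronglyMeasurable φ (inflowMeasure X)) :
    ‖entryPairing X φ‖ₑ ≤ eLpNorm φ 1 (inflowMeasure X) :=
  (enorm_integral_le_lintegral_enorm _).trans (lintegral_entryPoint_le hX hφ)

lemma isFiniteMeasure_phase (hb : Bornology.IsBounded X) : IsFiniteMeasure (phaseMeasure X) := by
  have : IsFiniteMeasure (volume.restrict X) :=
    ⟨by rw [Measure.restrict_apply_univ]; exact hb.measure_lt_top⟩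
  unfold phaseMeasure
  infer_instance

variable {u w f a v y b' g' : Pos n × Dir n → ℝ} {Cu Cv Cw Cy : ℝ}

/-- Green's formula for a pair of transport equations. -/
theorem boundary_identity (hX : IsSmoothBoundedDomain X)
    (hum : AEStronglyMeasurable u (phaseMeasure X)) (hvm : AEStronglyMeasurable v (phaseMeasure X))
    (hwm : AEStronglyMeasurable w (phaseMeasure X)) (hym : AEStronglyMeasurable y (phaseMeasure X))
    (hub : ∀ᵐ z ∂(phaseMeasure X), |u z| ≤ Cu) (hvb : ∀ᵐ z ∂(phaseMeasure X), |v z| ≤ Cv)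
    (hwb : ∀ᵐ z ∂(phaseMeasure X), |w z| ≤ Cw) (hyb : ∀ᵐ z ∂(phaseMeasure X), |y z| ≤ Cy)
    (hu : TransportFromInflow X u w f) (hu' : TransportToOutflow X u w a)
    (hv : TransportFromInflow X v y b') (hv' : TransportToOutflow X v y g')
    (ha : Integrable (fun z => a z * g' z) (outflowMeasure X))
    (hf : Integrable (fun z => f z * b' z) (inflowMeasure X)) :
    exitPairing X (fun z => a z * g' z) - entryPairing X (fun z => f z * b' z) =
      ∫ z, (w z * v z + u z * y z) ∂(phaseMeasure X) := by
  have ho := hX.isOpen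
  have hb := hX.isBounded
  have := isFiniteMeasure_phase hb
  have hF : Integrable (fun z => w z * v z + u z * y z) (phaseMeasure X) := by
    refine Integrable.of_bound ((hwm.mul hvm).add (hum.mul hym)) (Cw * Cv + Cu * Cy) ?_
    filter_upwards [hub, hvb, hwb, hyb] with z h1 h2 h3 h4
    rw [Real.norm_eq_abs]
    refine (abs_add_le _ _).trans ?_
    rw [abs_mul, abs_mul]
    exact add_le_add (mul_le_mul h3 h2 (abs_nonneg _) ((abs_nonneg _).trans h3))
      (mul_le_mul h1 h4 (abs_nonneg _) ((abs_nonneg _).trans h1))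
  rw [integral_phase_eq ho hb hF, exitPairing, entryPairing,
    ← integral_sub (integrable_exitPoint hX ha) (integrable_entryPoint hX hf)]
  refine integral_congr_ae ?_
  filter_upwards [hu.ae_line ho hb, hv.ae_line ho hb, hu.ae_eq, hv.ae_eq, hu'.ae_eq, hv'.ae_eq,
    ae_intervalIntegrable_segment ho hwm hwb, ae_intervalIntegrable_segment ho hym hyb,
    ae_phase_mem ho] with z h1 h2 h3 h4 h5 h6 h7 h8 hz
  have hm := tauMinus_pos ho hb hz
  have hp := tauPlus_pos ho hb hz
  have hle : -tauMinus X z ≤ tauPlus X z := by linarith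
  rw [← intervalIntegrable_iff_integrableOn_Ioo_of_le hle] at h7 h8
  -- Entry and exit values are both expressed relative to `z`, so the chord is split at time zero.
  have hsub : ∀ {q : ℝ → ℝ}, IntervalIntegrable q volume (-tauMinus X z) (tauPlus X z) →
      (∫ r in (-tauMinus X z)..0, q r) + ∫ r in (0 : ℝ)..(tauPlus X z), q r =
        ∫ r in (-tauMinus X z)..(tauPlus X z), q r := by
    intro q hq
    refine intervalIntegral.integral_add_adjacent_intervals (hq.mono_set ?_) (hq.mono_set ?_)
    · rw [uIcc_of_le hle, uIcc_of_le (by linarith)]; exact Icc_subset_Icc_right hp.le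
    · rw [uIcc_of_le hle, uIcc_of_le (by linarith)]; exact Icc_subset_Icc_left (by linarith)
  have e := integral_primitive_mul (U₀ := f (entryPoint X z)) (V₀ := b' (entryPoint X z)) h7 h8
  rw [← hsub h7, ← hsub h8, ← add_assoc, ← add_assoc, ← h3, ← h4, ← h5, ← h6] at e
  rw [← mul_sub, ← e]
  congr 1
  rw [intervalIntegral.integral_of_le hle, intervalIntegral.integral_of_le hle,
    integral_Ioc_eq_integral_Ioo, integral_Ioc_eq_integral_Ioo]
  refine setIntegral_congr_ae measurableSet_Ioo ?_
  filter_upwards [h1, h2] with s hs1 hs2 hs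
  rw [hs1 hs, hs2 hs]

end Identity

/-! ### Duality of `A` and `A*`. -/

section Adjoint

variable {L c d B B' : ℝ} {σ : Pos n → ℝ} {k : Pos n → Dir n → Dir n → ℝ}
  {u v : Pos n × Dir n → ℝ}

/-- Fubini on the product of two spheres. The kernel is bounded there by compactness; the bound may
depend on the point of `X`, since only integrability is needed. -/
lemma integral_slice_adjoint {K : Dir n → Dir n → ℝ} (hK : Continuous fun p : Dir n × Dir n =>
    K p.1 p.2) {a b : Dir n → ℝ} (ha : AEStronglyMeasurable a (sphereMeasure n))
    (hb : AEStronglyMeasurable b (sphereMeasure n)) (hB : ∀ᵐ θ ∂(sphereMeasure n), |a θ| ≤ B)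
    (hB' : ∀ᵐ θ ∂(sphereMeasure n), |b θ| ≤ B') (s : ℝ) :
    ∫ θ, (-(s * a θ) + ∫ θ', K θ θ' * a θ' ∂(sphereMeasure n)) * b θ ∂(sphereMeasure n) =
      ∫ θ, a θ * (-(s * b θ) + ∫ θ', K θ' θ * b θ' ∂(sphereMeasure n)) ∂(sphereMeasure n) := by
  have hab : Integrable (fun θ => a θ * b θ) (sphereMeasure n) := by
    refine Integrable.of_bound (ha.mul hb) (B * B') ?_
    filter_upwards [hB, hB'] with θ h1 h2
    rw [norm_mul]
    exact mul_le_mul h1 h2 (abs_nonneg _) ((abs_nonneg _).trans h1)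
  obtain ⟨N, hN⟩ := isCompact_univ.exists_bound_of_continuousOn hK.continuousOn
  have h2 : Integrable (fun p : Dir n × Dir n => b p.1 * (K p.1 p.2 * a p.2))
      ((sphereMeasure n).prod (sphereMeasure n)) := by
    refine Integrable.of_bound (hb.comp_fst.mul (hK.aestronglyMeasurable.mul ha.comp_snd))
      (B' * (N * B)) ?_
    filter_upwards [Measure.quasiMeasurePreserving_fst.ae hB',
      Measure.quasiMeasurePreserving_snd.ae hB] with p h1 h2
    rw [norm_mul, norm_mul]
    have h3 := hN p trivial
    have h4 : 0 ≤ N := (norm_nonneg _).trans h3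
    exact mul_le_mul h1 (mul_le_mul h3 h2 (abs_nonneg _) h4) (by positivity)
      ((abs_nonneg _).trans h1)
  have hswap := integral_integral_swap (f := fun θ θ' => b θ * (K θ θ' * a θ')) h2
  have i1 : Integrable (fun θ => b θ * ∫ θ', K θ θ' * a θ' ∂(sphereMeasure n))
      (sphereMeasure n) := by
    have := h2.integral_prod_left
    simpa only [integral_const_mul] using this
  have i2 : Integrable (fun θ => a θ * ∫ θ', K θ' θ * b θ' ∂(sphereMeasure n))
      (sphereMeasure n) := by
    have := h2.integral_prod_right
    refine this.congr (Filter.Eventually.of_forall fun θ => ?_)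
    simp only
    rw [← integral_const_mul]
    congr 1; ext θ'; ring
  have e1 : ∀ θ, (-(s * a θ) + ∫ θ', K θ θ' * a θ' ∂(sphereMeasure n)) * b θ =
      -s * (a θ * b θ) + b θ * ∫ θ', K θ θ' * a θ' ∂(sphereMeasure n) := fun θ => by ring
  have e2 : ∀ θ, a θ * (-(s * b θ) + ∫ θ', K θ' θ * b θ' ∂(sphereMeasure n)) =
      -s * (a θ * b θ) + a θ * ∫ θ', K θ' θ * b θ' ∂(sphereMeasure n) := fun θ => by ring
  simp_rw [e1, e2]
  rw [integral_add (hab.const_mul _) i1, integral_add (hab.const_mul _) i2]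
  congr 1
  simp_rw [← integral_const_mul]
  rw [hswap]
  congr 1; ext θ'; congr 1; ext θ; ring

/-- `CoefficientBound` controls the integral of `k` in its last variable only. Reciprocity transfers
the bound to the other variable. -/
lemma CoefficientBound.collisionAdjoint_mem (h : CoefficientBound X L c d σ k) (ho : IsOpen X)
    (hk : ∀ x ∈ X, ∀ θ θ' : Dir n, k x θ θ' = k x (-θ') (-θ))
    (hv : AEStronglyMeasurable v (phaseMeasure X)) (hB : ∀ᵐ z ∂(phaseMeasure X), |v z| ≤ B) :
    AEStronglyMeasurable (collisionAdjoint σ k v) (phaseMeasure X) ∧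
      ∀ᵐ z ∂(phaseMeasure X), |collisionAdjoint σ k v z| ≤ (L + (c * L + d)) * B := by
  have hmp := measurePreserving_rev_phase (X := X)
  have hr : AEStronglyMeasurable (reflect v) (phaseMeasure X) := hv.comp_measurePreserving hmp
  have hrb : ∀ᵐ z ∂(phaseMeasure X), |reflect v z| ≤ B := ae_phase_rev hB
  have heq : (fun z => collision σ k (reflect v) (rev z)) =ᵐ[phaseMeasure X]
      collisionAdjoint σ k v := by
    filter_upwards [ae_phase_mem ho] with z hz
    rw [← collisionAdjoint_rev hk (z := rev z) hz, rev_rev]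
  refine ⟨((h.aestronglyMeasurable_collision ho hr).comp_measurePreserving hmp).congr heq, ?_⟩
  filter_upwards [heq, ae_phase_rev (h.collision_le ho hr hrb)] with z h1 h2
  rwa [← h1]

lemma integrable_mul_of_bound (hb : Bornology.IsBounded X)
    (hu : AEStronglyMeasurable u (phaseMeasure X)) (hB : ∀ᵐ z ∂(phaseMeasure X), |u z| ≤ B)
    (hv : AEStronglyMeasurable v (phaseMeasure X)) (hB' : ∀ᵐ z ∂(phaseMeasure X), |v z| ≤ B') :
    Integrable (fun z => u z * v z) (phaseMeasure X) := by
  have := isFiniteMeasure_phase hb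
  refine Integrable.of_bound (hu.mul hv) (B * B') ?_
  filter_upwards [hB, hB'] with z h1 h2
  rw [norm_mul]
  exact mul_le_mul h1 h2 (abs_nonneg _) ((abs_nonneg _).trans h1)

lemma CoefficientBound.integral_adjoint (h : CoefficientBound X L c d σ k) (ho : IsOpen X)
    (hb : Bornology.IsBounded X)
    (hk : ∀ x ∈ X, ∀ θ θ' : Dir n, k x θ θ' = k x (-θ') (-θ))
    (hu : AEStronglyMeasurable u (phaseMeasure X)) (hB : ∀ᵐ z ∂(phaseMeasure X), |u z| ≤ B)
    (hv : AEStronglyMeasurable v (phaseMeasure X)) (hB' : ∀ᵐ z ∂(phaseMeasure X), |v z| ≤ B') :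
    ∫ z, collision σ k u z * v z ∂(phaseMeasure X) =
      ∫ z, u z * collisionAdjoint σ k v z ∂(phaseMeasure X) := by
  obtain ⟨h1, h2⟩ := h.collisionAdjoint_mem ho hk hv hB'
  have i1 := integrable_mul_of_bound hb (h.aestronglyMeasurable_collision ho hu)
    (h.collision_le ho hu hB) hv hB'
  have i2 := integrable_mul_of_bound hb hu hB h1 h2
  rw [phaseMeasure] at i1 i2 ⊢
  rw [integral_prod _ i1, integral_prod _ i2]
  refine integral_congr_ae ?_
  filter_upwards [ae_measurable_slice hu, ae_measurable_slice hv, ae_abs_slice_le hB,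
    ae_abs_slice_le hB', ae_restrict_mem ho.measurableSet] with x h3 h4 h5 h6 hx
  exact integral_slice_adjoint (continuous_kernel h.continuous hx) h3 h4 h5 h6 (σ x)

end Adjoint

/-! ### First-order expansion of the boundary pairing. -/

section FirstOrder

lemma abs_modulation_sub_one_le {ε : ℝ} (hε : 0 ≤ ε) (q : Pos n) (φ : ℝ) (x : Pos n) :
    |modulation ε q φ x - 1| ≤ ε := by
  rw [modulation, add_sub_cancel_left, abs_mul, abs_of_nonneg hε]
  exact mul_le_of_le_one_right hε (Real.abs_cos_le_one _)

lemma continuous_modulation (ε : ℝ) (q : Pos n) (φ : ℝ) : Continuous (modulation ε q φ) := by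
  unfold modulation; fun_prop

lemma integrable_mul_of_memLp_top {α : Type*} [MeasurableSpace α] {μ : Measure α}
    [IsFiniteMeasure μ] {φ ψ : α → ℝ} (hφ : MemLp φ ⊤ μ) (hψ : MemLp ψ ⊤ μ) :
    Integrable (fun z => φ z * ψ z) μ := by
  exact (hψ.integrable le_top).bdd_mul hφ.1 (ae_abs_le_of_memLp hφ)

lemma memLp_reflect (hX : IsSmoothBoundedDomain X) {g : Pos n × Dir n → ℝ}
    (hg : MemLp g ⊤ (inflowMeasure X)) : MemLp (reflect g) ⊤ (outflowMeasure X) :=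
  hg.comp_measurePreserving (measurePreserving_rev_outflow hX)

lemma memLp_reflect' (hX : IsSmoothBoundedDomain X) {b : Pos n × Dir n → ℝ}
    (hb : MemLp b ⊤ (outflowMeasure X)) : MemLp (reflect b) ⊤ (inflowMeasure X) :=
  hb.comp_measurePreserving (measurePreserving_rev_inflow hX)

/-- The internal functional, tested against the modulation, to first order. -/
theorem exists_first_order (hn : 0 < n) (hX : IsSmoothBoundedDomain X)
    {f g : Pos n × Dir n → ℝ} (hf : MemLp f ⊤ (inflowMeasure X))
    (hg : MemLp g ⊤ (inflowMeasure X)) (M : ℝ) {α : ℝ} (hα : 0 < α) :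
    ∃ C > 0, ∃ ε₀ > 0, ∀ (σ : Pos n → ℝ) (k : Pos n → Dir n → Dir n → ℝ)
      (u v b : Pos n × Dir n → ℝ), IsExperiment X M α f g σ k u v b →
      (∀ᵐ x ∂(volume.restrict X),
        Integrable (fun θ => collision σ k u (x, θ) * v (x, θ)) (sphereMeasure n)) ∧
      MemLp (internalFunctional σ k u v) ⊤ (volume.restrict X) ∧
      ∀ ε ∈ Ioo 0 ε₀, ∀ (q : Pos n) (φ : ℝ) (a : Pos n × Dir n → ℝ),
        IsAlbedo X (fun x => modulation ε q φ x * σ x)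
          (fun x θ θ' => modulation ε q φ x * k x θ θ') f a →
        |exitPairing X (fun z => a z * reflect g z) - entryPairing X (fun z => f z * reflect b z)
          - ε * ∫ x in X, internalFunctional σ k u v x * Real.cos (inner ℝ q x + φ)|
          ≤ C * ε ^ 2 := by
  have ho := hX.isOpen
  have hb := hX.isBounded
  have hfin := isFiniteMeasure_phase hb
  have hfinb := isFiniteMeasure_boundary hX
  have hfin1 : IsFiniteMeasure (outflowMeasure X) := by unfold outflowMeasure; infer_instance
  have hfin2 : IsFiniteMeasure (inflowMeasure X) := by unfold inflowMeasure; infer_instance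
  obtain ⟨T, L, κ, hT0, hT, hL, hκ0, hκ1, hadm⟩ := exists_coefficientBound hX hn M hα
  set F := (eLpNorm f ⊤ (inflowMeasure X)).toReal with hF
  set G := (eLpNorm g ⊤ (inflowMeasure X)).toReal with hG
  have hF0 : 0 ≤ F := ENNReal.toReal_nonneg
  have hG0 : 0 ≤ G := ENNReal.toReal_nonneg
  have hFb : ∀ᵐ z ∂(phaseMeasure X), |f (entryPoint X z)| ≤ F :=
    ae_entryPoint hX (ae_abs_le_of_memLp hf)
  have hGb : ∀ᵐ z ∂(phaseMeasure X), |g (entryPoint X z)| ≤ G :=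
    ae_entryPoint hX (ae_abs_le_of_memLp hg)
  have hκ' : 0 < 1 - κ := by linarith
  set Bu := F / (1 - κ) with hBu
  set Bv := G / (1 - κ) with hBv
  have hBu0 : 0 ≤ Bu := by positivity
  have hBv0 : 0 ≤ Bv := by positivity
  -- `ε * D` will bound `u_ε - u`. Here `3 * L` bounds `L + (c * L + d)`, the norm of `A`, and `(1 +
  -- κ) / 2` is the contraction constant of the modulated equation.
  set D := T * (3 * L * Bu) / (1 - (1 + κ) / 2) with hD
  have hden : 0 < 1 - (1 + κ) / 2 := by linarith
  have hD0 : 0 ≤ D := by positivity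
  set V := (phaseMeasure X).real univ with hV
  have hV0 : 0 ≤ V := measureReal_nonneg
  -- The summand 1 only makes the constant positive. For `ε ≤ (1 - κ) / 2`, modulation keeps the
  -- contraction constant below `(1 + κ) / 2`, because `T * d ≤ 1`.
  refine ⟨V * (3 * L * D * Bv) + 1, by positivity, min 1 ((1 - κ) / 2), by positivity,
    fun σ k u v b hE => ?_⟩
  obtain ⟨c, d, hk, hcd, hc1, hdL⟩ := hadm σ k hE.admissible
  have hrec := hE.admissible.reciprocity
  have hN : L + (c * L + d) ≤ 3 * L := by nlinarith [mul_le_mul_of_nonneg_right hc1 hL]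
  have hN0 : 0 ≤ L + (c * L + d) := by
    have := hk.c_nonneg
    have := hk.d_nonneg
    positivity
  have apriori : ∀ {w h : Pos n × Dir n → ℝ} {H : ℝ}, 0 ≤ H → IsRTESolution X σ k h w →
      (∀ᵐ z ∂(phaseMeasure X), |h (entryPoint X z)| ≤ H) →
      ∀ᵐ z ∂(phaseMeasure X), |w z| ≤ H / (1 - κ) := by
    intro w h H hH hw hh
    have h1 := hk.ae_abs_le (S := fun _ => 0) (F := H) (s := 0) ho hb hT0.le hT hcd hκ1 le_rfl hH
      hw.1 aestronglyMeasurable_const (by simp) hh (by simpa using hw.2)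
    simpa using h1
  have hub : ∀ᵐ z ∂(phaseMeasure X), |u z| ≤ Bu := apriori hF0 hE.forward hFb
  have hvr : IsRTESolution X σ k g (reflect v) := hE.adjoint.reflect ho hrec
  have hvb : ∀ᵐ z ∂(phaseMeasure X), |v z| ≤ Bv := by
    filter_upwards [ae_phase_rev (apriori hG0 hvr hGb)] with z hz
    have : reflect v (rev z) = v z := by simp [reflect, rev]
    rwa [this] at hz
  have hum := hE.forward.1.1
  have hvm := hE.adjoint.1.1
  have hAm := hk.aestronglyMeasurable_collision ho hum
  have hAb := hk.collision_le ho hum hub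
  have hint := integrable_mul_of_bound hb hAm hAb hvm hvb
  have hslice : ∀ᵐ x ∂(volume.restrict X),
      Integrable (fun θ => collision σ k u (x, θ) * v (x, θ)) (sphereMeasure n) :=
    Integrable.prod_right_ae hint
  refine ⟨hslice, ?_, fun ε hε q φ a ha => ?_⟩
  · refine memLp_top_of_bound (hAm.mul hvm).integral_prod_right'
      ((L + (c * L + d)) * Bu * Bv * (sphereMeasure n).real univ) ?_
    filter_upwards [ae_abs_slice_le hAb, ae_abs_slice_le hvb] with x h1 h2
    refine norm_integral_le_of_norm_le_const ?_
    filter_upwards [h1, h2] with θ h3 h4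
    rw [norm_mul]
    exact mul_le_mul h3 h4 (abs_nonneg _) (by positivity)
  · obtain ⟨ham, uε, huε, huε'⟩ := ha
    obtain ⟨hbm, ug, hug, hug'⟩ := hE.albedo
    have hε0 : 0 < ε := hε.1
    have hε1 : ε ≤ 1 := hε.2.le.trans (min_le_left _ _)
    have hεκ : ε ≤ (1 - κ) / 2 := hε.2.le.trans (min_le_right _ _)
    set m := modulation ε q φ with hm
    have hmc : Continuous m := continuous_modulation ε q φ
    have hm1 : ∀ x, |m x - 1| ≤ ε := abs_modulation_sub_one_le hε0.le q φ
    have hkm := hk.modulate hε1 hmc hm1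
    have hκm : c + T * ((1 + ε) * d) ≤ (1 + κ) / 2 := by
      have h1 : 0 ≤ T * d := mul_nonneg hT0.le hk.d_nonneg
      have h2 := hk.c_nonneg
      have h3 : T * d ≤ 1 := by linarith
      have h4 : ε * (T * d) ≤ ε := mul_le_of_le_one_right hε0.le h3
      nlinarith
    have hdiff := hk.ae_abs_sub_le ho hb hT0.le hT hε1 hmc hm1 hκm (by linarith) hL hBu0 hub
      hE.forward huε
    have hdiff' : ∀ᵐ z ∂(phaseMeasure X), |(uε - u) z| ≤ ε * D := by
      filter_upwards [hdiff] with z hz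
      refine hz.trans ?_
      have e : ε * D = (ε * (T * (3 * L * Bu))) / (1 - (1 + κ) / 2) := by rw [hD]; ring
      rw [e]
      refine div_le_div_of_nonneg_right ?_ hden.le
      have h1 := mul_le_mul_of_nonneg_right hN hBu0
      have h2 := mul_le_mul_of_nonneg_left h1 (mul_nonneg hT0.le hε0.le)
      linarith
    have hεm := huε.1.1
    have hεb := ae_abs_le_of_memLp huε.1
    have hAεm := hk.aestronglyMeasurable_collision ho hεm
    have hAεb := hk.collision_le ho hεm hεb
    obtain ⟨hadjm, hadjb⟩ := hk.collisionAdjoint_mem ho hrec hvm hvb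
    -- The solution behind the datum `b = 𝒜(g)` is some `ug`; uniqueness identifies it with the
    -- reflected adjoint solution.
    have huv : ug =ᵐ[phaseMeasure X] reflect v := hk.unique ho hb hT0.le hT hcd hκ1 hug hvr
    have hvin := transportFromInflow_adjoint ho hrec hug' huv
    have hid := boundary_identity hX hεm hvm (hkm.aestronglyMeasurable_collision ho hεm) hadjm.neg
      hεb hvb (hkm.collision_le ho hεm hεb)
      (Cy := (L + (c * L + d)) * Bv) (by simpa using hadjb) huε.2 huε' hvin hE.adjoint.2
      (integrable_mul_of_memLp_top ham (memLp_reflect hX hg))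
      (integrable_mul_of_memLp_top hf (memLp_reflect' hX hbm))
    have i1 := integrable_mul_of_bound hb hAεm hAεb hvm hvb
    have i2 := integrable_mul_of_bound hb hεm hεb hadjm hadjb
    have i3 : Integrable (fun z => (m z.1 - 1) * (collision σ k uε z * v z)) (phaseMeasure X) :=
      i1.bdd_mul (c := ε) (by fun_prop) (Filter.Eventually.of_forall fun z => hm1 z.1)
    -- Writing `m A = A + (m - 1) A`, the first part cancels against `A*` by duality.
    have hgreen : ∫ z, (collision (fun x => m x * σ x) (fun x θ θ' => m x * k x θ θ') uε z * v z +
        uε z * -collisionAdjoint σ k v z) ∂(phaseMeasure X) =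
        ∫ z, (m z.1 - 1) * (collision σ k uε z * v z) ∂(phaseMeasure X) := by
      have e : ∀ z, collision (fun x => m x * σ x) (fun x θ θ' => m x * k x θ θ') uε z * v z +
          uε z * -collisionAdjoint σ k v z = (m z.1 - 1) * (collision σ k uε z * v z) +
          (collision σ k uε z * v z - uε z * collisionAdjoint σ k v z) := fun z => by
        rw [collision_smul m]; ring
      have i5 : Integrable (fun z => collision σ k uε z * v z - uε z * collisionAdjoint σ k v z)
          (phaseMeasure X) := i1.sub i2
      simp_rw [e]
      rw [integral_add i3 i5, integral_sub i1 i2,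
        hk.integral_adjoint ho hb hrec hεm hεb hvm hvb, sub_self, add_zero]
    have i4 : Integrable (fun z => (m z.1 - 1) * (collision σ k u z * v z)) (phaseMeasure X) :=
      hint.bdd_mul (c := ε) (by fun_prop) (Filter.Eventually.of_forall fun z => hm1 z.1)
    have hH : ε * ∫ x in X, internalFunctional σ k u v x * Real.cos (inner ℝ q x + φ) =
        ∫ z, (m z.1 - 1) * (collision σ k u z * v z) ∂(phaseMeasure X) := by
      rw [phaseMeasure] at i4 ⊢
      rw [integral_prod _ i4, ← integral_const_mul]
      congr 1
      ext x
      change _ = ∫ y, (m x - 1) * (collision σ k u (x, y) * v (x, y)) ∂(sphereMeasure n)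
      have hmx : m x - 1 = ε * Real.cos (inner ℝ q x + φ) := by
        rw [hm, modulation, add_sub_cancel_left]
      rw [integral_const_mul, hmx, internalFunctional]
      ring
    simp only [Pi.neg_apply] at hid
    rw [hid, hgreen, hH, ← integral_sub i3 i4, ← Real.norm_eq_abs]
    -- One factor `ε` comes from `m - 1`, the other from `uε - u`.
    have hbound : ∀ᵐ z ∂(phaseMeasure X), ‖(m z.1 - 1) * (collision σ k uε z * v z) -
        (m z.1 - 1) * (collision σ k u z * v z)‖ ≤ ε * ((3 * L * (ε * D)) * Bv) := by
      filter_upwards [hk.collision_sub ho hεm hεb hum hub,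
        hk.collision_le ho (hεm.sub hum) hdiff', hvb] with z h1 h2 h3
      have e : (m z.1 - 1) * (collision σ k uε z * v z) - (m z.1 - 1) * (collision σ k u z * v z) =
          (m z.1 - 1) * (collision σ k (uε - u) z * v z) := by rw [h1]; ring
      rw [e, norm_mul, norm_mul]
      have hεD : 0 ≤ ε * D := by positivity
      have h4 : ‖collision σ k (uε - u) z‖ ≤ 3 * L * (ε * D) :=
        h2.trans (mul_le_mul_of_nonneg_right hN hεD)
      exact mul_le_mul (hm1 z.1) (mul_le_mul h4 h3 (norm_nonneg _) (by positivity))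
        (by positivity) hε0.le
    refine (norm_integral_le_of_norm_le_const hbound).trans ?_
    rw [← hV]
    have : ε * ((3 * L * (ε * D)) * Bv) * V = V * (3 * L * D * Bv) * ε ^ 2 := by ring
    rw [this]
    exact mul_le_mul_of_nonneg_right (by linarith) (by positivity)

end FirstOrder

/-! ### Fourier inversion and sup-norm bounds. -/

section Fourier

open FourierTransform Filter

/-- `F` need not be continuous, so inversion holds only almost everywhere. It is tested against
smooth compactly supported `g`, written as the transform of a Schwartz function; the transform is
moved onto `F` and the inverse transform then onto `𝓕 F`. -/
lemma ae_eq_fourierInv_fourier {F : Pos n → ℂ} (hF : Integrable F) (hF' : Integrable (𝓕 F)) :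
    F =ᵐ[volume] 𝓕⁻ (𝓕 F) := by
  have hcont : Continuous (𝓕⁻ (𝓕 F)) :=
    VectorFourier.fourierIntegral_continuous Real.continuous_fourierChar
      (L := -innerₗ (Pos n)) ((continuous_inner (𝕜 := ℝ) (E := Pos n)).neg) hF'
  refine ae_eq_of_integral_contDiff_smul_eq hF.locallyIntegrable hcont.locallyIntegrable
    fun g hg hgs => ?_
  have hgs' : HasCompactSupport fun x => (g x : ℂ) := hgs.comp_left (g := Complex.ofReal) rfl
  have hg' : ContDiff ℝ (⊤ : ℕ∞) fun x => (g x : ℂ) := Complex.ofRealCLM.contDiff.comp hg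
  set S : SchwartzMap (Pos n) ℂ := hgs'.toSchwartzMap hg' with hS
  set ψ : SchwartzMap (Pos n) ℂ := 𝓕⁻ S with hψ
  have hSg : ∀ x, S x = (g x : ℂ) := fun x => rfl
  have h1 : 𝓕 (ψ : Pos n → ℂ) = S := by
    rw [← SchwartzMap.fourier_coe, hψ, FourierTransform.fourier_fourierInv_eq]
  have h2 : 𝓕⁻ (S : Pos n → ℂ) = ψ := by rw [hψ, SchwartzMap.fourierInv_coe]
  have h3 : ∫ x, S x • F x = ∫ x, ψ x • 𝓕 F x := by
    rw [← h1]
    have := VectorFourier.integral_fourierIntegral_smul_eq_flip (L := innerₗ (Pos n))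
      Real.continuous_fourierChar continuous_inner (ψ.integrable (μ := volume)) hF
    rwa [flip_innerₗ] at this
  have h4 : ∫ x, ψ x • 𝓕 F x = ∫ x, S x • 𝓕⁻ (𝓕 F) x := by
    rw [← h2]
    have := VectorFourier.integral_fourierIntegral_smul_eq_flip (L := -innerₗ (Pos n))
      Real.continuous_fourierChar
      ((continuous_inner (𝕜 := ℝ) (E := Pos n)).neg)
      (S.integrable (μ := volume)) hF'
    have e : (-innerₗ (Pos n)).flip = -innerₗ (Pos n) := by
      ext x y; simp [real_inner_comm]
    rwa [e] at this
  have h5 := h3.trans h4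
  simp only [hSg] at h5
  simpa using h5

/-- If `𝓕 F` is not integrable, the right side is infinite; otherwise the inversion formula applies.
-/
lemma eLpNorm_top_le_lintegral_fourier {F : Pos n → ℂ} (hF : Integrable F) :
    eLpNorm F ⊤ volume ≤ ∫⁻ w, ‖𝓕 F w‖ₑ := by
  have hc : Continuous (𝓕 F) := VectorFourier.fourierIntegral_continuous
    Real.continuous_fourierChar (L := innerₗ (Pos n)) continuous_inner hF
  by_cases hF' : Integrable (𝓕 F)
  · rw [eLpNorm_exponent_top]
    refine essSup_le_of_ae_le _ ?_
    filter_upwards [ae_eq_fourierInv_fourier hF hF'] with x hx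
    rw [hx, Real.fourierInv_eq']
    refine (enorm_integral_le_lintegral_enorm _).trans (le_of_eq ?_)
    refine lintegral_congr fun w => ?_
    rw [enorm_smul, ← ofReal_norm, Complex.norm_exp_ofReal_mul_I]
    simp
  · have : ∫⁻ w, ‖𝓕 F w‖ₑ = ⊤ := by
      by_contra h
      exact hF' ⟨hc.aestronglyMeasurable, lt_top_iff_ne_top.2 h⟩
    rw [this]; exact le_top

lemma fourierOn_smul (hX : MeasurableSet X) (H : Pos n → ℝ) (w : Pos n) :
    fourierOn X H ((2 * Real.pi) • w) = 𝓕 (X.indicator fun x => (H x : ℂ)) w := by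
  rw [Real.fourier_eq', fourierOn, ← integral_indicator hX]
  refine integral_congr_ae (Eventually.of_forall fun x => ?_)
  by_cases hx : x ∈ X
  · simp only [indicator_of_mem hx, smul_eq_mul]
    rw [mul_comm, inner_smul_left, real_inner_comm]
    congr 2
    simp
    ring
  · simp [indicator_of_notMem hx]

lemma integrable_indicator_ofReal (hX : MeasurableSet X) {H : Pos n → ℝ}
    (hH : Integrable H (volume.restrict X)) :
    Integrable (X.indicator fun x => (H x : ℂ)) :=
  (integrable_indicator_iff hX).2 hH.ofReal

lemma continuous_fourierOn (hX : MeasurableSet X) {H : Pos n → ℝ}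
    (hH : Integrable H (volume.restrict X)) : Continuous (fourierOn X H) := by
  have hc : Continuous (𝓕 (X.indicator fun x => (H x : ℂ))) :=
    VectorFourier.fourierIntegral_continuous Real.continuous_fourierChar
      (L := innerₗ (Pos n)) continuous_inner (integrable_indicator_ofReal hX hH)
  have : fourierOn X H = fun q =>
      𝓕 (X.indicator fun x => (H x : ℂ)) ((2 * Real.pi)⁻¹ • q) := by
    ext q
    rw [← fourierOn_smul hX, smul_inv_smul₀ (by positivity)]
  rw [this]
  exact hc.comp (continuous_const_smul _)

/-- The Riemann-Lebesgue lemma. -/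
lemma tendsto_fourierOn (hX : MeasurableSet X) (H : Pos n → ℝ) :
    Tendsto (fourierOn X H) (cocompact (Pos n)) (𝓝 0) := by
  have h := tendsto_integral_exp_inner_smul_cocompact (X.indicator fun x => (H x : ℂ))
  have e : (2 * Real.pi)⁻¹ ≠ 0 := by positivity
  have h2 := h.comp (Homeomorph.smulOfNeZero _ e).isClosedEmbedding.tendsto_cocompact
  refine h2.congr fun q => ?_
  have := fourierOn_smul hX H ((2 * Real.pi)⁻¹ • q)
  rw [smul_inv_smul₀ (by positivity)] at this
  rw [this]
  rfl

lemma eLpNorm_top_le_lintegral_fourierOn (hX : MeasurableSet X) {H : Pos n → ℝ}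
    (hH : Integrable H (volume.restrict X)) :
    eLpNorm H ⊤ (volume.restrict X) ≤ ∫⁻ q, ‖fourierOn X H q‖ₑ := by
  have h1 : eLpNorm H ⊤ (volume.restrict X) =
      eLpNorm (X.indicator fun x => (H x : ℂ)) ⊤ volume := by
    rw [eLpNorm_indicator_eq_eLpNorm_restrict hX]
    exact eLpNorm_congr_norm_ae (Eventually.of_forall fun x => by simp)
  rw [h1]
  refine (eLpNorm_top_le_lintegral_fourier (integrable_indicator_ofReal hX hH)).trans ?_
  simp_rw [← fourierOn_smul hX]
  have hpi : (2 * Real.pi) ≠ 0 := by positivity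
  have hm : Measurable fun q => ‖fourierOn X H q‖ₑ := (continuous_fourierOn hX hH).enorm.measurable
  rw [← lintegral_map (μ := volume) (f := fun q => ‖fourierOn X H q‖ₑ)
    (g := fun w : Pos n => (2 * Real.pi) • w) hm (measurable_const_smul _),
    Measure.map_addHaar_smul _ hpi, lintegral_smul_measure]
  -- The rescaling `q = 2π w` produces the factor `(2π)⁻ⁿ ≤ 1`, which is dropped.
  refine mul_le_of_le_one_left (zero_le) ?_
  rw [ENNReal.ofReal_le_one, abs_of_nonneg (by positivity)]
  exact inv_le_one_of_one_le₀ (one_le_pow₀ (by linarith [Real.pi_gt_three]))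

lemma integrable_mul_cos {H : Pos n → ℝ} (hH : Integrable H (volume.restrict X)) (q : Pos n)
    (φ : ℝ) : Integrable (fun x => H x * Real.cos (inner ℝ q x + φ)) (volume.restrict X) :=
  hH.mul_bdd (c := 1) (by fun_prop) (Eventually.of_forall fun x => Real.abs_cos_le_one _)

/-- `e^{-iq·x} = cos(q·x) + i cos(q·x + π/2)`. This is why exactly these two phases are measured:
they give the real and the imaginary part. -/
lemma fourierOn_eq {H : Pos n → ℝ} (hH : Integrable H (volume.restrict X)) (q : Pos n) :
    fourierOn X H q = ((∫ x in X, H x * Real.cos (inner ℝ q x + 0) : ℝ) : ℂ) +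
      Complex.I * ((∫ x in X, H x * Real.cos (inner ℝ q x + Real.pi / 2) : ℝ) : ℂ) := by
  rw [fourierOn, ← integral_complex_ofReal, ← integral_complex_ofReal, ← integral_const_mul,
    ← integral_add (integrable_mul_cos hH q 0).ofReal
      ((integrable_mul_cos hH q _).ofReal.const_mul _)]
  refine integral_congr_ae (Eventually.of_forall fun x => ?_)
  have e : -(Complex.I * ((inner ℝ q x : ℝ) : ℂ)) = ((-(inner ℝ q x) : ℝ) : ℂ) * Complex.I := by
    push_cast; ring
  simp only [add_zero, Real.cos_add_pi_div_two]
  rw [e, Complex.exp_mul_I, ← Complex.ofReal_cos, ← Complex.ofReal_sin, Real.cos_neg, Real.sin_neg]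
  push_cast
  ring

lemma fourierOn_sub {H₁ H₂ : Pos n → ℝ} (h₁ : Integrable H₁ (volume.restrict X))
    (h₂ : Integrable H₂ (volume.restrict X)) (q : Pos n) :
    fourierOn X (H₁ - H₂) q = fourierOn X H₁ q - fourierOn X H₂ q := by
  rw [fourierOn_eq (h₁.sub h₂), fourierOn_eq h₁, fourierOn_eq h₂]
  simp_rw [Pi.sub_apply, sub_mul]
  rw [integral_sub (integrable_mul_cos h₁ q _) (integrable_mul_cos h₂ q _),
    integral_sub (integrable_mul_cos h₁ q _) (integrable_mul_cos h₂ q _)]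
  push_cast
  ring

lemma re_fourierOn {H : Pos n → ℝ} (hH : Integrable H (volume.restrict X)) (q : Pos n) :
    (fourierOn X H q).re = ∫ x in X, H x * Real.cos (inner ℝ q x + 0) := by
  rw [fourierOn_eq hH]; simp

lemma im_fourierOn {H : Pos n → ℝ} (hH : Integrable H (volume.restrict X)) (q : Pos n) :
    (fourierOn X H q).im = ∫ x in X, H x * Real.cos (inner ℝ q x + Real.pi / 2) := by
  rw [fourierOn_eq hH]; simp

lemma enorm_le_enorm_re_add_enorm_im (z : ℂ) : ‖z‖ₑ ≤ ‖z.re‖ₑ + ‖z.im‖ₑ := by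
  rw [Real.enorm_eq_ofReal_abs, Real.enorm_eq_ofReal_abs, ← ENNReal.ofReal_add (abs_nonneg _)
    (abs_nonneg _), ← ofReal_norm]
  exact ENNReal.ofReal_le_ofReal (Complex.norm_le_abs_re_add_abs_im z)

/-- A function is controlled by its Fourier transform on a large ball. -/
lemma exists_le_two_mul_lintegral_fourierOn (hX : MeasurableSet X) {H : Pos n → ℝ}
    (hH : Integrable H (volume.restrict X)) (hH' : MemLp H ⊤ (volume.restrict X)) :
    ∃ R : ℝ, eLpNorm H ⊤ (volume.restrict X) ≤
      2 * ∫⁻ q in Metric.closedBall 0 R, ‖fourierOn X H q‖ₑ := by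
  set h := eLpNorm H ⊤ (volume.restrict X) with hh
  rcases eq_or_ne h 0 with h0 | h0
  · exact ⟨0, by rw [h0]; exact zero_le⟩
  have hlim : Tendsto (fun R : ℕ => ∫⁻ q in Metric.closedBall (0 : Pos n) R, ‖fourierOn X H q‖ₑ)
      atTop (𝓝 (∫⁻ q, ‖fourierOn X H q‖ₑ)) :=
    (aecover_closedBall tendsto_natCast_atTop_atTop).lintegral_tendsto_of_countably_generated
      (continuous_fourierOn hX hH).enorm.measurable.aemeasurable
  -- Halving a finite nonzero norm makes the inequality strict, so a large enough ball already
  -- suffices.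
  have hlt : h / 2 < ∫⁻ q, ‖fourierOn X H q‖ₑ :=
    (ENNReal.half_lt_self h0 hH'.2.ne).trans_le (eLpNorm_top_le_lintegral_fourierOn hX hH)
  obtain ⟨R, hR⟩ := (hlim.eventually (lt_mem_nhds hlt)).exists
  refine ⟨R, ?_⟩
  calc h = 2 * (h / 2) := (ENNReal.mul_div_cancel (by norm_num) (by norm_num)).symm
    _ ≤ _ := by gcongr

end Fourier

/-! ### Reconstruction and stability. -/

section Stability

open Filter

lemma enorm_exitPairing_mul_le (hX : IsSmoothBoundedDomain X) {a g : Pos n × Dir n → ℝ}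
    (ha : MemLp a ⊤ (outflowMeasure X)) (hg : MemLp g ⊤ (inflowMeasure X)) :
    ‖exitPairing X (fun z => a z * reflect g z)‖ₑ ≤
      eLpNorm g 1 (inflowMeasure X) * eLpNorm a ⊤ (outflowMeasure X) := by
  have hr := (memLp_reflect hX hg).1
  refine (exitPairing_le hX (ha.1.mul hr)).trans ?_
  have h := eLpNorm_le_eLpNorm_top_mul_eLpNorm 1 a hr (fun s t => s * t) 1
    (Eventually.of_forall fun z => by simp)
  have e : eLpNorm (reflect g) 1 (outflowMeasure X) = eLpNorm g 1 (inflowMeasure X) :=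
    eLpNorm_comp_measurePreserving hg.1 (measurePreserving_rev_outflow hX)
  rw [e, ENNReal.coe_one, one_mul, mul_comm] at h
  exact h

lemma enorm_entryPairing_mul_le (hX : IsSmoothBoundedDomain X) {f b : Pos n × Dir n → ℝ}
    (hf : MemLp f ⊤ (inflowMeasure X)) (hb : MemLp b ⊤ (outflowMeasure X)) :
    ‖entryPairing X (fun z => f z * reflect b z)‖ₑ ≤
      eLpNorm f 1 (inflowMeasure X) * eLpNorm b ⊤ (outflowMeasure X) := by
  have hr := (memLp_reflect' hX hb).1
  refine (entryPairing_le hX (hf.1.mul hr)).trans ?_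
  have h := eLpNorm_le_eLpNorm_mul_eLpNorm_top 1 hf.1 (reflect b) (fun s t => s * t) 1
    (Eventually.of_forall fun z => by simp)
  have e : eLpNorm (reflect b) ⊤ (inflowMeasure X) = eLpNorm b ⊤ (outflowMeasure X) :=
    eLpNorm_comp_measurePreserving hb.1 (measurePreserving_rev_inflow hX)
  rw [e, ENNReal.coe_one, one_mul] at h
  exact h

lemma isFiniteMeasure_outflow (hX : IsSmoothBoundedDomain X) :
    IsFiniteMeasure (outflowMeasure X) := by
  have := isFiniteMeasure_boundary hX
  unfold outflowMeasure
  infer_instance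

lemma isFiniteMeasure_inflow (hX : IsSmoothBoundedDomain X) :
    IsFiniteMeasure (inflowMeasure X) := by
  have := isFiniteMeasure_boundary hX
  unfold inflowMeasure
  infer_instance

lemma exitPairing_sub_mul (hX : IsSmoothBoundedDomain X) {a₁ a₂ g : Pos n × Dir n → ℝ}
    (h₁ : MemLp a₁ ⊤ (outflowMeasure X)) (h₂ : MemLp a₂ ⊤ (outflowMeasure X))
    (hg : MemLp g ⊤ (inflowMeasure X)) :
    exitPairing X (fun z => (a₁ - a₂) z * reflect g z) =
      exitPairing X (fun z => a₁ z * reflect g z) - exitPairing X (fun z => a₂ z * reflect g z) := by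
  have := isFiniteMeasure_outflow hX
  have hr := memLp_reflect hX hg
  rw [exitPairing, exitPairing, exitPairing,
    ← integral_sub (integrable_exitPoint hX (integrable_mul_of_memLp_top h₁ hr))
      (integrable_exitPoint hX (integrable_mul_of_memLp_top h₂ hr))]
  refine integral_congr_ae (Eventually.of_forall fun z => ?_)
  simp only [Pi.sub_apply]
  ring

lemma entryPairing_mul_sub (hX : IsSmoothBoundedDomain X) {b₁ b₂ f : Pos n × Dir n → ℝ}
    (h₁ : MemLp b₁ ⊤ (outflowMeasure X)) (h₂ : MemLp b₂ ⊤ (outflowMeasure X))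
    (hf : MemLp f ⊤ (inflowMeasure X)) :
    entryPairing X (fun z => f z * reflect (b₁ - b₂) z) =
      entryPairing X (fun z => f z * reflect b₁ z) -
        entryPairing X (fun z => f z * reflect b₂ z) := by
  have := isFiniteMeasure_inflow hX
  rw [entryPairing, entryPairing, entryPairing,
    ← integral_sub
      (integrable_entryPoint hX (integrable_mul_of_memLp_top hf (memLp_reflect' hX h₁)))
      (integrable_entryPoint hX (integrable_mul_of_memLp_top hf (memLp_reflect' hX h₂)))]
  refine integral_congr_ae (Eventually.of_forall fun z => ?_)
  simp only [reflect, Pi.sub_apply]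
  ring

lemma integrable_of_memLp_top (hb : Bornology.IsBounded X) {H : Pos n → ℝ}
    (hH : MemLp H ⊤ (volume.restrict X)) : Integrable H (volume.restrict X) := by
  have : IsFiniteMeasure (volume.restrict X) :=
    ⟨by rw [Measure.restrict_apply_univ]; exact hb.measure_lt_top⟩
  exact hH.integrable le_top

/-- The difference of the internal functionals of two experiments, tested against the modulation,
to first order. -/
theorem exists_first_order_sub (hn : 0 < n) (hX : IsSmoothBoundedDomain X)
    {f g : Pos n × Dir n → ℝ} (hf : MemLp f ⊤ (inflowMeasure X))
    (hg : MemLp g ⊤ (inflowMeasure X)) (M : ℝ) {α : ℝ} (hα : 0 < α) :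
    ∃ C > 0, ∃ ε₀ > 0, ∀ (σ₁ σ₂ : Pos n → ℝ) (k₁ k₂ : Pos n → Dir n → Dir n → ℝ)
      (u₁ u₂ v₁ v₂ b₁ b₂ : Pos n × Dir n → ℝ),
      IsExperiment X M α f g σ₁ k₁ u₁ v₁ b₁ → IsExperiment X M α f g σ₂ k₂ u₂ v₂ b₂ →
      MemLp (internalFunctional σ₁ k₁ u₁ v₁) ⊤ (volume.restrict X) ∧
      MemLp (internalFunctional σ₂ k₂ u₂ v₂) ⊤ (volume.restrict X) ∧
      ∀ ε ∈ Ioo 0 ε₀, ∀ (q : Pos n) (φ : ℝ) (a₁ a₂ : Pos n × Dir n → ℝ),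
        IsAlbedo X (fun x => modulation ε q φ x * σ₁ x)
          (fun x θ θ' => modulation ε q φ x * k₁ x θ θ') f a₁ →
        IsAlbedo X (fun x => modulation ε q φ x * σ₂ x)
          (fun x θ θ' => modulation ε q φ x * k₂ x θ θ') f a₂ →
        |exitPairing X (fun z => (a₁ - a₂) z * reflect g z)
          - entryPairing X (fun z => f z * reflect (b₁ - b₂) z)
          - ε * ∫ x in X, (internalFunctional σ₁ k₁ u₁ v₁ - internalFunctional σ₂ k₂ u₂ v₂) x *
            Real.cos (inner ℝ q x + φ)| ≤ C * ε ^ 2 := by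
  obtain ⟨C, hC, ε₀, hε₀, h⟩ := exists_first_order hn hX hf hg M hα
  refine ⟨2 * C, by positivity, ε₀, hε₀, fun σ₁ σ₂ k₁ k₂ u₁ u₂ v₁ v₂ b₁ b₂ E₁ E₂ => ?_⟩
  obtain ⟨-, m₁, e₁⟩ := h _ _ _ _ _ E₁
  obtain ⟨-, m₂, e₂⟩ := h _ _ _ _ _ E₂
  refine ⟨m₁, m₂, fun ε hε q φ a₁ a₂ A₁ A₂ => ?_⟩
  have i₁ := integrable_mul_cos (integrable_of_memLp_top hX.isBounded m₁) q φ
  have i₂ := integrable_mul_cos (integrable_of_memLp_top hX.isBounded m₂) q φ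
  have r₁ := e₁ ε hε q φ a₁ A₁
  have r₂ := e₂ ε hε q φ a₂ A₂
  rw [exitPairing_sub_mul hX A₁.1 A₂.1 hg, entryPairing_mul_sub hX E₁.albedo.1 E₂.albedo.1 hf]
  simp_rw [Pi.sub_apply, sub_mul]
  rw [integral_sub i₁ i₂]
  rw [abs_le] at r₁ r₂ ⊢
  constructor <;> linarith [r₁.1, r₁.2, r₂.1, r₂.2]

lemma enorm_le_of_abs_sub_le {ε J D K C : ℝ} (hε : 0 < ε) (hC : 0 ≤ C)
    (h : |D - K - ε * J| ≤ C * ε ^ 2) :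
    ‖J‖ₑ ≤ ENNReal.ofReal (1 / ε) * (‖D‖ₑ + ‖K‖ₑ) + ENNReal.ofReal (C * ε) := by
  have h1 : ε * |J| ≤ |D| + |K| + C * ε ^ 2 := by
    rw [← abs_of_pos hε, ← abs_mul, abs_of_pos hε]
    have e : ε * J = D - K - (D - K - ε * J) := by ring
    rw [e]
    exact (abs_sub _ _).trans (add_le_add (abs_sub _ _) h)
  have h2 : |J| ≤ 1 / ε * (|D| + |K|) + C * ε := by
    rw [← mul_le_mul_iff_right₀ hε]
    refine h1.trans (le_of_eq ?_)
    field_simp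
  simp only [Real.enorm_eq_ofReal_abs]
  rw [← ENNReal.ofReal_add (abs_nonneg _) (abs_nonneg _), ← ENNReal.ofReal_mul (by positivity),
    ← ENNReal.ofReal_add (by positivity) (by positivity)]
  exact ENNReal.ofReal_le_ofReal h2

lemma sum_phases {A : Type*} [AddCommMonoid A] (F : ℝ → A) :
    ∑ φ ∈ phases, F φ = F 0 + F (Real.pi / 2) :=
  Finset.sum_pair (by positivity)

lemma zero_mem_phases : (0 : ℝ) ∈ phases := by simp [phases]

lemma pi_div_two_mem_phases : Real.pi / 2 ∈ phases := by simp [phases]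

/-- Boundary data determine the Fourier transform of the internal functional to first order. -/
theorem exists_reconstruction (hn : 0 < n) (hX : IsSmoothBoundedDomain X)
    {f g : Pos n × Dir n → ℝ} (hf : MemLp f ⊤ (inflowMeasure X))
    (hg : MemLp g ⊤ (inflowMeasure X)) :
    ∃ R : ℝ → (Pos n → ℝ → Pos n × Dir n → ℝ) → (Pos n × Dir n → ℝ) → Pos n → ℂ,
      ∀ M α : ℝ, 0 < α → ∃ C > 0, ∃ ε₀ > 0,
      ∀ (σ : Pos n → ℝ) (k : Pos n → Dir n → Dir n → ℝ) (u v b : Pos n × Dir n → ℝ),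
        IsExperiment X M α f g σ k u v b →
        (∀ᵐ x ∂(volume.restrict X),
          Integrable (fun θ => collision σ k u (x, θ) * v (x, θ)) (sphereMeasure n)) ∧
        MemLp (internalFunctional σ k u v) ⊤ (volume.restrict X) ∧
        ∀ ε ∈ Ioo 0 ε₀, ∀ a : Pos n → ℝ → Pos n × Dir n → ℝ,
          IsModulatedAlbedo X σ k ε f a →
          ∀ q : Pos n, ‖fourierOn X (internalFunctional σ k u v) q - R ε a b q‖ ≤ C * ε := by
  set P : (Pos n × Dir n → ℝ) → (Pos n × Dir n → ℝ) → ℝ := fun a b =>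
    exitPairing X (fun z => a z * reflect g z) - entryPairing X (fun z => f z * reflect b z) with hP
  -- The boundary pairing divided by `ε` approximates the real part for phase `0` and the imaginary
  -- part for phase `π / 2`.
  refine ⟨fun ε a b q => ((P (a q 0) b / ε : ℝ) : ℂ) +
    Complex.I * ((P (a q (Real.pi / 2)) b / ε : ℝ) : ℂ), fun M α hα => ?_⟩
  obtain ⟨C, hC, ε₀, hε₀, h⟩ := exists_first_order hn hX hf hg M hα
  refine ⟨2 * C, by positivity, ε₀, hε₀, fun σ k u v b E => ?_⟩
  obtain ⟨hs, hm, he⟩ := h σ k u v b E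
  refine ⟨hs, hm, fun ε hε a ha q => ?_⟩
  have key : ∀ φ ∈ phases, |(∫ x in X, internalFunctional σ k u v x *
      Real.cos (inner ℝ q x + φ)) - P (a q φ) b / ε| ≤ C * ε := by
    intro φ hφ
    have h1 := he ε hε q φ (a q φ) (ha q φ hφ)
    set J := ∫ x in X, internalFunctional σ k u v x * Real.cos (inner ℝ q x + φ)
    have e : J - P (a q φ) b / ε = -(P (a q φ) b - ε * J) / ε := by
      have := hε.1.ne'
      field_simp
      ring
    rw [e, abs_div, abs_neg, abs_of_pos hε.1, div_le_iff₀ hε.1]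
    linarith
  refine (Complex.norm_le_abs_re_add_abs_im _).trans ?_
  have hi := integrable_of_memLp_top hX.isBounded hm
  rw [Complex.sub_re, Complex.sub_im, re_fourierOn hi, im_fourierOn hi]
  have k1 := key 0 zero_mem_phases
  have k2 := key _ pi_div_two_mem_phases
  simp only [Complex.add_re, Complex.add_im, Complex.mul_re, Complex.mul_im, Complex.I_re,
    Complex.I_im, Complex.ofReal_re, Complex.ofReal_im, zero_mul, mul_zero, one_mul, sub_zero,
    add_zero, zero_add] at k1 k2 ⊢
  linarith

/-- Stability of the Fourier transform of the internal functional. -/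
theorem exists_fourier_stability (hn : 0 < n) (hX : IsSmoothBoundedDomain X)
    {f g : Pos n × Dir n → ℝ} (hf : MemLp f ⊤ (inflowMeasure X))
    (hg : MemLp g ⊤ (inflowMeasure X)) (M : ℝ) {α : ℝ} (hα : 0 < α) :
    ∃ C' > 0, ∃ ε₀ > 0,
      ∀ (σ₁ σ₂ : Pos n → ℝ) (k₁ k₂ : Pos n → Dir n → Dir n → ℝ)
        (u₁ u₂ v₁ v₂ b₁ b₂ : Pos n × Dir n → ℝ),
        IsExperiment X M α f g σ₁ k₁ u₁ v₁ b₁ → IsExperiment X M α f g σ₂ k₂ u₂ v₂ b₂ →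
        ∀ ε ∈ Ioo 0 ε₀, ∀ a₁ a₂ : Pos n → ℝ → Pos n × Dir n → ℝ,
          IsModulatedAlbedo X σ₁ k₁ ε f a₁ → IsModulatedAlbedo X σ₂ k₂ ε f a₂ →
          ∀ q : Pos n,
            ‖fourierOn X (internalFunctional σ₁ k₁ u₁ v₁) q
                - fourierOn X (internalFunctional σ₂ k₂ u₂ v₂) q‖ₑ
              ≤ ENNReal.ofReal (2 / ε) *
                  (eLpNorm g 1 (inflowMeasure X) *
                      ∑ φ ∈ phases, eLpNorm (a₁ q φ - a₂ q φ) ⊤ (outflowMeasure X)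
                    + eLpNorm f 1 (inflowMeasure X) * eLpNorm (b₁ - b₂) ⊤ (outflowMeasure X))
                + ENNReal.ofReal (C' * ε) := by
  obtain ⟨C, hC, ε₀, hε₀, h⟩ := exists_first_order_sub hn hX hf hg M hα
  refine ⟨2 * C, by positivity, ε₀, hε₀,
    fun σ₁ σ₂ k₁ k₂ u₁ u₂ v₁ v₂ b₁ b₂ E₁ E₂ ε hε a₁ a₂ A₁ A₂ q => ?_⟩
  obtain ⟨m₁, m₂, e⟩ := h _ _ _ _ _ _ _ _ _ _ E₁ E₂
  have i₁ := integrable_of_memLp_top hX.isBounded m₁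
  have i₂ := integrable_of_memLp_top hX.isBounded m₂
  have hK := enorm_entryPairing_mul_le hX hf (E₁.albedo.1.sub E₂.albedo.1)
  have key : ∀ φ ∈ phases, ‖∫ x in X, (internalFunctional σ₁ k₁ u₁ v₁ -
      internalFunctional σ₂ k₂ u₂ v₂) x * Real.cos (inner ℝ q x + φ)‖ₑ ≤
      ENNReal.ofReal (1 / ε) * (eLpNorm g 1 (inflowMeasure X) *
        eLpNorm (a₁ q φ - a₂ q φ) ⊤ (outflowMeasure X) +
        eLpNorm f 1 (inflowMeasure X) * eLpNorm (b₁ - b₂) ⊤ (outflowMeasure X)) +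
        ENNReal.ofReal (C * ε) := by
    intro φ hφ
    have hA₁ := A₁ q φ hφ
    have hA₂ := A₂ q φ hφ
    refine (enorm_le_of_abs_sub_le hε.1 hC.le (e ε hε q φ _ _ hA₁ hA₂)).trans ?_
    gcongr
    exact enorm_exitPairing_mul_le hX (hA₁.1.sub hA₂.1) hg
  rw [← fourierOn_sub i₁ i₂]
  refine (enorm_le_enorm_re_add_enorm_im _).trans ?_
  rw [re_fourierOn (i₁.sub i₂), im_fourierOn (i₁.sub i₂)]
  refine (add_le_add (key 0 zero_mem_phases) (key _ pi_div_two_mem_phases)).trans ?_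
  have e2 : ENNReal.ofReal (2 / ε) = 2 * ENNReal.ofReal (1 / ε) := by
    rw [← ENNReal.ofReal_ofNat 2, ← ENNReal.ofReal_mul (by norm_num)]
    congr 1; ring
  have e3 : ENNReal.ofReal (2 * C * ε) = 2 * ENNReal.ofReal (C * ε) := by
    rw [← ENNReal.ofReal_ofNat 2, ← ENNReal.ofReal_mul (by norm_num), mul_assoc]
  rw [sum_phases, e2, e3]
  generalize eLpNorm (a₁ q 0 - a₂ q 0) ⊤ (outflowMeasure X) = s
  generalize eLpNorm (a₁ q (Real.pi / 2) - a₂ q (Real.pi / 2)) ⊤ (outflowMeasure X) = t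
  -- The term with `f` occurs once for each phase, whereas each term with `g` occurs once; a second
  -- copy of the latter is added to reach the common factor `2 / ε`.
  refine (le_self_add (b := ENNReal.ofReal (1 / ε) *
    (eLpNorm g 1 (inflowMeasure X) * (s + t)))).trans (le_of_eq ?_)
  ring

/-- For `n > 0` the complement of a compact set has infinite volume. -/
lemma lintegral_eq_top_of_le_cocompact (hn : 0 < n) {F : Pos n → ENNReal} {δ : ENNReal}
    (hδ : δ ≠ 0) (h : ∀ᶠ q in cocompact (Pos n), δ ≤ F q) : ∫⁻ q, F q = ⊤ := by
  have : Nonempty (Fin n) := ⟨⟨0, hn⟩⟩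
  obtain ⟨t, ht, hts⟩ := mem_cocompact.1 h
  have h1 : volume (tᶜ) = ⊤ := by
    by_contra hne
    have h2 : (volume : Measure (Pos n)) univ ≤ volume t + volume tᶜ := by
      rw [← union_compl_self t]; exact measure_union_le _ _
    rw [measure_univ_of_isAddLeftInvariant] at h2
    exact (ENNReal.add_lt_top.2 ⟨ht.measure_lt_top, lt_top_iff_ne_top.2 hne⟩).not_ge h2
  rw [eq_top_iff]
  calc ⊤ = ∫⁻ q, tᶜ.indicator (fun _ => δ) q := by
        rw [lintegral_indicator_const ht.measurableSet.compl, h1, ENNReal.mul_top hδ]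
    _ ≤ ∫⁻ q, F q := by
        refine lintegral_mono fun q => ?_
        by_cases hq : q ∈ tᶜ
        · rw [indicator_of_mem hq]; exact hts hq
        · rw [indicator_of_notMem hq]; exact zero_le

/-- Stability of the internal functional. -/
theorem exists_stability (hn : 0 < n) (hX : IsSmoothBoundedDomain X)
    {f g : Pos n × Dir n → ℝ} (hf : MemLp f ⊤ (inflowMeasure X))
    (hg : MemLp g ⊤ (inflowMeasure X)) {M α : ℝ} (hα : 0 < α)
    {σ₁ σ₂ : Pos n → ℝ} {k₁ k₂ : Pos n → Dir n → Dir n → ℝ}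
    {u₁ u₂ v₁ v₂ b₁ b₂ : Pos n × Dir n → ℝ}
    (E₁ : IsExperiment X M α f g σ₁ k₁ u₁ v₁ b₁) (E₂ : IsExperiment X M α f g σ₂ k₂ u₂ v₂ b₂) :
    ∃ C' > 0, ∃ ε₀ > 0, ∀ ε ∈ Ioo 0 ε₀, ∀ a₁ a₂ : Pos n → ℝ → Pos n × Dir n → ℝ,
      IsModulatedAlbedo X σ₁ k₁ ε f a₁ → IsModulatedAlbedo X σ₂ k₂ ε f a₂ →
      eLpNorm (internalFunctional σ₁ k₁ u₁ v₁ - internalFunctional σ₂ k₂ u₂ v₂) ⊤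
          (volume.restrict X)
        ≤ 2 * (eLpNorm g 1 (inflowMeasure X) * (modulatedNorm X (a₁ - a₂) / ENNReal.ofReal ε))
          + ENNReal.ofReal (C' * ε) := by
  have hXm := hX.isOpen.measurableSet
  obtain ⟨C, hC, ε₀, hε₀, h⟩ := exists_first_order_sub hn hX hf hg M hα
  obtain ⟨m₁, m₂, e⟩ := h _ _ _ _ _ _ _ _ _ _ E₁ E₂
  set H := internalFunctional σ₁ k₁ u₁ v₁ - internalFunctional σ₂ k₂ u₂ v₂ with hH
  have hHm : MemLp H ⊤ (volume.restrict X) := m₁.sub m₂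
  have hHi := integrable_of_memLp_top hX.isBounded hHm
  set K := entryPairing X (fun z => f z * reflect (b₁ - b₂) z) with hK
  obtain ⟨R, hR⟩ := exists_le_two_mul_lintegral_fourierOn hXm hHi hHm
  set B := Metric.closedBall (0 : Pos n) R with hB
  set V := (volume B).toReal with hV
  have hBfin : volume B ≠ ⊤ := measure_closedBall_lt_top.ne
  -- The error `3 * C * ε`, integrated over the ball, is doubled once for the two phases and once by
  -- the choice of `R`; the summand 1 ensures positivity.
  refine ⟨12 * C * V + 1, by positivity, ε₀, hε₀, fun ε hε a₁ a₂ A₁ A₂ => ?_⟩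
  have hε0 := hε.1
  -- In the infinite case the right side is infinite. When `g` has norm zero and the modulated norm
  -- is infinite, the product is zero and belongs to the finite case.
  by_cases hfin : eLpNorm g 1 (inflowMeasure X) *
      (modulatedNorm X (a₁ - a₂) / ENNReal.ofReal ε) = ⊤
  · rw [hfin]; simp
  set D : Pos n → ℝ → ℝ := fun q φ =>
    exitPairing X (fun z => (a₁ q φ - a₂ q φ) z * reflect g z) with hD
  set J : Pos n → ℝ → ℝ := fun q φ => ∫ x in X, H x * Real.cos (inner ℝ q x + φ) with hJ
  have hDJ : ∀ q, ∀ φ ∈ phases, |D q φ - K - ε * J q φ| ≤ C * ε ^ 2 := fun q φ hφ =>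
    e ε hε q φ _ _ (A₁ q φ hφ) (A₂ q φ hφ)
  have := isFiniteMeasure_inflow hX
  have hg1 : eLpNorm g 1 (inflowMeasure X) ≠ ⊤ := (hg.mono_exponent le_top).2.ne
  have hDle : ∀ φ ∈ phases, ∫⁻ q, ‖D q φ‖ₑ ≤ eLpNorm g 1 (inflowMeasure X) *
      ∫⁻ q, eLpNorm ((a₁ - a₂) q φ) ⊤ (outflowMeasure X) := by
    intro φ hφ
    -- The data need not be measurable in `q`; the finiteness of the constant takes the place of
    -- measurability.
    rw [← lintegral_const_mul' _ _ hg1]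
    exact lintegral_mono fun q =>
      enorm_exitPairing_mul_le hX ((A₁ q φ hφ).1.sub (A₂ q φ hφ).1) hg
  have hsum : ENNReal.ofReal (1 / ε) * (∫⁻ q, ‖D q 0‖ₑ) +
      ENNReal.ofReal (1 / ε) * (∫⁻ q, ‖D q (Real.pi / 2)‖ₑ) ≤
      eLpNorm g 1 (inflowMeasure X) * (modulatedNorm X (a₁ - a₂) / ENNReal.ofReal ε) := by
    rw [modulatedNorm, sum_phases, one_div, ENNReal.ofReal_inv_of_pos hε0]
    refine (add_le_add (mul_le_mul_right (hDle 0 zero_mem_phases) _)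
      (mul_le_mul_right (hDle _ pi_div_two_mem_phases) _)).trans (le_of_eq ?_)
    simp only [Pi.sub_apply]
    generalize ∫⁻ q, eLpNorm (a₁ q 0 - a₂ q 0) ⊤ (outflowMeasure X) = s
    generalize ∫⁻ q, eLpNorm (a₁ q (Real.pi / 2) - a₂ q (Real.pi / 2)) ⊤ (outflowMeasure X) = t
    rw [ENNReal.div_eq_inv_mul]
    ring
  have hD0 : ∫⁻ q, ‖D q 0‖ₑ ≠ ⊤ := by
    intro htop
    refine hfin (eq_top_iff.2 (le_trans ?_ hsum))
    rw [htop, ENNReal.mul_top (by simpa using hε0)]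
    exact le_self_add
  -- `K` is independent of `q`, and `J q 0` tends to zero by the Riemann-Lebesgue lemma. If the
  -- bound failed, `D q 0` would stay away from zero outside a compact set and its integral would be
  -- infinite.
  have hKle : |K| ≤ 2 * C * ε ^ 2 := by
    by_contra! hlt
    refine hD0 (lintegral_eq_top_of_le_cocompact hn
      (δ := ENNReal.ofReal (|K| - 2 * C * ε ^ 2)) (by simpa using hlt) ?_)
    have hCε : 0 < C * ε := by positivity
    filter_upwards [(tendsto_fourierOn hXm H).norm.eventually
      (gt_mem_nhds (by simpa using hCε))] with q hq
    have h1 : |J q 0| < C * ε := by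
      have := Complex.abs_re_le_norm (fourierOn X H q)
      rw [re_fourierOn hHi] at this
      exact this.trans_lt hq
    have h2 := hDJ q 0 zero_mem_phases
    rw [Real.enorm_eq_ofReal_abs]
    refine ENNReal.ofReal_le_ofReal ?_
    have h3 : |K| ≤ |D q 0| + |ε * J q 0| + |D q 0 - K - ε * J q 0| := by
      have e : K = D q 0 - ε * J q 0 - (D q 0 - K - ε * J q 0) := by ring
      calc |K| = |D q 0 - ε * J q 0 - (D q 0 - K - ε * J q 0)| := by rw [← e]
        _ ≤ _ := (abs_sub _ _).trans (add_le_add_left (abs_sub _ _) _)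
    have h4 : |ε * J q 0| ≤ C * ε ^ 2 := by
      rw [abs_mul, abs_of_pos hε0]
      nlinarith
    linarith
  have hJle : ∀ φ ∈ phases, ∫⁻ q in B, ‖J q φ‖ₑ ≤
      ENNReal.ofReal (1 / ε) * (∫⁻ q, ‖D q φ‖ₑ) + ENNReal.ofReal (3 * C * ε) * volume B := by
    intro φ hφ
    calc ∫⁻ q in B, ‖J q φ‖ₑ
        ≤ ∫⁻ q in B, (ENNReal.ofReal (1 / ε) * ‖D q φ‖ₑ + ENNReal.ofReal (3 * C * ε)) := by
          refine lintegral_mono fun q => ?_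
          -- Dropping `K` costs `2 * C * ε ^ 2` on top of the first-order error `C * ε ^ 2`.
          have h1 : |D q φ - 0 - ε * J q φ| ≤ 3 * C * ε ^ 2 := by
            have h2 := hDJ q φ hφ
            rw [abs_le] at h2 hKle ⊢
            constructor <;> linarith [h2.1, h2.2, hKle.1, hKle.2]
          simpa using enorm_le_of_abs_sub_le hε0 (by positivity) h1
      _ ≤ _ := by
          rw [lintegral_add_right _ measurable_const, lintegral_const_mul' _ _ (by simp),
            setLIntegral_const]
          gcongr
          exact Measure.restrict_le_self
  have hF := continuous_fourierOn hXm hHi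
  have hFle : ∫⁻ q in B, ‖fourierOn X H q‖ₑ ≤
      (∫⁻ q in B, ‖J q 0‖ₑ) + ∫⁻ q in B, ‖J q (Real.pi / 2)‖ₑ := by
    simp_rw [hJ, ← re_fourierOn hHi, ← im_fourierOn hHi]
    have hre : Measurable fun q => ‖(fourierOn X H q).re‖ₑ :=
      (Complex.continuous_re.comp hF).enorm.measurable
    rw [← lintegral_add_left hre]
    exact lintegral_mono fun q => enorm_le_enorm_re_add_enorm_im _
  have hconst : 2 * (ENNReal.ofReal (3 * C * ε) * volume B + ENNReal.ofReal (3 * C * ε) * volume B)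
      ≤ ENNReal.ofReal ((12 * C * V + 1) * ε) := by
    rw [← ENNReal.ofReal_toReal hBfin, ← hV, ← ENNReal.ofReal_mul (by positivity),
      ← ENNReal.ofReal_add (by positivity) (by positivity), ← ENNReal.ofReal_ofNat 2,
      ← ENNReal.ofReal_mul (by norm_num)]
    exact ENNReal.ofReal_le_ofReal (by nlinarith)
  calc eLpNorm H ⊤ (volume.restrict X) ≤ 2 * ∫⁻ q in B, ‖fourierOn X H q‖ₑ := hR
    _ ≤ 2 * ((ENNReal.ofReal (1 / ε) * (∫⁻ q, ‖D q 0‖ₑ) + ENNReal.ofReal (3 * C * ε) * volume B) +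
        (ENNReal.ofReal (1 / ε) * (∫⁻ q, ‖D q (Real.pi / 2)‖ₑ) +
          ENNReal.ofReal (3 * C * ε) * volume B)) := by
        gcongr
        exact hFle.trans (add_le_add (hJle 0 zero_mem_phases) (hJle _ pi_div_two_mem_phases))
    _ = 2 * (ENNReal.ofReal (1 / ε) * (∫⁻ q, ‖D q 0‖ₑ) +
          ENNReal.ofReal (1 / ε) * (∫⁻ q, ‖D q (Real.pi / 2)‖ₑ)) +
        2 * (ENNReal.ofReal (3 * C * ε) * volume B + ENNReal.ofReal (3 * C * ε) * volume B) := by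
        rw [add_add_add_comm, mul_add]
    _ ≤ _ := add_le_add (by gcongr) hconst

end Stability

end AcoustoOptic

/-! ### Assembly of the reconstruction and stability statements. -/

theorem proposition1p2 {n : ℕ} (hn : 2 ≤ n) (X : Set (Pos n)) (hX : IsSmoothBoundedDomain X) :
    -- `H ∈ L^∞(X)`, and the data determine `H` up to order `ε`
    (∀ f g : Pos n × Dir n → ℝ,
      MemLp f ⊤ (inflowMeasure X) → MemLp g ⊤ (inflowMeasure X) →
      ∃ R : ℝ → (Pos n → ℝ → Pos n × Dir n → ℝ) → (Pos n × Dir n → ℝ) → Pos n → ℂ,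
      ∀ M α : ℝ, 0 < α → ∃ C > 0, ∃ ε₀ > 0,
      ∀ (σ : Pos n → ℝ) (k : Pos n → Dir n → Dir n → ℝ) (u v b : Pos n × Dir n → ℝ),
        IsExperiment X M α f g σ k u v b →
        (∀ᵐ x ∂(volume.restrict X),
          Integrable (fun θ => collision σ k u (x, θ) * v (x, θ)) (sphereMeasure n)) ∧
        MemLp (internalFunctional σ k u v) ⊤ (volume.restrict X) ∧
        ∀ ε ∈ Ioo 0 ε₀, ∀ a : Pos n → ℝ → Pos n × Dir n → ℝ,
          IsModulatedAlbedo X σ k ε f a →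
          ∀ q : Pos n, ‖fourierOn X (internalFunctional σ k u v) q - R ε a b q‖ ≤ C * ε) ∧
    -- stability
    (∃ C > 0, ∀ f g : Pos n × Dir n → ℝ,
      MemLp f ⊤ (inflowMeasure X) → MemLp g ⊤ (inflowMeasure X) →
      ∀ M α : ℝ, 0 < α →
      -- of the Fourier transform of `H`, with an error that is uniform over the coefficients
      (∃ C' > 0, ∃ ε₀ > 0,
        ∀ (σ₁ σ₂ : Pos n → ℝ) (k₁ k₂ : Pos n → Dir n → Dir n → ℝ)
          (u₁ u₂ v₁ v₂ b₁ b₂ : Pos n × Dir n → ℝ),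
          IsExperiment X M α f g σ₁ k₁ u₁ v₁ b₁ → IsExperiment X M α f g σ₂ k₂ u₂ v₂ b₂ →
          ∀ ε ∈ Ioo 0 ε₀, ∀ a₁ a₂ : Pos n → ℝ → Pos n × Dir n → ℝ,
            IsModulatedAlbedo X σ₁ k₁ ε f a₁ → IsModulatedAlbedo X σ₂ k₂ ε f a₂ →
            ∀ q : Pos n,
              ‖fourierOn X (internalFunctional σ₁ k₁ u₁ v₁) q
                  - fourierOn X (internalFunctional σ₂ k₂ u₂ v₂) q‖ₑ
                ≤ ENNReal.ofReal (C / ε) *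
                    (eLpNorm g 1 (inflowMeasure X) *
                        ∑ φ ∈ phases, eLpNorm (a₁ q φ - a₂ q φ) ⊤ (outflowMeasure X)
                      + eLpNorm f 1 (inflowMeasure X) * eLpNorm (b₁ - b₂) ⊤ (outflowMeasure X))
                  + ENNReal.ofReal (C' * ε)) ∧
      -- of `H` in `L^∞(X)`
      (∀ (σ₁ σ₂ : Pos n → ℝ) (k₁ k₂ : Pos n → Dir n → Dir n → ℝ)
          (u₁ u₂ v₁ v₂ b₁ b₂ : Pos n × Dir n → ℝ),
          IsExperiment X M α f g σ₁ k₁ u₁ v₁ b₁ → IsExperiment X M α f g σ₂ k₂ u₂ v₂ b₂ →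
          ∃ C' > 0, ∃ ε₀ > 0, ∀ ε ∈ Ioo 0 ε₀, ∀ a₁ a₂ : Pos n → ℝ → Pos n × Dir n → ℝ,
            IsModulatedAlbedo X σ₁ k₁ ε f a₁ → IsModulatedAlbedo X σ₂ k₂ ε f a₂ →
            eLpNorm (internalFunctional σ₁ k₁ u₁ v₁ - internalFunctional σ₂ k₂ u₂ v₂) ⊤
                (volume.restrict X)
              ≤ ENNReal.ofReal C *
                  (eLpNorm g 1 (inflowMeasure X) * (modulatedNorm X (a₁ - a₂) / ENNReal.ofReal ε)
                    + eLpNorm f 1 (inflowMeasure X) * eLpNorm (b₁ - b₂) ⊤ (outflowMeasure X))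
                + ENNReal.ofReal (C' * ε))) := by
  have hn0 : 0 < n := by omega
  -- The common constant 2 comes from the two phases in (a) and from the choice of the ball in (b).
  refine ⟨fun f g hf hg => exists_reconstruction hn0 hX hf hg, 2, two_pos, fun f g hf hg M α hα =>
    ⟨exists_fourier_stability hn0 hX hf hg M hα, ?_⟩⟩
  intro σ₁ σ₂ k₁ k₂ u₁ u₂ v₁ v₂ b₁ b₂ E₁ E₂
  obtain ⟨C', hC', ε₀, hε₀, h⟩ := exists_stability hn0 hX hf hg hα E₁ E₂
  refine ⟨C', hC', ε₀, hε₀, fun ε hε a₁ a₂ A₁ A₂ => (h ε hε a₁ a₂ A₁ A₂).trans ?_⟩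
  rw [ENNReal.ofReal_ofNat]
  gcongr
  -- The term with `𝒜(g)` is merely added: its contribution has already been absorbed into `O(ε)`.
  exact le_self_add
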